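/- Let $k$ be a finite field with $|k|=q$, and let $Q$ be a tame quiver with vertex set $\{1,\dots,n\}$, i.e. an acyclic quiver whose underlying diagram is an extended Dynkin diagram of type $\widetilde A_n$, $\widetilde D_n$ or $\widetilde E_{6,7,8}$. Put $b_{ij}=\#\{i\to j\}-\#\{j\to i\}$ and assume that $Q$ is graded: there is a linear form $\epsilon$ on $\mathbb Z^n$ with $\epsilon(B\alpha_i)<0$ for $1\le i\le n$, where $B=(b_{ij})$ and $\alpha_i$ is the $i$-th standard basis vector. Let $\widetilde Q$ be obtained from $Q$ by adding frozen vertices $n+1,\dots,2n$ and one arrow $n+i\to i$ for each $1\le i\le n$. Let $\widetilde B=(b_{ij})$ be its $2n\times n$ matrix ($1\le i\le 2n$, $1\le j\le n$), $\widetilde I=\begin{bmatrix}I_n\\0\end{bmatrix}$, $\widetilde R=(\widetilde r_{ij})$ with $\widetilde r_{ij}=\#\{j\to i\}$, and let $\Lambda$ be an antisymmetric integer $2n\times 2n$ matrix with $\Lambda(-\widetilde B)=\widetilde I$. Write $\Lambda(e,f)=e^{tr}\Lambda f$. Let $\mathcal T$ be the quantum torus over $\mathbb Z[q^{\pm 1/2}]$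 with basis $X^e$ ($e\in\mathbb Z^{2n}$) and multiplication $X^eX^f=q^{\frac12\Lambda(e,f)}X^{e+f}$. Modules are finite-dimensional, in the convention $\dim_k\mathrm{Ext}^1(S_i,S_j)=\#\{j\to i\}$ for the simple modules $S_i$. Denote by $\langle\ ,\ \rangle$ the Euler form. For a $kQ$-module $M$ with dimension vector $\underline m$ and an injective $k\widetilde Q$-module $I$ put $$X_{M\oplus I[-1]}=\sum_{\underline e}|\mathrm{Gr}_{\underline e}M|\,q^{-\frac12\langle \underline e,\underline m-\underline e\rangle}X^{\widetilde B\underline e-(\widetilde I-\widetilde R)\underline m+\underline{\dim}\,\mathrm{soc}\,I},\qquad X_M=X_{M\oplus 0},$$ where $\mathrm{Gr}_{\underline e}M$ is the set of submodules of $M$ of dimension vector $\underline e$. Let $E_1,\dots,E_r$ ($r\ge 2$) be the pairwise non-isomorphic regular simple $kQ$-modules of a non-homogeneous tube of rank $r$, numbered with indices modulo $r$ so that $\tau_QE_{j+1}\cong E_j$, where $\tau_Q$ is the Auslander–Reiten translation. Let $E_i[l]$ be the indecomposable regular module with quasi-socle $E_i$ and quasi-length $l$, and $E_i[0]=0$.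 Then, for every $i$, $$X_{E_i[r-1]}X_{E_{i-1}}=q^{\frac12\lambda}X_{E_i[r]}+q^{\frac12\lambda-\frac12}X_{E_i[r-2]\oplus I[-1]},\qquad \lambda=\Lambda\big((\widetilde I-\widetilde R)\,\underline{\dim}\,E_i[r-1],\ (\widetilde I-\widetilde R)\,\underline{\dim}\,E_{i-1}\big),$$ where $I=\bigoplus_{j=1}^n I_{n+j}^{\oplus(\underline{\dim}E_{i-1})_j}$ and $I_{n+j}$ is the indecomposable injective $k\widetilde Q$-module with socle $S_{n+j}$. -/

import Mathlib

universe u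

noncomputable section

namespace QuiverCC

/-! ## Quantum tori -/

/-- The based quantum torus of `(ℤ^ι, Λ)` over a commutative ring `R` with a chosen unit `t`
(which plays the role of `q^{1/2}`): the free `R`-module with basis `X^e`, `e ∈ ℤ^ι`. -/
def QuantumTorus (R : Type*) [CommRing R] (_t : Rˣ) {ι : Type*} [Fintype ι]
    (_Λ : Matrix ι ι ℤ) : Type _ :=
  (ι → ℤ) →₀ R

/-- The bilinear form `Λ(e, f) = eᵗ Λ f`. -/
def form {ι : Type*} [Fintype ι] (Λ : Matrix ι ι ℤ) (e f : ι → ℤ) : ℤ :=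
  e ⬝ᵥ Λ.mulVec f

namespace QuantumTorus

variable {R : Type*} [CommRing R] {t : Rˣ} {ι : Type*} [Fintype ι] {Λ : Matrix ι ι ℤ}

instance : AddCommGroup (QuantumTorus R t Λ) := inferInstanceAs (AddCommGroup ((ι → ℤ) →₀ R))

instance : Module R (QuantumTorus R t Λ) := inferInstanceAs (Module R ((ι → ℤ) →₀ R))

/-- The basis element `X^e`. -/
def X (e : ι → ℤ) : QuantumTorus R t Λ := Finsupp.single e 1

/-- The `R`-linear map out of the quantum torus with prescribed values on the basis. -/
def extend {N : Type*} [AddCommMonoid N] [Module R N] (v : (ι → ℤ) → N) :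
    QuantumTorus R t Λ →ₗ[R] N :=
  Finsupp.linearCombination R v

theorem extend_X {N : Type*} [AddCommMonoid N] [Module R N] (v : (ι → ℤ) → N) (e : ι → ℤ) :
    (extend v : QuantumTorus R t Λ →ₗ[R] N) (X e) = v e := by
  exact (Finsupp.linearCombination_single R (1 : R) e).trans (one_smul R (v e))

theorem induction_X {p : QuantumTorus R t Λ → Prop} (a : QuantumTorus R t Λ) (h0 : p 0)
    (hadd : ∀ a b, p a → p b → p (a + b)) (hX : ∀ (r : R) (e : ι → ℤ), p (r • X e)) : p a := by
  refine Finsupp.induction_linear (motive := p) a h0 hadd fun e r => ?_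
  have h : (r • X e : QuantumTorus R t Λ) = Finsupp.single e r := by
    change r • Finsupp.single e (1 : R) = _
    rw [Finsupp.smul_single, smul_eq_mul, mul_one]
  exact h ▸ hX r e

/-- The multiplication: the bilinear extension of `X^e X^f = q^{Λ(e,f)/2} X^{e+f}`. -/
def mulLin : QuantumTorus R t Λ →ₗ[R] QuantumTorus R t Λ →ₗ[R] QuantumTorus R t Λ :=
  extend fun e => extend fun f => ((t ^ form Λ e f : Rˣ) : R) • X (e + f)

theorem mulLin_X (e f : ι → ℤ) :
    mulLin (X e : QuantumTorus R t Λ) (X f) = ((t ^ form Λ e f : Rˣ) : R) • X (e + f) := by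
  simp [mulLin, extend_X]

theorem mulLin_assoc (a b c : QuantumTorus R t Λ) :
    mulLin (mulLin a b) c = mulLin a (mulLin b c) := by
  refine induction_X (p := fun a => mulLin (mulLin a b) c = mulLin a (mulLin b c)) a
    (by simp) (fun x y hx hy => by simp [hx, hy]) fun r e => ?_
  refine induction_X (p := fun b => mulLin (mulLin (r • X e) b) c =
    mulLin (r • X e) (mulLin b c)) b
    (by simp) (fun x y hx hy => by simp only [map_add, LinearMap.add_apply, hx, hy])
    fun s f => ?_
  refine induction_X (p := fun c => mulLin (mulLin (r • X e) (s • X f)) c =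
    mulLin (r • X e) (mulLin (s • X f) c)) c
    (by simp) (fun x y hx hy => by simp only [map_add, hx, hy]) fun w g => ?_
  simp only [map_smul, LinearMap.smul_apply, mulLin_X, smul_smul]
  rw [add_assoc e f g]
  congr 1
  have h : form Λ e f + form Λ (e + f) g = form Λ f g + form Λ e (f + g) := by
    simp only [form, add_dotProduct, Matrix.mulVec_add, dotProduct_add]
    ring
  have h2 : ((t ^ form Λ e f : Rˣ) : R) * ((t ^ form Λ (e + f) g : Rˣ) : R) =
      ((t ^ form Λ f g : Rˣ) : R) * ((t ^ form Λ e (f + g) : Rˣ) : R) := by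
    rw [← Units.val_mul, ← Units.val_mul, ← zpow_add, ← zpow_add, h]
  linear_combination (w * r * s) * h2

theorem one_mulLin (a : QuantumTorus R t Λ) : mulLin (X 0) a = a := by
  refine induction_X (p := fun a => mulLin (X 0) a = a) a (by simp) (fun x y hx hy => by simp [hx, hy]) fun r e => ?_
  simp [mulLin_X, form]

theorem mulLin_one (a : QuantumTorus R t Λ) : mulLin a (X 0) = a := by
  refine induction_X (p := fun a => mulLin a (X 0) = a) a (by simp) (fun x y hx hy => by simp [hx, hy]) fun r e => ?_
  simp [mulLin_X, form]

instance : Ring (QuantumTorus R t Λ) where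
  __ := (inferInstance : AddCommGroup (QuantumTorus R t Λ))
  mul a b := mulLin a b
  one := X 0
  left_distrib a b c := map_add (mulLin a) b c
  right_distrib a b c := by
    change mulLin (a + b) c = mulLin a c + mulLin b c
    simp
  zero_mul a := by
    change mulLin 0 a = 0
    simp
  mul_zero a := map_zero (mulLin a)
  mul_assoc := mulLin_assoc
  one_mul := one_mulLin
  mul_one := mulLin_one

theorem X_mul_X (e f : ι → ℤ) :
    (X e * X f : QuantumTorus R t Λ) = (t ^ form Λ e f) • X (e + f) :=
  mulLin_X e f

end QuantumTorus

/-- The ring `ℤ[|k|^{±1/2}]`, as a subring of the real numbers. -/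
def halfRing (k : Type*) : Subring ℝ :=
  Subring.closure {√(Nat.card k : ℝ), (√(Nat.card k : ℝ))⁻¹}

/-- The unit `|k|^{1/2}` of `ℤ[|k|^{±1/2}]`. -/
def sqrtCard (k : Type*) [Field k] [Finite k] : (halfRing k)ˣ where
  val := ⟨√(Nat.card k : ℝ), Subring.subset_closure (by simp)⟩
  inv := ⟨(√(Nat.card k : ℝ))⁻¹, Subring.subset_closure (by simp)⟩
  val_inv := Subtype.ext (mul_inv_cancel₀
    (Real.sqrt_ne_zero'.2 (Nat.cast_pos.2 Nat.card_pos)))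
  inv_val := Subtype.ext (inv_mul_cancel₀
    (Real.sqrt_ne_zero'.2 (Nat.cast_pos.2 Nat.card_pos)))

/-! ## Acyclic, tame and graded quivers; the ice quiver -/

/-- A quiver is acyclic if it has no closed path of positive length. -/
def IsAcyclic (V : Type u) [Quiver.{u} V] : Prop :=
  ∀ (v : V) (p : Quiver.Path v v), p.length = 0

/-- The number of arrows from `i` to `j`. -/
def numArrows {V : Type u} [Quiver.{u} V] (i j : V) : ℕ := Nat.card (i ⟶ j)

/-- The number of edges between two vertices of the cycle on `n + 1 ≥ 2` vertices
(for `n = 1` this is the graph with two vertices joined by a double edge). -/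
def edgesA (n : ℕ) (i j : Fin (n + 1)) : ℕ :=
  (if j = i + 1 then 1 else 0) + (if i = j + 1 then 1 else 0)

/-- The number of edges between `i` and `j` in the simple graph with the given list of edges. -/
def edgesOf (l : List (ℕ × ℕ)) (i j : ℕ) : ℕ := if (i, j) ∈ l ∨ (j, i) ∈ l then 1 else 0

/-- The diagram on `0, …, n`, `n ≥ 4`: a path `1 - 2 - ⋯ - (n-1)`, with `0` attached to `2` and
`n` attached to `n - 2`. -/
def listD (n : ℕ) : List (ℕ × ℕ) :=
  (0, 2) :: (n - 2, n) :: (List.range (n - 2)).map fun i => (i + 1, i + 2)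

/-- The star with arms of lengths `2, 2, 2`, on `0, …, 6`. -/
def listE6 : List (ℕ × ℕ) := [(0, 1), (1, 2), (2, 3), (3, 4), (2, 5), (5, 6)]

/-- The star with arms of lengths `1, 3, 3`, on `0, …, 7`. -/
def listE7 : List (ℕ × ℕ) := [(0, 1), (1, 2), (2, 3), (3, 4), (4, 5), (5, 6), (3, 7)]

/-- The star with arms of lengths `1, 2, 5`, on `0, …, 8`. -/
def listE8 : List (ℕ × ℕ) :=
  [(0, 1), (1, 2), (2, 3), (3, 4), (4, 5), (5, 6), (6, 7), (2, 8)]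

/-- `mult i j`, the number of edges between `i` and `j`, is one of the extended Dynkin diagrams
`Ã_n (n ≥ 1)`, `D̃_n (n ≥ 4)`, `Ẽ_6`, `Ẽ_7`, `Ẽ_8`, up to relabelling the vertices. -/
def IsExtendedDynkin {V : Type u} (mult : V → V → ℕ) : Prop :=
  (∃ n, 1 ≤ n ∧ ∃ e : V ≃ Fin (n + 1), ∀ i j, mult i j = edgesA n (e i) (e j)) ∨
  (∃ n, 4 ≤ n ∧ ∃ e : V ≃ Fin (n + 1), ∀ i j, mult i j = edgesOf (listD n) (e i) (e j)) ∨
  (∃ e : V ≃ Fin 7, ∀ i j, mult i j = edgesOf listE6 (e i) (e j)) ∨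
  (∃ e : V ≃ Fin 8, ∀ i j, mult i j = edgesOf listE7 (e i) (e j)) ∨
  (∃ e : V ≃ Fin 9, ∀ i j, mult i j = edgesOf listE8 (e i) (e j))

/-- A tame quiver: an acyclic quiver whose underlying diagram is an extended Dynkin diagram. -/
def IsTameQuiver (V : Type u) [Quiver.{u} V] : Prop :=
  IsAcyclic V ∧ IsExtendedDynkin fun i j : V => numArrows i j + numArrows j i

/-- The exchange matrix of a quiver: `b_{ij} = #(i → j) - #(j → i)`. -/
def matB (V : Type u) [Quiver.{u} V] : Matrix V V ℤ :=
  Matrix.of fun i j => (numArrows i j : ℤ) - numArrows j i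

/-- A quiver is graded if some linear form `ε` on `ℤ^V` satisfies `ε(B αᵢ) < 0` for all `i`, where
`αᵢ` is the standard basis (so that `B αᵢ` is the `i`-th column of `B`). -/
def IsGraded (V : Type u) [Quiver.{u} V] : Prop :=
  ∃ ε : (V → ℤ) →ₗ[ℤ] ℤ, ∀ i, ε (fun j => matB V j i) < 0

/-- The ice quiver `Q̃` on `V ⊕ V`: the quiver `Q` on the principal vertices `inl i`, a frozen
vertex `inr i` for each `i`, and one arrow `inr i ⟶ inl i` for each `i`. -/
instance iceQuiver (V : Type u) [Quiver.{u} V] : Quiver.{u} (V ⊕ V) where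
  Hom
    | .inl i, .inl j => i ⟶ j
    | .inr i, .inl j => ULift.{u} (PLift (i = j))
    | .inl _, .inr _ => PEmpty
    | .inr _, .inr _ => PEmpty

/-- The matrix `B̃`, with rows indexed by all and columns by the principal vertices of `Q̃`. -/
def matBt (V : Type u) [Quiver.{u} V] : Matrix (V ⊕ V) V ℤ :=
  Matrix.of fun i j => (numArrows i (Sum.inl j) : ℤ) - numArrows (Sum.inl j) i

/-- The matrix `Ĩ`: the columns of the identity matrix at the principal vertices. -/
def matIt (V : Type u) [DecidableEq V] : Matrix (V ⊕ V) V ℤ :=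
  Matrix.of fun i j => if i = Sum.inl j then 1 else 0

/-- The matrix `R̃`, with entries `dim Ext¹(S_i, S_j) = #(j → i)`. -/
def matRt (V : Type u) [Quiver.{u} V] : Matrix (V ⊕ V) V ℤ :=
  Matrix.of fun i j => (numArrows (Sum.inl j) i : ℤ)

/-! ## Representations -/

/-- A `kQ`-module, in the convention in which `dim Ext¹(S_i, S_j)` is the number of arrows
`j ⟶ i`: a vector space at each vertex and a linear map `M_j → M_i` for each arrow `i ⟶ j`. -/
structure QRep (k V : Type u) [Field k] [Quiver.{u} V] where
  obj : V → Type u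
  [addCommGroup : ∀ v, AddCommGroup (obj v)]
  [module : ∀ v, Module k (obj v)]
  map : ∀ {i j : V}, (i ⟶ j) → obj j →ₗ[k] obj i

attribute [instance] QRep.addCommGroup QRep.module

namespace QRep

variable {k V : Type u} [Field k] [Quiver.{u} V]

/-- Finite-dimensional modules. -/
def IsFD (M : QRep k V) : Prop := ∀ v, FiniteDimensional k (M.obj v)

/-- The zero module. -/
def IsZero (M : QRep k V) : Prop := ∀ v, Subsingleton (M.obj v)

/-- Isomorphism of modules. -/
def Iso (M N : QRep k V) : Prop :=
  ∃ f : ∀ v, M.obj v ≃ₗ[k] N.obj v,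
    ∀ (i j : V) (a : i ⟶ j) (x : M.obj j), f i (M.map a x) = N.map a (f j x)

/-- The dimension vector. -/
def dimVec (M : QRep k V) : V → ℕ := fun v => Module.finrank k (M.obj v)

/-- A family of subspaces is a submodule if it is stable under all arrows. -/
def IsSub (M : QRep k V) (U : ∀ v, Submodule k (M.obj v)) : Prop :=
  ∀ (i j : V) (a : i ⟶ j), U j ≤ (U i).comap (M.map a)

/-- A submodule, as a module. -/
def restrict (M : QRep k V) (U : ∀ v, Submodule k (M.obj v)) (hU : M.IsSub U) : QRep k V where
  obj v := U v
  map {i j} a := (M.map a).restrict (hU i j a)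

/-- The quotient by a submodule. -/
def quot (M : QRep k V) (U : ∀ v, Submodule k (M.obj v)) (hU : M.IsSub U) : QRep k V where
  obj v := M.obj v ⧸ U v
  map {i j} a := (U j).mapQ (U i) (M.map a) (hU i j a)

/-- The subquotient `W / (U ∩ W)`. -/
def subquot (M : QRep k V) (U W : ∀ v, Submodule k (M.obj v)) (hU : M.IsSub U)
    (hW : M.IsSub W) : QRep k V :=
  (M.restrict W hW).quot (fun v => (U v).comap (W v).subtype) fun i j a _ hx => hU i j a hx

/-- Indecomposable modules: nonzero, and in a decomposition `M = U ⊕ W` one summand is zero. -/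
def Indec (M : QRep k V) : Prop :=
  ¬ M.IsZero ∧ ∀ U W : ∀ v, Submodule k (M.obj v), M.IsSub U → M.IsSub W →
    (∀ v, IsCompl (U v) (W v)) → (∀ v, U v = ⊥) ∨ (∀ v, W v = ⊥)

/-- The quiver Grassmannian `Gr_e(M)`: the submodules of dimension vector `e`. -/
def Gr (M : QRep k V) (e : V → ℕ) : Set (∀ v, Submodule k (M.obj v)) :=
  {U | M.IsSub U ∧ ∀ v, Module.finrank k (U v) = e v}

/-- The indecomposable projective module `P_v`: at `w` it has the paths from `w` to `v` as basis. -/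
def proj (k : Type u) {V : Type u} [Field k] [Quiver.{u} V] (v : V) : QRep k V where
  obj w := Quiver.Path w v →₀ k
  map a := Finsupp.lmapDomain k k fun p => a.toPath.comp p

/-- The map `P_v → P_w` given by an arrow `v ⟶ w`. -/
def projMap (k : Type u) {V : Type u} [Field k] [Quiver.{u} V] {v w : V} (a : v ⟶ w) (x : V) :
    (proj k v).obj x →ₗ[k] (proj k w).obj x :=
  Finsupp.lmapDomain k k fun p => p.cons a

theorem projMap_map {v w : V} (a : v ⟶ w) {i j : V} (b : i ⟶ j) (y : (proj k v).obj j) :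
    projMap k a i ((proj k v).map b y) = (proj k w).map b (projMap k a j y) := by
  have h : ∀ y : Quiver.Path j v →₀ k,
      Finsupp.mapDomain (fun p : Quiver.Path i v => p.cons a)
        (Finsupp.mapDomain (fun p => b.toPath.comp p) y) =
      Finsupp.mapDomain (fun p : Quiver.Path j w => b.toPath.comp p)
        (Finsupp.mapDomain (fun p => p.cons a) y) := fun y => by
    rw [← Finsupp.mapDomain_comp, ← Finsupp.mapDomain_comp]
    rfl
  exact h y

/-- The indecomposable injective module `I_v`: at `w`, the dual of the space with the paths from
`v` to `w` as basis. -/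
def inj (k : Type u) {V : Type u} [Field k] [Quiver.{u} V] (v : V) : QRep k V where
  obj w := Quiver.Path v w → k
  map a := LinearMap.funLeft k k fun p => p.cons a

/-- The differential `⊕_v Hom(M_v, N_v) → ⊕_{a : i → j} Hom(M_j, N_i)`; its kernel is `Hom(M, N)`
and its cokernel is `Ext¹(M, N)`. -/
def extDiff (M N : QRep k V) :
    (∀ v, M.obj v →ₗ[k] N.obj v) →ₗ[k] (∀ i j : V, (i ⟶ j) → (M.obj j →ₗ[k] N.obj i)) where
  toFun f i j a := N.map a ∘ₗ f j - f i ∘ₗ M.map a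
  map_add' f g := by
    ext i j a x
    simp only [LinearMap.sub_apply, LinearMap.comp_apply, Pi.add_apply, LinearMap.add_apply,
      map_add]
    abel
  map_smul' c f := by
    ext i j a x
    simp [smul_sub]

/-- `Ext¹(M, N)`, computed from the standard projective resolution of `M`. -/
abbrev Ext1 (M N : QRep k V) : Type u :=
  (∀ i j : V, (i ⟶ j) → (M.obj j →ₗ[k] N.obj i)) ⧸ LinearMap.range (extDiff M N)

/-- The map `Ext¹(M, P_v) → Ext¹(M, P_w)` given by an arrow `v ⟶ w`. -/
def extMap (M : QRep k V) {v w : V} (a : v ⟶ w) : Ext1 M (proj k v) →ₗ[k] Ext1 M (proj k w) :=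
  Submodule.mapQ _ _
    { toFun := fun φ i j b => projMap k a i ∘ₗ φ i j b
      map_add' := fun φ ψ => by
        ext i j b x
        simp
      map_smul' := fun c φ => by
        ext i j b x
        simp } <| by
    rintro _ ⟨f, rfl⟩
    refine ⟨fun x => projMap k a x ∘ₗ f x, ?_⟩
    funext i j b
    refine LinearMap.ext fun x => ?_
    simp only [extDiff, LinearMap.coe_mk, AddHom.coe_mk, LinearMap.sub_apply,
      LinearMap.comp_apply, map_sub, projMap_map]

/-- The Auslander-Reiten translation of the hereditary algebra `kQ`: `τ M = D Ext¹(M, kQ)`, that is,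
`(τ M)_v = D Ext¹(M, P_v)`. -/
def tau (M : QRep k V) : QRep k V where
  obj v := Module.Dual k (Ext1 M (proj k v))
  map a := (extMap M a).dualMap

/-- Indecomposable preprojective modules: some `τ^m M` with `m ≥ 0` is an indecomposable
projective module. -/
def IsPreprojectiveIndec (M : QRep k V) : Prop :=
  M.Indec ∧ ∃ (m : ℕ) (v : V), Iso (tau^[m] M) (proj k v)

/-- Indecomposable preinjective modules: `M ≅ τ^m I` with `m ≥ 0` and `I` an indecomposable
injective module. -/
def IsPreinjectiveIndec (M : QRep k V) : Prop :=
  M.Indec ∧ ∃ (m : ℕ) (v : V), Iso M (tau^[m] (inj k v))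

/-- Regular modules: finite-dimensional modules none of whose indecomposable direct summands is
preprojective or preinjective. -/
def IsRegular (M : QRep k V) : Prop :=
  M.IsFD ∧ ∀ (U W : ∀ v, Submodule k (M.obj v)) (hU : M.IsSub U), M.IsSub W →
    (∀ v, IsCompl (U v) (W v)) →
    ¬ (M.restrict U hU).IsPreprojectiveIndec ∧ ¬ (M.restrict U hU).IsPreinjectiveIndec

/-- Regular simple modules: indecomposable regular modules without nontrivial regular
submodules. -/
def IsRegularSimple (M : QRep k V) : Prop :=
  M.Indec ∧ M.IsRegular ∧
    ∀ (U : ∀ v, Submodule k (M.obj v)) (hU : M.IsSub U), (M.restrict U hU).IsRegular →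
      (∀ v, U v = ⊥) ∨ (∀ v, U v = ⊤)

/-- `E` is the quasi-socle of `M`, for a regular simple module `E`: the module `M` has exactly one
regular simple submodule, and this submodule is isomorphic to `E`. -/
def HasQuasiSocle (M E : QRep k V) : Prop :=
  ∃ (U : ∀ v, Submodule k (M.obj v)) (hU : M.IsSub U), Iso (M.restrict U hU) E ∧
    ∀ (W : ∀ v, Submodule k (M.obj v)) (hW : M.IsSub W),
      (M.restrict W hW).IsRegularSimple ↔ W = U

/-- `M` has quasi-length `l`: there is a chain `0 = F_0 ⊆ F_1 ⊆ ⋯ ⊆ F_l = M` of submodules with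
regular simple quotients `F_{j+1} / F_j`. -/
def HasQuasiLength (M : QRep k V) (l : ℕ) : Prop :=
  ∃ (F : ℕ → ∀ v, Submodule k (M.obj v)) (hF : ∀ j, M.IsSub (F j)),
    (∀ v, F 0 v = ⊥) ∧ (∀ v, F l v = ⊤) ∧
    ∀ j < l, (∀ v, F j v ≤ F (j + 1) v) ∧
      (M.subquot (F j) (F (j + 1)) (hF j) (hF (j + 1))).IsRegularSimple

/-- `M ≅ E[l]`: for `l ≥ 1`, `M` is an indecomposable regular module with quasi-socle `E` and
quasi-length `l`; and `E[0] = 0`. -/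
def IsTubeModule (E : QRep k V) (l : ℕ) (M : QRep k V) : Prop :=
  if l = 0 then M.IsZero
  else M.Indec ∧ M.IsRegular ∧ M.HasQuasiSocle E ∧ M.HasQuasiLength l

/-- `E_i`, `i ∈ ℤ/r`, are the pairwise non-isomorphic regular simple modules of a non-homogeneous
tube of rank `r`, numbered so that `τ E_{i+1} ≅ E_i`. -/
structure IsNonhomogeneousTube (r : ℕ) (E : ZMod r → QRep k V) : Prop where
  two_le : 2 ≤ r
  regularSimple : ∀ i, (E i).IsRegularSimple
  injective : ∀ i j, Iso (E i) (E j) → i = j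
  tau_iso : ∀ i, Iso (tau (E (i + 1))) (E i)

/-- The dimension vector of the socle of a module over an acyclic quiver; the socle consists of
the elements that are killed by all arrows. -/
def socDim (M : QRep k V) : V → ℕ := fun v =>
  Module.finrank k (⨅ (w : V) (a : w ⟶ v), LinearMap.ker (M.map a) : Submodule k (M.obj v))

/-- The injective `kQ̃`-module `⊕_j I_{inr j}^{m_j}` associated to the frozen vertices. -/
def frozenInj (k : Type u) {V : Type u} [Field k] [Quiver.{u} V] (m : V → ℕ) :
    QRep k (V ⊕ V) where
  obj w := ∀ j : V, Fin (m j) → (inj k (Sum.inr j : V ⊕ V)).obj w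
  map a := LinearMap.pi fun j => LinearMap.pi fun c =>
    (inj k (Sum.inr j : V ⊕ V)).map a ∘ₗ LinearMap.proj c ∘ₗ LinearMap.proj j

end QRep

/-! ## The quantum Caldero-Chapoton map -/

section CC

variable {k V : Type u} [Field k] [Finite k] [Fintype V] [DecidableEq V] [Quiver.{u} V]

/-- The Euler form on dimension vectors,
`⟨x, y⟩ = ∑_i x_i y_i - ∑_{i,j} x_i y_j dim Ext¹(S_i, S_j)`. -/
def euler (x y : V → ℤ) : ℤ :=
  ∑ i, x i * y i - ∑ i, ∑ j, x i * y j * (numArrows j i : ℤ)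

/-- The vector `(Ĩ - R̃) m`. -/
def gvec (m : V → ℕ) : V ⊕ V → ℤ :=
  (matIt V - matRt V).mulVec fun v => (m v : ℤ)

/-- The specialized quantum torus, over `ℤ[|k|^{±1/2}]`. -/
abbrev Torus (k : Type u) [Field k] [Finite k] (Λ : Matrix (V ⊕ V) (V ⊕ V) ℤ) : Type u :=
  QuantumTorus (halfRing k) (sqrtCard k) Λ

/-- `∑_e |Gr_e(M)| q^{-⟨e, m-e⟩/2} X^{B̃ e - (Ĩ - R̃) m + c}`, where `m` is the dimension vector
of `M`. -/
def ccSum (Λ : Matrix (V ⊕ V) (V ⊕ V) ℤ) (M : QRep k V) (c : V ⊕ V → ℤ) : Torus k Λ :=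
  ∑ e ∈ Finset.Iic M.dimVec,
    (((M.Gr e).ncard : halfRing k) *
      ((sqrtCard k ^ (-euler (fun v => (e v : ℤ)) (fun v => (M.dimVec v : ℤ) - e v)) :
        (halfRing k)ˣ) : halfRing k)) •
    QuantumTorus.X ((matBt V).mulVec (fun v => (e v : ℤ)) - gvec M.dimVec + c)

/-- `X_M`, for a `kQ`-module `M`. -/
def cc (Λ : Matrix (V ⊕ V) (V ⊕ V) ℤ) (M : QRep k V) : Torus k Λ := ccSum Λ M 0

/-- `X_{M ⊕ I[-1]}`, for a `kQ`-module `M` and an injective `kQ̃`-module `I`. In the cluster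
category `I[-1] ≅ P[1]` for the projective module `P` with `P / rad P ≅ soc I`. -/
def ccShift (Λ : Matrix (V ⊕ V) (V ⊕ V) ℤ) (M : QRep k V) (I : QRep k (V ⊕ V)) : Torus k Λ :=
  ccSum Λ M fun v => (I.socDim v : ℤ)

end CC

end QuiverCC

end

/-! Write N = E_{i-1}, L = E_i[r-1], T = E_{i-2} ≅ τN, and let L' = E_i[r-2] be the kernel of the
surjection L → T. Then Hom(N, L) = 0, Ext¹(N, L) is a line, and the nonsplit extension of N by L is
E_i[r].

The product X_L X_N is a sum over pairs of submodules A ⊆ L, C ⊆ N. A submodule W of the extension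
determines such a pair, by intersection with L and image in N, and the W over a fixed pair are the
splittings of the class induced in Ext¹(C, L/A) (`isSub_graphSub_iff`): there are none, or they form
a torsor under Hom(C, L/A). Since kQ is hereditary, Ext¹(N, L) → Ext¹(C, L/A) is onto; its source is
spanned by the extension class, so W exists exactly when Ext¹(C, L/A) = 0
(`cochainRes_notMem_range`). In that case there are q^⟨C, L/A⟩ of them, which is the factor produced
by multiplying the two terms in the quantum torus (`ccTerm_mul`), apart from the global q^(λ/2). By
Auslander-Reiten duality the exceptional pairs are those with C = N and A ⊆ L'
(`ext_restrict_quot_ne_zero_iff`); they run through the submodules of L' and sum to the second term.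
`cc_mul_cc` carries this out.

The remaining work derives the needed facts about tubes from the definition of regular modules.
Everything is numerical: the Euler form (`hom_sub_ext`), the Auslander-Reiten formula (`hom_tau`)
and its consequence for dimension vectors (`euler_tau`) control dimensions, and over a finite field
a module is determined by the dimensions of its morphism spaces (`iso_of_hom_eq`), so τ is never
needed as a functor. They give a Schur lemma for the tube (`IsNonhomogeneousTube.bijective`) and
End(E_j) = k (`IsNonhomogeneousTube.hom_self`). Consequently, an iterated nonsplit extension has a
unique top, is unique up to isomorphism, and describes E_i[l] (`Tower.hom_eq`, `Tower.iso`,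
`IsTubeModule.tower`). -/

noncomputable section

namespace QuiverCC

namespace QRep

/-! ### Morphisms and extension groups. -/

section Basic

variable {k V : Type u} [Field k] [Quiver.{u} V]

/-- Morphisms of modules: families of linear maps that commute with the arrows. -/
def IsHom (X Y : QRep k V) (f : ∀ v, X.obj v →ₗ[k] Y.obj v) : Prop :=
  ∀ (i j : V) (a : i ⟶ j) (x : X.obj j), f i (X.map a x) = Y.map a (f j x)

theorem mem_ker_extDiff {X Y : QRep k V} {f : ∀ v, X.obj v →ₗ[k] Y.obj v} :
    f ∈ LinearMap.ker (extDiff X Y) ↔ IsHom X Y f := by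
  rw [LinearMap.mem_ker]
  constructor
  · intro h i j a x
    have := LinearMap.congr_fun (congr_fun (congr_fun (congr_fun h i) j) a) x
    simp only [extDiff, LinearMap.coe_mk, AddHom.coe_mk, LinearMap.sub_apply,
      LinearMap.comp_apply, Pi.zero_apply, LinearMap.zero_apply] at this
    exact (sub_eq_zero.1 this).symm
  · intro h
    funext i j a
    ext x
    simp [extDiff, h i j a x]

/-- The dimension of the space of morphisms. -/
def hom (X Y : QRep k V) : ℕ := Module.finrank k (LinearMap.ker (extDiff X Y))

/-- The dimension of the first extension group. -/
def ext (X Y : QRep k V) : ℕ := Module.finrank k (Ext1 X Y)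

/-- The dimension vector with integer entries. -/
def dimZ (X : QRep k V) : V → ℤ := fun v => (X.dimVec v : ℤ)

theorem IsHom.comp {X Y Z : QRep k V} {g : ∀ v, Y.obj v →ₗ[k] Z.obj v}
    {f : ∀ v, X.obj v →ₗ[k] Y.obj v} (hg : IsHom Y Z g) (hf : IsHom X Y f) :
    IsHom X Z fun v => g v ∘ₗ f v := fun i j a x => by
  simp [hf i j a x, hg i j a]

theorem IsHom.id (X : QRep k V) : IsHom X X fun _ => LinearMap.id := fun _ _ _ _ => rfl

theorem IsHom.sub {X Y : QRep k V} {f g : ∀ v, X.obj v →ₗ[k] Y.obj v} (hf : IsHom X Y f)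
    (hg : IsHom X Y g) : IsHom X Y (f - g) := fun i j a x => by simp [hf i j a x, hg i j a x]

theorem Iso.refl (X : QRep k V) : Iso X X := ⟨fun _ => LinearEquiv.refl k _, fun _ _ _ _ => rfl⟩

theorem Iso.symm {X Y : QRep k V} (h : Iso X Y) : Iso Y X := by
  obtain ⟨f, hf⟩ := h
  refine ⟨fun v => (f v).symm, fun i j a y => ?_⟩
  rw [LinearEquiv.symm_apply_eq, hf, LinearEquiv.apply_symm_apply]

theorem Iso.trans {X Y Z : QRep k V} (h : Iso X Y) (h' : Iso Y Z) : Iso X Z := by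
  obtain ⟨f, hf⟩ := h
  obtain ⟨g, hg⟩ := h'
  exact ⟨fun v => (f v).trans (g v), fun i j a y => by simp [hf, hg]⟩

theorem IsHom.iso_of_bijective {X Y : QRep k V} {f : ∀ v, X.obj v →ₗ[k] Y.obj v}
    (hf : IsHom X Y f) (hb : ∀ v, Function.Bijective (f v)) : Iso X Y :=
  ⟨fun v => LinearEquiv.ofBijective (f v) (hb v), fun i j a x => hf i j a x⟩

theorem Iso.exists_isHom {X Y : QRep k V} (h : Iso X Y) :
    ∃ f, IsHom X Y f ∧ ∀ v, Function.Bijective (f v) := by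
  obtain ⟨f, hf⟩ := h
  exact ⟨fun v => (f v).toLinearMap, hf, fun v => (f v).bijective⟩

theorem Iso.dimVec_eq {X Y : QRep k V} (h : Iso X Y) : X.dimVec = Y.dimVec := by
  obtain ⟨f, _⟩ := h
  exact funext fun v => (f v).finrank_eq

theorem Iso.dimZ_eq {X Y : QRep k V} (h : Iso X Y) : X.dimZ = Y.dimZ := by
  unfold dimZ
  rw [h.dimVec_eq]

theorem Iso.isFD {X Y : QRep k V} (h : Iso X Y) (hX : X.IsFD) : Y.IsFD := fun v => by
  obtain ⟨f, _⟩ := h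
  have := hX v
  exact LinearEquiv.finiteDimensional (f v)

theorem Iso.isZero {X Y : QRep k V} (h : Iso X Y) (hX : X.IsZero) : Y.IsZero := fun v => by
  obtain ⟨f, _⟩ := h
  have := hX v
  exact (f v).symm.toEquiv.subsingleton

theorem IsZero.iso {X Y : QRep k V} (hX : X.IsZero) (hY : Y.IsZero) : Iso X Y := by
  have := fun v => hX v
  have := fun v => hY v
  exact ⟨fun v => 0, fun _ _ _ _ => Subsingleton.elim _ _⟩

theorem IsZero.isFD {X : QRep k V} (hX : X.IsZero) : X.IsFD := fun v => by
  have := hX v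
  infer_instance

section Finite

variable [Finite V]

theorem IsFD.finite_hom {X Y : QRep k V} (hX : X.IsFD) (hY : Y.IsFD) :
    FiniteDimensional k (∀ v, X.obj v →ₗ[k] Y.obj v) := by
  have := fun v => hX v
  have := fun v => hY v
  infer_instance

theorem hom_eq_zero_iff {X Y : QRep k V} (hX : X.IsFD) (hY : Y.IsFD) :
    hom X Y = 0 ↔ ∀ f, IsHom X Y f → f = 0 := by
  have := hX.finite_hom hY
  rw [hom, Submodule.finrank_eq_zero, Submodule.eq_bot_iff]
  simp only [mem_ker_extDiff]

theorem hom_ne_zero_iff {X Y : QRep k V} (hX : X.IsFD) (hY : Y.IsFD) :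
    hom X Y ≠ 0 ↔ ∃ f, IsHom X Y f ∧ f ≠ 0 := by
  rw [Ne, hom_eq_zero_iff hX hY]
  push Not
  rfl

theorem hom_le_of_injective {X Y Y' : QRep k V} (hX : X.IsFD) (hY' : Y'.IsFD)
    {g : ∀ v, Y.obj v →ₗ[k] Y'.obj v} (hg : IsHom Y Y' g) (hi : ∀ v, Function.Injective (g v)) :
    hom X Y ≤ hom X Y' := by
  have := hX.finite_hom hY'
  let φ : (∀ v, X.obj v →ₗ[k] Y.obj v) →ₗ[k] (∀ v, X.obj v →ₗ[k] Y'.obj v) :=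
    { toFun := fun f v => g v ∘ₗ f v
      map_add' := fun f f' => by ext; simp
      map_smul' := fun c f => by ext; simp }
  refine LinearMap.finrank_le_finrank_of_injective
    (f := φ.restrict (p := LinearMap.ker (extDiff X Y)) (q := LinearMap.ker (extDiff X Y'))
      fun f hf => mem_ker_extDiff.2 (hg.comp (mem_ker_extDiff.1 hf))) ?_
  rintro ⟨f, hf⟩ ⟨f', hf'⟩ h
  refine Subtype.ext (funext fun v => LinearMap.ext fun x => hi v ?_)
  exact LinearMap.congr_fun (congr_fun (congrArg Subtype.val h) v) x

theorem hom_le_of_surjective {X X' Y : QRep k V} (hX : X.IsFD) (hY : Y.IsFD)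
    {g : ∀ v, X.obj v →ₗ[k] X'.obj v} (hg : IsHom X X' g) (hs : ∀ v, Function.Surjective (g v)) :
    hom X' Y ≤ hom X Y := by
  have := hX.finite_hom hY
  let φ : (∀ v, X'.obj v →ₗ[k] Y.obj v) →ₗ[k] (∀ v, X.obj v →ₗ[k] Y.obj v) :=
    { toFun := fun f v => f v ∘ₗ g v
      map_add' := fun f f' => by ext; simp
      map_smul' := fun c f => by ext; simp }
  refine LinearMap.finrank_le_finrank_of_injective
    (f := φ.restrict (p := LinearMap.ker (extDiff X' Y)) (q := LinearMap.ker (extDiff X Y))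
      fun f hf => mem_ker_extDiff.2 ((mem_ker_extDiff.1 hf).comp hg)) ?_
  rintro ⟨f, hf⟩ ⟨f', hf'⟩ h
  refine Subtype.ext (funext fun v => LinearMap.ext fun x => ?_)
  obtain ⟨x, rfl⟩ := hs v x
  exact LinearMap.congr_fun (congr_fun (congrArg Subtype.val h) v) x

theorem Iso.hom_left {X X' Y : QRep k V} (h : Iso X X') (hX : X.IsFD) (hY : Y.IsFD) :
    hom X Y = hom X' Y := by
  obtain ⟨f, hf, hb⟩ := h.exists_isHom
  obtain ⟨g, hg, hb'⟩ := h.symm.exists_isHom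
  exact le_antisymm (hom_le_of_surjective (h.isFD hX) hY hg fun v => (hb' v).2)
    (hom_le_of_surjective hX hY hf fun v => (hb v).2)

theorem Iso.hom_right {X Y Y' : QRep k V} (h : Iso Y Y') (hX : X.IsFD) (hY : Y.IsFD) :
    hom X Y = hom X Y' := by
  obtain ⟨f, hf, hb⟩ := h.exists_isHom
  obtain ⟨g, hg, hb'⟩ := h.symm.exists_isHom
  exact le_antisymm (hom_le_of_injective hX (h.isFD hY) hf fun v => (hb v).1)
    (hom_le_of_injective hX hY hg fun v => (hb' v).1)

variable [∀ i j : V, Finite (i ⟶ j)]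

theorem IsFD.finite_cochain {X Y : QRep k V} (hX : X.IsFD) (hY : Y.IsFD) :
    FiniteDimensional k (∀ i j : V, (i ⟶ j) → (X.obj j →ₗ[k] Y.obj i)) := by
  have := fun v => hX v
  have := fun v => hY v
  infer_instance

theorem IsFD.finite_ext {X Y : QRep k V} (hX : X.IsFD) (hY : Y.IsFD) :
    FiniteDimensional k (Ext1 X Y) := by
  have := hX.finite_cochain hY
  infer_instance

theorem ext_eq_zero_iff {X Y : QRep k V} (hX : X.IsFD) (hY : Y.IsFD) :
    ext X Y = 0 ↔ ∀ z, z ∈ LinearMap.range (extDiff X Y) := by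
  have := hX.finite_ext hY
  rw [ext, Module.finrank_zero_iff, Submodule.Quotient.subsingleton_iff,
    Submodule.eq_top_iff']

/-- Pushing forward cochains along a family of linear maps. -/
def cochainPush (C : QRep k V) {Y Y' : QRep k V} (g : ∀ v, Y.obj v →ₗ[k] Y'.obj v) :
    (∀ i j : V, (i ⟶ j) → (C.obj j →ₗ[k] Y.obj i)) →ₗ[k]
      (∀ i j : V, (i ⟶ j) → (C.obj j →ₗ[k] Y'.obj i)) where
  toFun z i j a := g i ∘ₗ z i j a
  map_add' z z' := by ext; simp
  map_smul' c z := by ext; simp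

/-- Pulling back cochains along a family of linear maps. -/
def cochainPull {C C' : QRep k V} (Y : QRep k V) (g : ∀ v, C'.obj v →ₗ[k] C.obj v) :
    (∀ i j : V, (i ⟶ j) → (C.obj j →ₗ[k] Y.obj i)) →ₗ[k]
      (∀ i j : V, (i ⟶ j) → (C'.obj j →ₗ[k] Y.obj i)) where
  toFun z i j a := z i j a ∘ₗ g j
  map_add' z z' := by ext; simp
  map_smul' c z := by ext; simp

omit [Finite V] [∀ i j : V, Finite (i ⟶ j)] in
theorem cochainPush_extDiff {C Y Y' : QRep k V} {g : ∀ v, Y.obj v →ₗ[k] Y'.obj v}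
    (hg : IsHom Y Y' g) (f : ∀ v, C.obj v →ₗ[k] Y.obj v) :
    cochainPush C g (extDiff C Y f) = extDiff C Y' fun v => g v ∘ₗ f v := by
  funext i j a
  ext x
  simp [cochainPush, extDiff, hg i j a]

omit [Finite V] [∀ i j : V, Finite (i ⟶ j)] in
theorem cochainPull_extDiff {C C' Y : QRep k V} {g : ∀ v, C'.obj v →ₗ[k] C.obj v}
    (hg : IsHom C' C g) (f : ∀ v, C.obj v →ₗ[k] Y.obj v) :
    cochainPull Y g (extDiff C Y f) = extDiff C' Y fun v => f v ∘ₗ g v := by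
  funext i j a
  ext x
  simp [cochainPull, extDiff, hg i j a]

omit [Finite V] [∀ i j : V, Finite (i ⟶ j)] in
-- Cochains need not respect the arrows, so a linear section of `g` at each vertex is enough to lift
-- them.
theorem cochainPush_surjective {C Y Y' : QRep k V} {g : ∀ v, Y.obj v →ₗ[k] Y'.obj v}
    (hs : ∀ v, Function.Surjective (g v)) : Function.Surjective (cochainPush C g) := fun z => by
  choose s hs' using fun v => (g v).exists_rightInverse_of_surjective (LinearMap.range_eq_top.2 (hs v))
  refine ⟨fun i j a => s i ∘ₗ z i j a, ?_⟩
  funext i j a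
  ext x
  exact LinearMap.congr_fun (hs' i) (z i j a x)

omit [Finite V] [∀ i j : V, Finite (i ⟶ j)] in
theorem cochainPull_surjective {C C' Y : QRep k V} {g : ∀ v, C'.obj v →ₗ[k] C.obj v}
    (hi : ∀ v, Function.Injective (g v)) : Function.Surjective (cochainPull Y g) := fun z => by
  choose s hs' using fun v => (g v).exists_leftInverse_of_injective (LinearMap.ker_eq_bot.2 (hi v))
  refine ⟨fun i j a => z i j a ∘ₗ s j, ?_⟩
  funext i j a
  ext x
  exact congrArg (z i j a) (LinearMap.congr_fun (hs' j) x)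

/-- The map on extension groups induced by a morphism in the second variable. -/
def extPush (C : QRep k V) {Y Y' : QRep k V} {g : ∀ v, Y.obj v →ₗ[k] Y'.obj v}
    (hg : IsHom Y Y' g) : Ext1 C Y →ₗ[k] Ext1 C Y' :=
  Submodule.mapQ _ _ (cochainPush C g) <| by
    rintro _ ⟨f, rfl⟩
    exact ⟨_, (cochainPush_extDiff hg f).symm⟩

/-- The map on extension groups induced by a morphism in the first variable. -/
def extPull {C C' : QRep k V} (Y : QRep k V) {g : ∀ v, C'.obj v →ₗ[k] C.obj v}
    (hg : IsHom C' C g) : Ext1 C Y →ₗ[k] Ext1 C' Y :=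
  Submodule.mapQ _ _ (cochainPull Y g) <| by
    rintro _ ⟨f, rfl⟩
    exact ⟨_, (cochainPull_extDiff hg f).symm⟩

omit [Finite V] [∀ i j : V, Finite (i ⟶ j)] in
-- Right exactness of `Ext¹` is heredity: the complex computing it ends with the cochains, on which
-- pushing forward along a surjection is already onto.
theorem extPush_surjective {C Y Y' : QRep k V} {g : ∀ v, Y.obj v →ₗ[k] Y'.obj v}
    (hg : IsHom Y Y' g) (hs : ∀ v, Function.Surjective (g v)) :
    Function.Surjective (extPush C hg) := by
  intro y
  obtain ⟨z, rfl⟩ := Submodule.mkQ_surjective _ y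
  obtain ⟨z, rfl⟩ := cochainPush_surjective (C := C) hs z
  exact ⟨Submodule.mkQ _ z, rfl⟩

omit [Finite V] [∀ i j : V, Finite (i ⟶ j)] in
theorem extPull_surjective {C C' Y : QRep k V} {g : ∀ v, C'.obj v →ₗ[k] C.obj v}
    (hg : IsHom C' C g) (hi : ∀ v, Function.Injective (g v)) :
    Function.Surjective (extPull Y hg) := by
  intro y
  obtain ⟨z, rfl⟩ := Submodule.mkQ_surjective _ y
  obtain ⟨z, rfl⟩ := cochainPull_surjective (Y := Y) hi z
  exact ⟨Submodule.mkQ _ z, rfl⟩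

theorem ext_le_of_surjective {C Y Y' : QRep k V} (hC : C.IsFD) (hY : Y.IsFD)
    {g : ∀ v, Y.obj v →ₗ[k] Y'.obj v} (hg : IsHom Y Y' g) (hs : ∀ v, Function.Surjective (g v)) :
    ext C Y' ≤ ext C Y := by
  have := hC.finite_ext hY
  exact LinearMap.finrank_le_finrank_of_surjective (extPush_surjective hg hs)

end Finite

/-! ### The Euler form. -/

section Euler

variable [Fintype V]

theorem euler_add_left (x x' y : V → ℤ) : euler (x + x') y = euler x y + euler x' y := by
  simp only [euler, Pi.add_apply, add_mul, Finset.sum_add_distrib]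
  ring

theorem euler_add_right (x y y' : V → ℤ) : euler x (y + y') = euler x y + euler x y' := by
  simp only [euler, Pi.add_apply, mul_add, add_mul, Finset.sum_add_distrib]
  ring

theorem euler_neg_right (x y : V → ℤ) : euler x (-y) = -euler x y := by
  simp only [euler, Pi.neg_apply, mul_neg, neg_mul, Finset.sum_neg_distrib]
  ring

theorem euler_sub_right (x y y' : V → ℤ) : euler x (y - y') = euler x y - euler x y' := by
  rw [sub_eq_add_neg, euler_add_right, euler_neg_right, sub_eq_add_neg]

theorem euler_smul_left (c : ℤ) (x y : V → ℤ) : euler (c • x) y = c * euler x y := by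
  simp only [euler, Pi.smul_apply, smul_eq_mul, mul_sub, Finset.mul_sum, mul_assoc]

theorem euler_smul_right (c : ℤ) (x y : V → ℤ) : euler x (c • y) = c * euler x y := by
  simp only [euler, Pi.smul_apply, smul_eq_mul, mul_sub, Finset.mul_sum]
  congr 1
  · exact Finset.sum_congr rfl fun _ _ => by ring
  · exact Finset.sum_congr rfl fun _ _ => Finset.sum_congr rfl fun _ _ => by ring

theorem euler_zero_left (y : V → ℤ) : euler 0 y = 0 := by simp [euler]

theorem euler_zero_right (x : V → ℤ) : euler x 0 = 0 := by simp [euler]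

theorem euler_sum_left {ι : Type*} (s : Finset ι) (x : ι → V → ℤ) (y : V → ℤ) :
    euler (∑ c ∈ s, x c) y = ∑ c ∈ s, euler (x c) y := by
  classical
  induction s using Finset.induction_on with
  | empty => simp [euler_zero_left]
  | insert a s ha ih => rw [Finset.sum_insert ha, Finset.sum_insert ha, euler_add_left, ih]

theorem euler_single_left [DecidableEq V] (v : V) (y : V → ℤ) :
    euler (Pi.single v 1) y = y v - ∑ u, y u * (numArrows u v : ℤ) := by
  simp [euler, Pi.single_apply]

theorem euler_single_right [DecidableEq V] (v : V) (x : V → ℤ) :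
    euler x (Pi.single v 1) = x v - ∑ u, x u * (numArrows v u : ℤ) := by
  simp [euler, Pi.single_apply]

omit [Quiver V] in
theorem eq_sum_single [DecidableEq V] (x : V → ℤ) : x = ∑ v, x v • (Pi.single v 1 : V → ℤ) := by
  funext w
  simp [Finset.sum_apply, Pi.single_apply]

variable [∀ i j : V, Finite (i ⟶ j)]

/-- The homological interpretation of the Euler form. -/
theorem hom_sub_ext {X Y : QRep k V} (hX : X.IsFD) (hY : Y.IsFD) :
    (hom X Y : ℤ) - ext X Y = euler X.dimZ Y.dimZ := by
  have := fun v => hX v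
  have := fun v => hY v
  have : ∀ i j : V, Fintype (i ⟶ j) := fun i j => Fintype.ofFinite _
  -- The difference of the dimensions of kernel and cokernel of `extDiff` is that of its source and
  -- target, which the dimension vectors determine.
  have h1 := LinearMap.finrank_range_add_finrank_ker (extDiff X Y)
  have h2 := Submodule.finrank_quotient_add_finrank (LinearMap.range (extDiff X Y))
  rw [Module.finrank_pi_fintype] at h1
  simp only [Module.finrank_pi_fintype, Module.finrank_linearMap] at h1 h2
  have e : euler X.dimZ Y.dimZ =
      ((∑ v, Module.finrank k (X.obj v) * Module.finrank k (Y.obj v) : ℕ) : ℤ) -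
      ((∑ i, ∑ j, ∑ _a : i ⟶ j, Module.finrank k (X.obj j) * Module.finrank k (Y.obj i) : ℕ) :
        ℤ) := by
    rw [Finset.sum_comm]
    simp only [euler, dimZ, dimVec, numArrows, Nat.card_eq_fintype_card, Finset.sum_const,
      Finset.card_univ, smul_eq_mul]
    push_cast
    congr 1
    exact Finset.sum_congr rfl fun _ _ => Finset.sum_congr rfl fun _ _ => by ring
  rw [e, ← h1, ← h2, hom, ext]
  push_cast
  ring

/-- No map between extension groups is built: the Euler form determines `ext` from `hom` and the
dimension vectors. -/
theorem Iso.ext_left {X X' Y : QRep k V} (h : Iso X X') (hX : X.IsFD) (hY : Y.IsFD) :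
    ext X Y = ext X' Y := by
  have h1 := hom_sub_ext hX hY
  have h2 := hom_sub_ext (h.isFD hX) hY
  rw [h.dimZ_eq] at h1
  rw [← h.hom_left hX hY] at h2
  omega

theorem Iso.ext_right {X Y Y' : QRep k V} (h : Iso Y Y') (hX : X.IsFD) (hY : Y.IsFD) :
    ext X Y = ext X Y' := by
  have h1 := hom_sub_ext hX hY
  have h2 := hom_sub_ext hX (h.isFD hY)
  rw [h.dimZ_eq] at h1
  rw [← h.hom_right hX hY] at h2
  omega

end Euler

/-! ### Extensions given by cocycles. -/

section Extension

/-- The extension of `N` by `L` given by a cocycle `z`. -/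
def extn (N L : QRep k V) (z : ∀ i j : V, (i ⟶ j) → (N.obj j →ₗ[k] L.obj i)) : QRep k V where
  obj v := L.obj v × N.obj v
  map {i j} a := LinearMap.prod
    (L.map a ∘ₗ LinearMap.fst k _ _ + z i j a ∘ₗ LinearMap.snd k _ _)
    (N.map a ∘ₗ LinearMap.snd k _ _)

variable {N L : QRep k V} {z : ∀ i j : V, (i ⟶ j) → (N.obj j →ₗ[k] L.obj i)}

theorem extn_map {i j : V} (a : i ⟶ j) (x : L.obj j) (y : N.obj j) :
    (extn N L z).map a (x, y) = (L.map a x + z i j a y, N.map a y) := rfl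

/-- The inclusion of the submodule of an extension. -/
def extnInl (N L : QRep k V) (z : ∀ i j : V, (i ⟶ j) → (N.obj j →ₗ[k] L.obj i)) (v : V) :
    L.obj v →ₗ[k] (extn N L z).obj v := LinearMap.inl k (L.obj v) (N.obj v)

/-- The projection to the quotient of an extension. -/
def extnSnd (N L : QRep k V) (z : ∀ i j : V, (i ⟶ j) → (N.obj j →ₗ[k] L.obj i)) (v : V) :
    (extn N L z).obj v →ₗ[k] N.obj v := LinearMap.snd k (L.obj v) (N.obj v)

theorem extnInl_apply (v : V) (x : L.obj v) : extnInl N L z v x = (x, 0) := rfl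

theorem isHom_extnInl : IsHom L (extn N L z) (extnInl N L z) := fun i j a x => by
  rw [extnInl_apply, extnInl_apply, extn_map, map_zero, map_zero, add_zero]

theorem isHom_extnSnd : IsHom (extn N L z) N (extnSnd N L z) := fun _ _ _ _ => rfl

theorem extnInl_injective (v : V) : Function.Injective (extnInl N L z v) :=
  LinearMap.inl_injective

theorem extnSnd_surjective (v : V) : Function.Surjective (extnSnd N L z v) :=
  LinearMap.snd_surjective

theorem isFD_extn (hN : N.IsFD) (hL : L.IsFD) : (extn N L z).IsFD := fun v => by
  have := hN v
  have := hL v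
  exact inferInstanceAs (FiniteDimensional k (L.obj v × N.obj v))

theorem dimVec_extn (hN : N.IsFD) (hL : L.IsFD) (v : V) :
    (extn N L z).dimVec v = L.dimVec v + N.dimVec v := by
  have := hN v
  have := hL v
  exact Module.finrank_prod

theorem dimZ_extn (hN : N.IsFD) (hL : L.IsFD) : (extn N L z).dimZ = L.dimZ + N.dimZ := by
  funext v
  simp [dimZ, dimVec_extn hN hL]

variable [Finite V]

/-- Left exactness of Hom(Z, -): the morphisms killed by the projection to `N` are those with values
in `L`. -/
theorem hom_extn_right_le {Z : QRep k V} (hZ : Z.IsFD) (hN : N.IsFD) (hL : L.IsFD) :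
    hom Z (extn N L z) ≤ hom Z L + hom Z N := by
  have := hZ.finite_hom hN
  have := hZ.finite_hom hL
  have := hZ.finite_hom (isFD_extn (z := z) hN hL)
  let φ : LinearMap.ker (extDiff Z (extn N L z)) →ₗ[k] LinearMap.ker (extDiff Z N) :=
    { toFun := fun f => ⟨fun v => extnSnd N L z v ∘ₗ f.1 v,
        mem_ker_extDiff.2 (isHom_extnSnd.comp (mem_ker_extDiff.1 f.2))⟩
      map_add' := fun f f' => rfl
      map_smul' := fun c f => rfl }
  have h := LinearMap.finrank_range_add_finrank_ker φ
  have h1 : Module.finrank k (LinearMap.range φ) ≤ hom Z N := Submodule.finrank_le _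
  have hh : ∀ (f : LinearMap.ker φ) (v : V) (x : Z.obj v),
      f.1.1 v x = (((f.1.1 v x : L.obj v × N.obj v).1, 0) : L.obj v × N.obj v) := fun f v x => by
    have h0 : (f.1.1 v x : L.obj v × N.obj v).2 = 0 :=
      LinearMap.congr_fun (congr_fun (congrArg Subtype.val (LinearMap.mem_ker.1 f.2)) v) x
    exact Prod.ext rfl h0
  let ψ : LinearMap.ker φ →ₗ[k] LinearMap.ker (extDiff Z L) :=
    { toFun := fun f => ⟨fun v => LinearMap.fst k (L.obj v) (N.obj v) ∘ₗ f.1.1 v,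
        mem_ker_extDiff.2 fun i j a x => by
          have h2 := mem_ker_extDiff.1 f.1.2 i j a x
          rw [hh f j x, extn_map, map_zero, add_zero] at h2
          exact congrArg Prod.fst h2⟩
      map_add' := fun f f' => rfl
      map_smul' := fun c f => rfl }
  have h2 : Module.finrank k (LinearMap.ker φ) ≤ hom Z L := by
    refine LinearMap.finrank_le_finrank_of_injective (f := ψ) fun f f' hff => ?_
    refine Subtype.ext (Subtype.ext (funext fun v => LinearMap.ext fun x => ?_))
    have h3 : (f.1.1 v x : L.obj v × N.obj v).1 = (f'.1.1 v x : L.obj v × N.obj v).1 :=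
      LinearMap.congr_fun (congr_fun (congrArg Subtype.val hff) v) x
    rw [hh f, hh f', h3]
  rw [hom, ← h]
  omega

theorem hom_extn_left_le {Z : QRep k V} (hZ : Z.IsFD) (hN : N.IsFD) (hL : L.IsFD) :
    hom (extn N L z) Z ≤ hom L Z + hom N Z := by
  have := hN.finite_hom hZ
  have := hL.finite_hom hZ
  have := (isFD_extn (z := z) hN hL).finite_hom hZ
  let φ : LinearMap.ker (extDiff (extn N L z) Z) →ₗ[k] LinearMap.ker (extDiff L Z) :=
    { toFun := fun f => ⟨fun v => f.1 v ∘ₗ extnInl N L z v,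
        mem_ker_extDiff.2 ((mem_ker_extDiff.1 f.2).comp isHom_extnInl)⟩
      map_add' := fun f f' => rfl
      map_smul' := fun c f => rfl }
  have h := LinearMap.finrank_range_add_finrank_ker φ
  have h1 : Module.finrank k (LinearMap.range φ) ≤ hom L Z := Submodule.finrank_le _
  have hh : ∀ (f : LinearMap.ker φ) (v : V) (x : L.obj v) (y : N.obj v),
      f.1.1 v ((x, y) : L.obj v × N.obj v) = f.1.1 v ((0, y) : L.obj v × N.obj v) :=
      fun f v x y => by
    have h0 : f.1.1 v ((x, 0) : L.obj v × N.obj v) = 0 :=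
      LinearMap.congr_fun (congr_fun (congrArg Subtype.val (LinearMap.mem_ker.1 f.2)) v) x
    have e : ((x, y) : L.obj v × N.obj v) = (x, 0) + (0, y) := by simp
    rw [e]
    exact (map_add (f.1.1 v) _ _).trans (by rw [h0, zero_add])
  let ψ : LinearMap.ker φ →ₗ[k] LinearMap.ker (extDiff N Z) :=
    { toFun := fun f => ⟨fun v => f.1.1 v ∘ₗ LinearMap.inr k (L.obj v) (N.obj v),
        mem_ker_extDiff.2 fun i j a x => by
          have h2 := mem_ker_extDiff.1 f.1.2 i j a ((0, x) : L.obj j × N.obj j)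
          rw [extn_map, hh f] at h2
          exact h2⟩
      map_add' := fun f f' => rfl
      map_smul' := fun c f => rfl }
  have h2 : Module.finrank k (LinearMap.ker φ) ≤ hom N Z := by
    refine LinearMap.finrank_le_finrank_of_injective (f := ψ) fun f f' hff => ?_
    refine Subtype.ext (Subtype.ext (funext fun v => LinearMap.ext fun x => ?_))
    obtain ⟨x, y⟩ := x
    have h3 : f.1.1 v ((0, y) : L.obj v × N.obj v) = f'.1.1 v ((0, y) : L.obj v × N.obj v) :=
      LinearMap.congr_fun (congr_fun (congrArg Subtype.val hff) v) y
    rw [hh f, hh f', h3]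
  rw [hom, ← h]
  omega

end Extension

end Basic

/-! ### The Auslander-Reiten formula. -/

section AuslanderReiten

variable {k V : Type u} [Field k] [Quiver.{u} V]

/-- The action of a path on a module. -/
def pathMap (X : QRep k V) {w v : V} : Quiver.Path w v → (X.obj v →ₗ[k] X.obj w)
  | .nil => LinearMap.id
  | .cons p a => pathMap X p ∘ₗ X.map a

theorem pathMap_toPath_comp (X : QRep k V) {u w v : V} (a : u ⟶ w) (p : Quiver.Path w v)
    (x : X.obj v) : X.pathMap (a.toPath.comp p) x = X.map a (X.pathMap p x) := by
  induction p with
  | nil => rfl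
  | cons p b ih => exact ih (X.map b x)

/-- The trivial path, as an element of the projective module. -/
def nilVec (k : Type u) {V : Type u} [Field k] [Quiver.{u} V] (v : V) : (proj k v).obj v :=
  Finsupp.single (Quiver.Path.nil : Quiver.Path v v) (1 : k)

/-- A path, as an element of the projective module. -/
def pathVec (k : Type u) {V : Type u} [Field k] [Quiver.{u} V] {w v : V} (p : Quiver.Path w v) :
    (proj k v).obj w :=
  Finsupp.single p (1 : k)

theorem proj_map_pathVec {u w v : V} (a : u ⟶ w) (p : Quiver.Path w v) :
    (proj k v).map a (pathVec k p) = pathVec k (a.toPath.comp p) :=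
  Finsupp.mapDomain_single

theorem projMap_pathVec {u v w : V} (a : v ⟶ w) (p : Quiver.Path u v) :
    projMap k a u (pathVec k p) = pathVec k (p.cons a) :=
  Finsupp.mapDomain_single

theorem proj_hom_ext {v w : V} {M : Type*} [AddCommGroup M] [Module k M]
    {f g : (proj k v).obj w →ₗ[k] M}
    (h : ∀ p : Quiver.Path w v, f (pathVec k p) = g (pathVec k p)) : f = g :=
  Finsupp.lhom_ext' fun p => LinearMap.ext_ring (h p)

/-- The morphism out of the projective module given by an element. -/
def yoneda {Y : QRep k V} {v : V} (y : Y.obj v) (w : V) : (proj k v).obj w →ₗ[k] Y.obj w :=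
  Finsupp.linearCombination k fun p : Quiver.Path w v => Y.pathMap p y

theorem yoneda_pathVec {Y : QRep k V} {v w : V} (y : Y.obj v) (p : Quiver.Path w v) :
    yoneda y w (pathVec k p) = Y.pathMap p y :=
  (Finsupp.linearCombination_single k (1 : k) p).trans (one_smul k _)

theorem isHom_yoneda {Y : QRep k V} {v : V} (y : Y.obj v) : IsHom (proj k v) Y (yoneda y) := by
  intro i j a x
  refine LinearMap.congr_fun (f := yoneda y i ∘ₗ (proj k v).map a)
    (g := Y.map a ∘ₗ yoneda y j) (proj_hom_ext fun p => ?_) x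
  rw [LinearMap.comp_apply, LinearMap.comp_apply, proj_map_pathVec, yoneda_pathVec, yoneda_pathVec,
    pathMap_toPath_comp]

theorem yoneda_add {Y : QRep k V} {v : V} (y y' : Y.obj v) :
    (yoneda (y + y') : ∀ w, _ →ₗ[k] Y.obj w) = yoneda y + yoneda y' := by
  funext w
  refine proj_hom_ext fun p => ?_
  rw [Pi.add_apply, LinearMap.add_apply, yoneda_pathVec, yoneda_pathVec, yoneda_pathVec, map_add]

theorem yoneda_smul {Y : QRep k V} {v : V} (c : k) (y : Y.obj v) :
    (yoneda (c • y) : ∀ w, _ →ₗ[k] Y.obj w) = c • yoneda y := by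
  funext w
  refine proj_hom_ext fun p => ?_
  rw [Pi.smul_apply, LinearMap.smul_apply, yoneda_pathVec, yoneda_pathVec, map_smul]

theorem yoneda_map {Y : QRep k V} {i j : V} (a : i ⟶ j) (y : Y.obj j) (w : V) :
    yoneda (Y.map a y) w = yoneda y w ∘ₗ projMap k a w := by
  refine proj_hom_ext fun p => ?_
  rw [LinearMap.comp_apply, projMap_pathVec, yoneda_pathVec, yoneda_pathVec]
  rfl

/-- The trivial path generates the projective module, since every path is obtained from it by acting
with arrows. -/
theorem eq_zero_of_nilVec {Y : QRep k V} {v : V} {f : ∀ w, (proj k v).obj w →ₗ[k] Y.obj w}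
    (hf : IsHom (proj k v) Y f) (h0 : f v (nilVec k v) = 0) : f = 0 := by
  have key : ∀ {w u : V} (p : Quiver.Path w u) (q : Quiver.Path u v), f u (pathVec k q) = 0 →
      f w (pathVec k (p.comp q)) = 0 := by
    intro w u p
    induction p with
    | nil =>
      intro q hq
      rwa [Quiver.Path.nil_comp]
    | cons p b ih =>
      intro q hq
      have : (p.cons b).comp q = p.comp (b.toPath.comp q) := by
        rw [← Quiver.Path.comp_assoc]
        rfl
      rw [this]
      refine ih _ ?_
      rw [← proj_map_pathVec, hf, hq, map_zero]
  funext w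
  refine proj_hom_ext fun p => ?_
  have := key p Quiver.Path.nil h0
  rwa [Quiver.Path.comp_nil] at this

section Tau

variable {X Y : QRep k V}

open Classical in
/-- The cochain supported at a single arrow. -/
def sing (X Y : QRep k V) {i j : V} (a : i ⟶ j) :
    (X.obj j →ₗ[k] Y.obj i) →ₗ[k] (∀ i j : V, (i ⟶ j) → (X.obj j →ₗ[k] Y.obj i)) :=
  LinearMap.single k (fun i => ∀ j : V, (i ⟶ j) → (X.obj j →ₗ[k] Y.obj i)) i ∘ₗ
    LinearMap.single k (fun j => (i ⟶ j) → (X.obj j →ₗ[k] Y.obj i)) j ∘ₗ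
    LinearMap.single k (fun _ : i ⟶ j => (X.obj j →ₗ[k] Y.obj i)) a

theorem sing_apply_self {i j : V} (a : i ⟶ j) (ψ : X.obj j →ₗ[k] Y.obj i) :
    sing X Y a ψ i j a = ψ := by
  simp [sing]

theorem cochainPush_sing {Y' : QRep k V} (g : ∀ v, Y.obj v →ₗ[k] Y'.obj v) {i j : V} (a : i ⟶ j)
    (ψ : X.obj j →ₗ[k] Y.obj i) : cochainPush X g (sing X Y a ψ) = sing X Y' a (g i ∘ₗ ψ) := by
  classical
  funext i' j' a'
  by_cases hi : i' = i
  · subst hi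
    by_cases hj : j' = j
    · subst hj
      by_cases ha : a' = a
      · subst ha
        simp [cochainPush, sing]
      · simp [cochainPush, sing, ha]
    · simp [cochainPush, sing, hj]
  · simp [cochainPush, sing, hi]

theorem extPush_mk {Y' : QRep k V} {g : ∀ v, Y.obj v →ₗ[k] Y'.obj v} (hg : IsHom Y Y' g)
    (z : ∀ i j : V, (i ⟶ j) → (X.obj j →ₗ[k] Y.obj i)) :
    extPush X hg (Submodule.Quotient.mk z) = Submodule.Quotient.mk (cochainPush X g z) := rfl

theorem extMap_mk {v w : V} (a : v ⟶ w)
    (z : ∀ i j : V, (i ⟶ j) → (X.obj j →ₗ[k] (proj k v).obj i)) :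
    extMap X a (Submodule.Quotient.mk z) =
      Submodule.Quotient.mk (cochainPush X (projMap k a) z) := rfl

/-- Reduces identities for cochains to rank-one maps `l.smulRight y`, where the pairing with the
translate is explicit. -/
theorem eq_sum_coord_smulRight {A B : Type*} [AddCommGroup A] [Module k A]
    [FiniteDimensional k A] [AddCommGroup B] [Module k B] (f : A →ₗ[k] B) :
    f = ∑ s, ((Module.finBasis k A).coord s).smulRight (f (Module.finBasis k A s)) := by
  refine (Module.finBasis k A).ext fun t => ?_
  simp [LinearMap.sum_apply, Finsupp.single_apply, ite_smul]

variable [Fintype V] [∀ i j : V, Fintype (i ⟶ j)]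

theorem sum_sing (z : ∀ i j : V, (i ⟶ j) → (X.obj j →ₗ[k] Y.obj i)) :
    ∑ i, ∑ j, ∑ a : i ⟶ j, sing X Y a (z i j a) = z := by
  classical
  have h : ∀ i, ∑ j, ∑ a : i ⟶ j, sing X Y a (z i j a) = Pi.single i (z i) := fun i => by
    have e : z i = ∑ j, LinearMap.single k (fun j => (i ⟶ j) → (X.obj j →ₗ[k] Y.obj i)) j
        (∑ a : i ⟶ j, LinearMap.single k (fun _ : i ⟶ j => (X.obj j →ₗ[k] Y.obj i)) a
          (z i j a)) := by
      refine (Finset.univ_sum_single (z i)).symm.trans (Finset.sum_congr rfl fun j _ => ?_)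
      exact congrArg (Pi.single j) (Finset.univ_sum_single (z i j)).symm
    conv_rhs => rw [e]
    change _ = LinearMap.single k (fun i => ∀ j : V, (i ⟶ j) → (X.obj j →ₗ[k] Y.obj i)) i _
    simp only [map_sum]
    refine Finset.sum_congr rfl fun j _ => Finset.sum_congr rfl fun a _ => ?_
    unfold sing
    simp only [LinearMap.comp_apply]
  simp only [h]
  exact Finset.univ_sum_single z

/-- The functional on the first extension group given by a morphism to the translate. -/
def tauFunctional (hX : X.IsFD) {g : ∀ v, Y.obj v →ₗ[k] (tau X).obj v} {i j : V} (a : i ⟶ j) :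
    (X.obj j →ₗ[k] Y.obj i) →ₗ[k] k :=
  haveI := hX j
  -- In the decomposition of `h` into rank-one maps, each vector `y` is replaced by the trivial
  -- path, and the resulting class is evaluated by the functional `g i y`.
  { toFun := fun h => ∑ s, (show Module.Dual k (Ext1 X (proj k i)) from
        g i (h (Module.finBasis k (X.obj j) s)))
        (Submodule.Quotient.mk (sing X (proj k i) a
          (((Module.finBasis k (X.obj j)).coord s).smulRight (nilVec k i))))
    map_add' := fun h h' => by
      rw [← Finset.sum_add_distrib]
      refine Finset.sum_congr rfl fun s _ => ?_
      rw [LinearMap.add_apply, map_add]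
      rfl
    map_smul' := fun c h => by
      rw [RingHom.id_apply, Finset.smul_sum]
      refine Finset.sum_congr rfl fun s _ => ?_
      rw [LinearMap.smul_apply, map_smul]
      rfl }

omit [Fintype V] [∀ i j : V, Fintype (i ⟶ j)] in
theorem tauFunctional_apply (hX : X.IsFD) {i j : V} [FiniteDimensional k (X.obj j)]
    {g : ∀ v, Y.obj v →ₗ[k] (tau X).obj v} (a : i ⟶ j) (h : X.obj j →ₗ[k] Y.obj i) :
    tauFunctional hX (g := g) a h = ∑ s, (show Module.Dual k (Ext1 X (proj k i)) from
        g i (h (Module.finBasis k (X.obj j) s)))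
        (Submodule.Quotient.mk (sing X (proj k i) a
          (((Module.finBasis k (X.obj j)).coord s).smulRight (nilVec k i)))) := rfl

omit [Fintype V] [∀ i j : V, Fintype (i ⟶ j)] in
-- Frees the functional from the basis used to define it.
theorem tauFunctional_smulRight (hX : X.IsFD) {g : ∀ v, Y.obj v →ₗ[k] (tau X).obj v} {i j : V}
    (a : i ⟶ j) (l : X.obj j →ₗ[k] k) (y : Y.obj i) :
    tauFunctional hX (g := g) a (l.smulRight y) =
      (show Module.Dual k (Ext1 X (proj k i)) from g i y)
        (Submodule.Quotient.mk (sing X (proj k i) a (l.smulRight (nilVec k i)))) := by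
  have := hX j
  have e : l.smulRight (nilVec k i) = ∑ s, l (Module.finBasis k (X.obj j) s) •
      ((Module.finBasis k (X.obj j)).coord s).smulRight (nilVec k i) := by
    refine (Module.finBasis k (X.obj j)).ext fun t => ?_
    simp [LinearMap.sum_apply, Finsupp.single_apply, ite_smul]
  rw [e, map_sum]
  have e2 : (Submodule.Quotient.mk (∑ s, sing X (proj k i) a
      (l (Module.finBasis k (X.obj j) s) •
      ((Module.finBasis k (X.obj j)).coord s).smulRight (nilVec k i))) : Ext1 X (proj k i)) =
      ∑ s, l (Module.finBasis k (X.obj j) s) • Submodule.Quotient.mk (sing X (proj k i) a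
      (((Module.finBasis k (X.obj j)).coord s).smulRight (nilVec k i))) := by
    simp only [map_smul]
    exact map_sum (Submodule.mkQ (LinearMap.range (extDiff X (proj k i)))) _ _
  rw [e2]
  generalize hG : (show Module.Dual k (Ext1 X (proj k i)) from g i y) = G
  rw [map_sum]
  rw [tauFunctional_apply]
  refine Finset.sum_congr rfl fun s _ => ?_
  rw [map_smul, ← hG, LinearMap.smulRight_apply]
  exact LinearMap.congr_fun ((g i).map_smul _ y) _

/-- The total functional on cochains. -/
def tauCochain (hX : X.IsFD) (g : ∀ v, Y.obj v →ₗ[k] (tau X).obj v) :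
    (∀ i j : V, (i ⟶ j) → (X.obj j →ₗ[k] Y.obj i)) →ₗ[k] k :=
  ∑ i, ∑ j, ∑ a : i ⟶ j, tauFunctional hX (g := g) a ∘ₗ
    LinearMap.proj (R := k) (φ := fun _ : i ⟶ j => (X.obj j →ₗ[k] Y.obj i)) a ∘ₗ
    LinearMap.proj (R := k) (φ := fun j => (i ⟶ j) → (X.obj j →ₗ[k] Y.obj i)) j ∘ₗ
    LinearMap.proj (R := k) (φ := fun i => ∀ j : V, (i ⟶ j) → (X.obj j →ₗ[k] Y.obj i)) i

theorem tauCochain_apply (hX : X.IsFD) (g : ∀ v, Y.obj v →ₗ[k] (tau X).obj v)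
    (z : ∀ i j : V, (i ⟶ j) → (X.obj j →ₗ[k] Y.obj i)) :
    tauCochain hX g z = ∑ i, ∑ j, ∑ a : i ⟶ j, tauFunctional hX (g := g) a (z i j a) := by
  simp [tauCochain, LinearMap.sum_apply]

theorem tauCochain_sing (hX : X.IsFD) (g : ∀ v, Y.obj v →ₗ[k] (tau X).obj v) {i j : V} (a : i ⟶ j)
    (h : X.obj j →ₗ[k] Y.obj i) :
    tauCochain hX g (sing X Y a h) = tauFunctional hX (g := g) a h := by
  classical
  rw [tauCochain_apply, Finset.sum_eq_single i, Finset.sum_eq_single j, Finset.sum_eq_single a,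
    sing_apply_self]
  · intro b _ hb
    simp [sing, hb]
  · simp
  · intro b _ hb
    simp [sing, hb]
  · simp
  · intro b _ hb
    simp [sing, hb]
  · simp

omit [Fintype V] [∀ i j : V, Fintype (i ⟶ j)] in
/-- The action of the arrows on the translate. -/
theorem tau_isHom_apply {g : ∀ v, Y.obj v →ₗ[k] (tau X).obj v} (hg : IsHom Y (tau X) g) {i j : V}
    (a : i ⟶ j) (y : Y.obj j) (ξ : Ext1 X (proj k i)) :
    (show Module.Dual k (Ext1 X (proj k i)) from g i (Y.map a y)) ξ =
      (show Module.Dual k (Ext1 X (proj k j)) from g j y) (extMap X a ξ) :=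
  LinearMap.congr_fun (hg i j a y) ξ

/-- This lets the functional descend to `Ext¹(X, Y)`. For a rank-one family `l.smulRight y` placed
at a vertex `v`, the value on its coboundary is that of `g v y` on the coboundary with the trivial
path in place of `y`, whose class is zero. -/
theorem tauCochain_extDiff (hX : X.IsFD) {g : ∀ v, Y.obj v →ₗ[k] (tau X).obj v}
    (hg : IsHom Y (tau X) g) : tauCochain hX g ∘ₗ extDiff X Y = 0 := by
  classical
  refine LinearMap.pi_ext' fun v => LinearMap.ext fun h => ?_
  have := hX v
  change (tauCochain hX g ∘ₗ extDiff X Y ∘ₗ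
    LinearMap.single k (fun v => X.obj v →ₗ[k] Y.obj v) v) h = 0
  rw [eq_sum_coord_smulRight h, map_sum]
  refine Finset.sum_eq_zero fun s _ => ?_
  generalize (Module.finBasis k (X.obj v)).coord s = l
  generalize h _ = y
  let F : ∀ w, X.obj w →ₗ[k] Y.obj w := Pi.single v (l.smulRight y)
  let G : ∀ w, X.obj w →ₗ[k] (proj k v).obj w := Pi.single v (l.smulRight (nilVec k v))
  let γ : Module.Dual k (Ext1 X (proj k v)) := g v y
  have h0 : γ (Submodule.Quotient.mk (extDiff X (proj k v) G)) = 0 := by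
    rw [(Submodule.Quotient.mk_eq_zero (LinearMap.range (extDiff X (proj k v)))).2 ⟨G, rfl⟩,
      map_zero]
  rw [← sum_sing (extDiff X (proj k v) G)] at h0
  change tauCochain hX g (extDiff X Y F) = 0
  rw [tauCochain_apply, ← h0]
  have e : ∀ z : (∀ i j : V, (i ⟶ j) → (X.obj j →ₗ[k] (proj k v).obj i)),
      γ (Submodule.Quotient.mk z) = (γ ∘ₗ Submodule.mkQ _) z := fun _ => rfl
  rw [e, map_sum]
  refine Finset.sum_congr rfl fun i _ => ?_
  rw [map_sum]
  refine Finset.sum_congr rfl fun j _ => ?_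
  rw [map_sum]
  refine Finset.sum_congr rfl fun a _ => ?_
  have e1 : extDiff X Y F i j a = Y.map a ∘ₗ F j - F i ∘ₗ X.map a := rfl
  have e2 : extDiff X (proj k v) G i j a = (proj k v).map a ∘ₗ G j - G i ∘ₗ X.map a := rfl
  rw [e1, e2, map_sub, map_sub, map_sub]
  congr 1
  · by_cases hj : j = v
    · subst hj
      have hF : F j = l.smulRight y := Pi.single_eq_same _ _
      have hG : G j = l.smulRight (nilVec k j) := Pi.single_eq_same _ _
      have h1 : Y.map a ∘ₗ l.smulRight y = l.smulRight (Y.map a y) := by ext; simp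
      -- The arrow `a`, as a path, is obtained from the trivial path at either of its ends.
      have h2 : (proj k j).map a ∘ₗ l.smulRight (nilVec k j) =
          projMap k a i ∘ₗ l.smulRight (nilVec k i) := by
        ext x
        rw [LinearMap.comp_apply, LinearMap.comp_apply, LinearMap.smulRight_apply,
          LinearMap.smulRight_apply, map_smul, map_smul]
        congr 1
        exact (proj_map_pathVec a _).trans (projMap_pathVec a _).symm
      rw [hF, hG, h1, h2, tauFunctional_smulRight, tau_isHom_apply hg, extMap_mk,
        cochainPush_sing]
      rfl
    · have hF : F j = 0 := Pi.single_eq_of_ne hj _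
      have hG : G j = 0 := Pi.single_eq_of_ne hj _
      rw [hF, hG, LinearMap.comp_zero, LinearMap.comp_zero, map_zero, map_zero, map_zero]
  · by_cases hi : i = v
    · subst hi
      have hF : F i = l.smulRight y := Pi.single_eq_same _ _
      have hG : G i = l.smulRight (nilVec k i) := Pi.single_eq_same _ _
      have h1 : l.smulRight y ∘ₗ X.map a = (l ∘ₗ X.map a).smulRight y := by ext; simp
      have h2 : l.smulRight (nilVec k i) ∘ₗ X.map a =
        (l ∘ₗ X.map a).smulRight (nilVec k i) := by ext; simp
      rw [hF, hG, h1, h2, tauFunctional_smulRight]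
      rfl
    · have hF : F i = 0 := Pi.single_eq_of_ne hi _
      have hG : G i = 0 := Pi.single_eq_of_ne hi _
      rw [hF, hG, LinearMap.zero_comp, LinearMap.zero_comp, map_zero, map_zero, map_zero]

omit [Fintype V] [∀ i j : V, Fintype (i ⟶ j)] in
-- Compatibility with one arrow, iterated along `p`: acting by `p` on `y` is traded for putting `p`
-- in place of the trivial path.
theorem tau_isHom_pathMap {g : ∀ v, Y.obj v →ₗ[k] (tau X).obj v} (hg : IsHom Y (tau X) g)
    {i j v : V} (a : i ⟶ j) (p : Quiver.Path i v) (y : Y.obj v) (l : X.obj j →ₗ[k] k) :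
    (show Module.Dual k (Ext1 X (proj k i)) from g i (Y.pathMap p y))
      (Submodule.Quotient.mk (sing X (proj k i) a (l.smulRight (nilVec k i)))) =
    (show Module.Dual k (Ext1 X (proj k v)) from g v y)
      (Submodule.Quotient.mk (sing X (proj k v) a (l.smulRight (pathVec k p)))) := by
  induction p with
  | nil => rfl
  | cons p b ih =>
    refine (ih (Y.map b y)).trans ?_
    rw [tau_isHom_apply hg, extMap_mk, cochainPush_sing]
    congr 3
    ext x
    rw [LinearMap.comp_apply, LinearMap.smulRight_apply, LinearMap.smulRight_apply, map_smul,
      projMap_pathVec]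

end Tau

section TauDim

variable {X Y : QRep k V} [Finite V] [∀ i j : V, Finite (i ⟶ j)]

/-- A morphism `g` induces a functional on `Ext¹(X, Y)`. It determines `g`, because classes
supported at one arrow and of the form `l.smulRight p`, with `p` a path, span `Ext¹(X, P_v)`, and
`tau_isHom_pathMap` recovers the values of `g v y` on them. -/
theorem hom_tau_le (hX : X.IsFD) (hY : Y.IsFD) : hom Y (tau X) ≤ ext X Y := by
  have := Fintype.ofFinite V
  have := fun i j : V => Fintype.ofFinite (i ⟶ j)
  have := hX.finite_ext hY
  let Ψ : LinearMap.ker (extDiff Y (tau X)) →ₗ[k] Module.Dual k (Ext1 X Y) :=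
    { toFun := fun g => Submodule.liftQ _ (tauCochain hX g.1)
        (LinearMap.range_le_ker_iff.2 (tauCochain_extDiff hX (mem_ker_extDiff.1 g.2)))
      map_add' := fun g g' => by
        refine LinearMap.ext fun ξ => ?_
        obtain ⟨z, rfl⟩ := Submodule.mkQ_surjective _ ξ
        change tauCochain hX _ z = tauCochain hX _ z + tauCochain hX _ z
        simp only [tauCochain_apply, ← Finset.sum_add_distrib]
        refine Finset.sum_congr rfl fun i _ => Finset.sum_congr rfl fun j _ =>
          Finset.sum_congr rfl fun a _ => ?_
        have := hX j
        rw [tauFunctional_apply, tauFunctional_apply, tauFunctional_apply,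
          ← Finset.sum_add_distrib]
        rfl
      map_smul' := fun c g => by
        refine LinearMap.ext fun ξ => ?_
        obtain ⟨z, rfl⟩ := Submodule.mkQ_surjective _ ξ
        change tauCochain hX _ z = c * tauCochain hX _ z
        simp only [tauCochain_apply, Finset.mul_sum]
        refine Finset.sum_congr rfl fun i _ => Finset.sum_congr rfl fun j _ =>
          Finset.sum_congr rfl fun a _ => ?_
        have := hX j
        rw [tauFunctional_apply, tauFunctional_apply, Finset.mul_sum]
        rfl }
  have hΨ : Function.Injective Ψ := by
    rw [injective_iff_map_eq_zero]
    rintro ⟨g, hg⟩ h0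
    have hg := mem_ker_extDiff.1 hg
    have h1 : ∀ z, tauCochain hX g z = 0 := fun z => LinearMap.congr_fun h0 (Submodule.Quotient.mk z)
    refine Subtype.ext (funext fun v => LinearMap.ext fun y => ?_)
    refine LinearMap.ext (M := Ext1 X (proj k v)) (f := g v y) (g := 0) fun ξ => ?_
    obtain ⟨z, rfl⟩ := Submodule.mkQ_surjective _ ξ
    let γ : Module.Dual k (Ext1 X (proj k v)) := g v y
    change (γ ∘ₗ Submodule.mkQ _) z = 0
    rw [← sum_sing z]
    simp only [map_sum]
    refine Finset.sum_eq_zero fun i _ => Finset.sum_eq_zero fun j _ =>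
      Finset.sum_eq_zero fun a _ => ?_
    have := hX j
    rw [eq_sum_coord_smulRight (z i j a)]
    simp only [map_sum]
    refine Finset.sum_eq_zero fun s _ => ?_
    generalize (Module.finBasis k (X.obj j)).coord s = l
    generalize z i j a _ = q
    let θ : (proj k v).obj i →ₗ[k] k :=
      { toFun := fun q => γ (Submodule.Quotient.mk (sing X (proj k v) a (l.smulRight q)))
        map_add' := fun q q' => by
          rw [← map_add, ← Submodule.Quotient.mk_add, ← map_add]
          congr 3
          ext x
          simp
        map_smul' := fun c q => by
          rw [RingHom.id_apply, ← map_smul, ← Submodule.Quotient.mk_smul, ← map_smul]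
          congr 3
          ext x
          exact smul_comm _ _ _ }
    have hθ : θ = 0 := proj_hom_ext fun p => by
      refine (tau_isHom_pathMap hg a p y l).symm.trans ?_
      rw [← tauFunctional_smulRight hX, ← tauCochain_sing hX, h1]
      rfl
    exact LinearMap.congr_fun hθ q
  have h := LinearMap.finrank_le_finrank_of_injective hΨ
  rwa [Subspace.dual_finrank_eq] at h

/-- A functional on `Ext¹(X, Y)` is pulled back, for each `y`, along the morphism `P_v → Y` defined
by `y`. Nothing is lost, since every rank-one cochain at an arrow is pushed forward along such a
morphism. -/
theorem le_hom_tau (hX : X.IsFD) (hY : Y.IsFD) (hτ : (tau X).IsFD) : ext X Y ≤ hom Y (tau X) := by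
  have := Fintype.ofFinite V
  have := fun i j : V => Fintype.ofFinite (i ⟶ j)
  have := hY.finite_hom hτ
  let Φ : Module.Dual k (Ext1 X Y) →ₗ[k] LinearMap.ker (extDiff Y (tau X)) :=
    { toFun := fun φ => ⟨fun v =>
        { toFun := fun y => φ ∘ₗ extPush X (isHom_yoneda y)
          map_add' := fun y y' => by
            refine LinearMap.ext fun ξ => ?_
            obtain ⟨z, rfl⟩ := Submodule.mkQ_surjective _ ξ
            refine Eq.trans ?_ (map_add φ _ _)
            refine congrArg φ (congrArg Submodule.Quotient.mk
              (a₂ := cochainPush X (yoneda y) z + cochainPush X (yoneda y') z) ?_)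
            rw [yoneda_add]
            rfl
          map_smul' := fun c y => by
            refine LinearMap.ext fun ξ => ?_
            obtain ⟨z, rfl⟩ := Submodule.mkQ_surjective _ ξ
            refine Eq.trans ?_ (map_smul φ _ _)
            refine congrArg φ (congrArg Submodule.Quotient.mk
              (a₂ := c • cochainPush X (yoneda y) z) ?_)
            rw [yoneda_smul]
            rfl }, mem_ker_extDiff.2 fun i j a y => by
              refine LinearMap.ext (M := Ext1 X (proj k i)) fun ξ => ?_
              obtain ⟨z, rfl⟩ := Submodule.mkQ_surjective _ ξ
              refine congrArg φ (congrArg Submodule.Quotient.mk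
                (a₁ := cochainPush X (yoneda (Y.map a y)) z)
                (a₂ := cochainPush X (yoneda y) (cochainPush X (projMap k a) z)) ?_)
              funext i' j' a'
              refine LinearMap.ext fun x => ?_
              exact LinearMap.congr_fun (yoneda_map a y i') (z i' j' a' x)⟩
      map_add' := fun φ φ' => rfl
      map_smul' := fun c φ => rfl }
  have hΦ : Function.Injective Φ := by
    rw [injective_iff_map_eq_zero]
    intro φ h0
    have h1 : ∀ v (y : Y.obj v) (z : ∀ i j : V, (i ⟶ j) → (X.obj j →ₗ[k] (proj k v).obj i)),
        φ (Submodule.Quotient.mk (cochainPush X (yoneda y) z)) = 0 := fun v y z =>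
      LinearMap.congr_fun (M := Ext1 X (proj k v)) (g := 0)
        (LinearMap.congr_fun (congr_fun (congrArg Subtype.val h0) v) y) (Submodule.Quotient.mk z)
    refine LinearMap.ext fun ξ => ?_
    obtain ⟨z, rfl⟩ := Submodule.mkQ_surjective _ ξ
    change (φ ∘ₗ Submodule.mkQ _) z = 0
    rw [← sum_sing z]
    simp only [map_sum]
    refine Finset.sum_eq_zero fun i _ => Finset.sum_eq_zero fun j _ =>
      Finset.sum_eq_zero fun a _ => ?_
    have := hX j
    rw [eq_sum_coord_smulRight (z i j a)]
    simp only [map_sum]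
    refine Finset.sum_eq_zero fun s _ => ?_
    generalize (Module.finBasis k (X.obj j)).coord s = l
    generalize z i j a _ = y
    have h2 := h1 i y (sing X (proj k i) a (l.smulRight (nilVec k i)))
    rw [cochainPush_sing] at h2
    have h3 : yoneda y i ∘ₗ l.smulRight (nilVec k i) = l.smulRight y := by
      ext x
      rw [LinearMap.comp_apply, LinearMap.smulRight_apply, LinearMap.smulRight_apply, map_smul]
      congr 1
      exact yoneda_pathVec y _
    rw [h3] at h2
    exact h2
  have h := LinearMap.finrank_le_finrank_of_injective hΦ
  rwa [Subspace.dual_finrank_eq] at h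

/-- The Auslander-Reiten formula. -/
theorem hom_tau (hX : X.IsFD) (hY : Y.IsFD) (hτ : (tau X).IsFD) : hom Y (tau X) = ext X Y :=
  le_antisymm (hom_tau_le hX hY) (le_hom_tau hX hY hτ)

end TauDim

end AuslanderReiten

end QRep

/-! ### Counting paths in an acyclic quiver. -/

section Paths

variable {V : Type u} [Quiver.{u} V]

theorem wellFounded_arrow [Finite V] (hQ : IsAcyclic V) :
    WellFounded fun u v : V => Nonempty (u ⟶ v) := by
  let r : V → V → Prop := fun u v => ∃ p : Quiver.Path u v, p.length ≠ 0
  have : IsTrans V r := ⟨fun u v w ⟨p, hp⟩ ⟨q, _⟩ => ⟨p.comp q, by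
    rw [Quiver.Path.length_comp]; omega⟩⟩
  have : Std.Irrefl r := ⟨fun u ⟨p, hp⟩ => hp (hQ u p)⟩
  refine Subrelation.wf (r := r) ?_ (Finite.wellFounded_of_trans_of_irrefl r)
  rintro u v ⟨a⟩
  exact ⟨a.toPath, by simp⟩

/-- A path is trivial or ends with an arrow. -/
def pathEquiv (w v : V) :
    Quiver.Path w v ≃ PLift (w = v) ⊕ Σ u : V, Quiver.Path w u × (u ⟶ v) where
  toFun
    | .nil => .inl ⟨rfl⟩
    | .cons p a => .inr ⟨_, p, a⟩
  invFun
    | .inl h => h.down ▸ .nil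
    | .inr x => x.2.1.cons x.2.2
  left_inv p := by cases p <;> rfl
  right_inv x := by
    rcases x with ⟨h⟩ | ⟨u, p, a⟩
    · obtain ⟨rfl⟩ := h
      rfl
    · rfl

variable [∀ i j : V, Finite (i ⟶ j)]

theorem finite_path [Finite V] (hQ : IsAcyclic V) (w v : V) : Finite (Quiver.Path w v) := by
  induction v using (wellFounded_arrow hQ).induction with
  | _ v ih =>
    have : ∀ u : V, Finite (Quiver.Path w u × (u ⟶ v)) := fun u => by
      by_cases h : Nonempty (u ⟶ v)
      · have := ih u h
        infer_instance
      · have := not_nonempty_iff.1 h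
        infer_instance
    exact Finite.of_equiv _ (pathEquiv w v).symm

/-- Splitting off the last arrow says that the matrix of path counts inverts the matrix of the Euler
form; `euler_proj` and `euler_inj` rest on this. -/
theorem card_path [Fintype V] [DecidableEq V] (hQ : IsAcyclic V) (w v : V) :
    (Nat.card (Quiver.Path w v) : ℤ) = (if w = v then 1 else 0) +
      ∑ u, (Nat.card (Quiver.Path w u) : ℤ) * numArrows u v := by
  have := finite_path hQ w
  rw [Nat.card_congr (pathEquiv w v), Nat.card_sum, Nat.card_sigma]
  push_cast
  congr 1
  · split_ifs with h
    · have : Unique (PLift (w = v)) := ⟨⟨⟨h⟩⟩, fun _ => rfl⟩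
      simp
    · have : IsEmpty (PLift (w = v)) := ⟨fun x => h x.down⟩
      simp
  · refine Finset.sum_congr rfl fun u _ => ?_
    rw [Nat.card_prod]
    push_cast
    rfl

omit [∀ i j : V, Finite (i ⟶ j)] in
theorem card_path_self (hQ : IsAcyclic V) (v : V) : Nat.card (Quiver.Path v v) = 1 := by
  have : Unique (Quiver.Path v v) := ⟨⟨.nil⟩, fun p => Quiver.Path.eq_nil_of_length_zero p (hQ v p)⟩
  simp

end Paths

namespace QRep

/-! ### Projective and injective modules, and the Coxeter transformation. -/

section ProjInj

variable {k V : Type u} [Field k] [Quiver.{u} V] [∀ i j : V, Finite (i ⟶ j)]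

section

variable [Finite V]

theorem isFD_proj (hQ : IsAcyclic V) (v : V) : (proj k v).IsFD := fun w => by
  have := finite_path hQ w v
  exact inferInstanceAs (FiniteDimensional k (Quiver.Path w v →₀ k))

theorem isFD_inj (hQ : IsAcyclic V) (v : V) : (inj k v).IsFD := fun w => by
  have := finite_path hQ v w
  exact inferInstanceAs (FiniteDimensional k (Quiver.Path v w → k))

theorem isFD_tau (hQ : IsAcyclic V) {X : QRep k V} (hX : X.IsFD) : (tau X).IsFD := fun v => by
  have := hX.finite_ext (isFD_proj (k := k) hQ v)
  exact inferInstanceAs (FiniteDimensional k (Module.Dual k (Ext1 X (proj k v))))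

theorem dimZ_proj (hQ : IsAcyclic V) (v w : V) :
    (proj k v).dimZ w = Nat.card (Quiver.Path w v) := by
  have := finite_path hQ w v
  have := Fintype.ofFinite (Quiver.Path w v)
  rw [Nat.card_eq_fintype_card]
  exact congrArg Nat.cast (Module.finrank_finsupp_self k)

theorem dimZ_inj (hQ : IsAcyclic V) (v w : V) :
    (inj k v).dimZ w = Nat.card (Quiver.Path v w) := by
  have := finite_path hQ v w
  have := Fintype.ofFinite (Quiver.Path v w)
  rw [Nat.card_eq_fintype_card]
  exact congrArg Nat.cast (Module.finrank_fintype_fun_eq_card k)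

theorem dimZ_tau {X : QRep k V} (v : V) : (tau X).dimZ v = ext X (proj k v) :=
  congrArg Nat.cast Subspace.dual_finrank_eq

theorem hom_tau' (hQ : IsAcyclic V) {X Y : QRep k V} (hX : X.IsFD) (hY : Y.IsFD) :
    hom Y (tau X) = ext X Y :=
  hom_tau hX hY (isFD_tau hQ hX)

theorem hom_proj_le {Z : QRep k V} (hZ : Z.IsFD) (v : V) : hom (proj k v) Z ≤ Z.dimVec v := by
  have := hZ v
  let φ : LinearMap.ker (extDiff (proj k v) Z) →ₗ[k] Z.obj v :=
    { toFun := fun f => f.1 v (nilVec k v)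
      map_add' := fun f g => rfl
      map_smul' := fun c f => rfl }
  refine LinearMap.finrank_le_finrank_of_injective (f := φ) ?_
  rw [injective_iff_map_eq_zero]
  exact fun f hf => Subtype.ext (eq_zero_of_nilVec (mem_ker_extDiff.1 f.2) hf)

/-- A morphism into the injective is determined by its coefficient at the trivial path: the
coefficient at `p.cons a` is the one at `p` after applying `a`. -/
theorem hom_inj_le {Z : QRep k V} (hZ : Z.IsFD) (v : V) : hom Z (inj k v) ≤ Z.dimVec v := by
  have := hZ v
  let φ : LinearMap.ker (extDiff Z (inj k v)) →ₗ[k] Module.Dual k (Z.obj v) :=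
    { toFun := fun f => LinearMap.proj (R := k) (φ := fun _ : Quiver.Path v v => k) .nil ∘ₗ
        (show Z.obj v →ₗ[k] (Quiver.Path v v → k) from f.1 v)
      map_add' := fun f g => rfl
      map_smul' := fun c f => rfl }
  have h := LinearMap.finrank_le_finrank_of_injective (f := φ) ?_
  · rwa [Subspace.dual_finrank_eq] at h
  rw [injective_iff_map_eq_zero]
  intro f hf
  have key : ∀ {w : V} (p : Quiver.Path v w) (x : Z.obj w),
      (show Quiver.Path v w → k from f.1 w x) p = 0 := by
    intro w p
    induction p with
    | nil => exact fun x => LinearMap.congr_fun hf x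
    | cons p a ih =>
      intro x
      rw [← ih (Z.map a x)]
      exact (congr_fun (mem_ker_extDiff.1 f.2 _ _ a x) p).symm
  exact Subtype.ext (funext fun w => LinearMap.ext fun x => funext fun p => key p x)

end

variable [Fintype V]

theorem dimZ_proj_eq [DecidableEq V] (hQ : IsAcyclic V) (v : V) : (proj k v).dimZ =
    Pi.single v 1 + ∑ u, (numArrows u v : ℤ) • (proj k u).dimZ := by
  funext w
  rw [dimZ_proj hQ, card_path hQ, Pi.add_apply, Finset.sum_apply, Pi.single_apply]
  congr 1
  refine Finset.sum_congr rfl fun u _ => ?_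
  rw [Pi.smul_apply, dimZ_proj hQ, smul_eq_mul, mul_comm]

variable (k) in
theorem euler_proj (hQ : IsAcyclic V) (v : V) (z : V → ℤ) :
    euler (proj k v).dimZ z = z v := by
  classical
  induction v using (wellFounded_arrow hQ).induction with
  | _ v ih =>
    rw [dimZ_proj_eq hQ, euler_add_left, euler_sum_left, euler_single_left]
    have : ∀ u, euler ((numArrows u v : ℤ) • (proj k u).dimZ) z = z u * numArrows u v := by
      intro u
      rw [euler_smul_left]
      by_cases h : Nonempty (u ⟶ v)
      · rw [ih u h, mul_comm]
      · have := not_nonempty_iff.1 h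
        simp [numArrows]
    rw [Finset.sum_congr rfl fun u _ => this u]
    ring

variable (k) in
theorem euler_inj (hQ : IsAcyclic V) (v : V) (z : V → ℤ) :
    euler z (inj k v).dimZ = z v := by
  classical
  simp only [euler, dimZ_inj hQ, mul_assoc, ← Finset.mul_sum, ← Finset.sum_sub_distrib,
    ← mul_sub]
  have : ∀ w, ((Nat.card (Quiver.Path v w) : ℤ) -
      ∑ u, (Nat.card (Quiver.Path v u) : ℤ) * numArrows u w) = if v = w then 1 else 0 := by
    intro w
    rw [card_path hQ v w]
    ring
  simp [this]

/-- The Euler form gives `hom - ext = dim Z_v`, and `hom` is at most `dim Z_v` because the image of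
the trivial path determines a morphism. Hence equality, and the vanishing of `ext` follows. -/
theorem hom_proj (hQ : IsAcyclic V) {Z : QRep k V} (hZ : Z.IsFD) (v : V) :
    hom (proj k v) Z = Z.dimVec v := by
  have h := hom_sub_ext (isFD_proj (k := k) hQ v) hZ
  rw [euler_proj k hQ] at h
  have := hom_proj_le hZ v
  simp only [dimZ] at h
  omega

theorem ext_proj (hQ : IsAcyclic V) {Z : QRep k V} (hZ : Z.IsFD) (v : V) :
    ext (proj k v) Z = 0 := by
  have h := hom_sub_ext (isFD_proj (k := k) hQ v) hZ
  rw [euler_proj k hQ, hom_proj hQ hZ] at h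
  simp only [dimZ] at h
  omega

theorem hom_inj (hQ : IsAcyclic V) {Z : QRep k V} (hZ : Z.IsFD) (v : V) :
    hom Z (inj k v) = Z.dimVec v := by
  have h := hom_sub_ext hZ (isFD_inj (k := k) hQ v)
  rw [euler_inj k hQ] at h
  have := hom_inj_le hZ v
  simp only [dimZ] at h
  omega

theorem ext_inj (hQ : IsAcyclic V) {Z : QRep k V} (hZ : Z.IsFD) (v : V) :
    ext Z (inj k v) = 0 := by
  have h := hom_sub_ext hZ (isFD_inj (k := k) hQ v)
  rw [euler_inj k hQ, hom_inj hQ hZ] at h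
  simp only [dimZ] at h
  omega

theorem hom_proj_self (hQ : IsAcyclic V) (v : V) : hom (proj k v) (proj k v) = 1 := by
  rw [hom_proj hQ (isFD_proj hQ v)]
  have h := dimZ_proj (k := k) hQ v v
  rw [card_path_self hQ] at h
  exact Int.natCast_inj.1 h

theorem hom_inj_self (hQ : IsAcyclic V) (v : V) : hom (inj k v) (inj k v) = 1 := by
  rw [hom_inj hQ (isFD_inj hQ v)]
  have h := dimZ_inj (k := k) hQ v v
  rw [card_path_self hQ] at h
  exact Int.natCast_inj.1 h

/-- Pairing with the injective modules reads off the coordinates. -/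
theorem eq_of_euler_left (k : Type u) [Field k] (hQ : IsAcyclic V) {y y' : V → ℤ} (h : ∀ z, euler y z = euler y' z) :
    y = y' :=
  funext fun v => by rw [← euler_inj k hQ v y, h, euler_inj k hQ]

/-- The dimension vector of the translate is given by the Coxeter transformation. -/
theorem euler_tau (hQ : IsAcyclic V) {X : QRep k V} (hX : X.IsFD)
    (h0 : ∀ v, hom X (proj k v) = 0) (z : V → ℤ) :
    euler z (tau X).dimZ = - euler X.dimZ z := by
  classical
  have hd : ∀ v, (tau X).dimZ v = - euler X.dimZ (proj k v).dimZ := fun v => by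
    rw [dimZ_tau, ← hom_sub_ext hX (isFD_proj hQ v), h0]
    simp
  -- Unit vectors are combinations of the dimension vectors of projectives, so the coordinates found
  -- in `hd` give the identity on a basis.
  have hs : ∀ v, euler (Pi.single v 1) (tau X).dimZ = - euler X.dimZ (Pi.single v 1) := by
    intro v
    have e : (Pi.single v 1 : V → ℤ) =
        (proj k v).dimZ + - ∑ u, (numArrows u v : ℤ) • (proj k u).dimZ :=
      eq_add_neg_of_add_eq (dimZ_proj_eq hQ v).symm
    have e2 : euler X.dimZ (Pi.single v 1) = euler X.dimZ (proj k v).dimZ -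
        ∑ u, (numArrows u v : ℤ) * euler X.dimZ (proj k u).dimZ := by
      rw [e, euler_add_right, euler_neg_right, sub_eq_add_neg]
      congr 2
      rw [← Finset.sum_congr rfl fun u _ => euler_smul_right (numArrows u v : ℤ) X.dimZ
        (proj k u).dimZ]
      exact map_sum (⟨⟨euler X.dimZ, euler_zero_right _⟩, euler_add_right _⟩ : (V → ℤ) →+ ℤ) _ _
    rw [euler_single_left, e2, hd, neg_sub, sub_eq_add_neg, add_comm, sub_eq_add_neg]
    congr 1
    rw [← Finset.sum_neg_distrib]
    refine Finset.sum_congr rfl fun u _ => ?_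
    rw [hd]
    ring
  rw [eq_sum_single z, euler_sum_left]
  have e3 : euler X.dimZ (∑ v, z v • Pi.single v 1) =
      ∑ v, euler X.dimZ (z v • (Pi.single v 1 : V → ℤ)) :=
    map_sum (⟨⟨euler X.dimZ, euler_zero_right _⟩, euler_add_right _⟩ : (V → ℤ) →+ ℤ) _ _
  rw [e3, ← Finset.sum_neg_distrib]
  refine Finset.sum_congr rfl fun v _ => ?_
  rw [euler_smul_left, euler_smul_right, hs]
  ring

/-- Since `euler Z (τ X) = - euler X Z`, the formula `hom Z (τ X) = ext X Z` forces its counterpart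
with `hom` and `ext` exchanged. -/
theorem ext_tau (hQ : IsAcyclic V) {X Z : QRep k V} (hX : X.IsFD) (hZ : Z.IsFD)
    (h0 : ∀ v, hom X (proj k v) = 0) : ext Z (tau X) = hom X Z := by
  have h1 := hom_sub_ext hZ (isFD_tau hQ hX)
  have h2 := hom_sub_ext hX hZ
  rw [euler_tau hQ hX h0, hom_tau' hQ hX hZ] at h1
  omega

theorem hom_tau_tau (hQ : IsAcyclic V) {X Z : QRep k V} (hX : X.IsFD) (hZ : Z.IsFD)
    (h0 : ∀ v, hom X (proj k v) = 0) : hom (tau X) (tau Z) = hom X Z := by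
  rw [hom_tau' hQ hZ (isFD_tau hQ hX), ext_tau hQ hX hZ h0]

theorem hom_inj_tau (hQ : IsAcyclic V) {X : QRep k V} (hX : X.IsFD) (v : V) :
    hom (inj k v) (tau X) = 0 := by
  rw [hom_tau' hQ hX (isFD_inj hQ v), ext_inj hQ hX]

end ProjInj

/-! ### Direct sums and indecomposability. -/

section Biprod

variable {k V : Type u} [Field k] [Quiver.{u} V]

/-- The direct sum of two modules. -/
def biprod (A B : QRep k V) : QRep k V := extn B A 0

theorem isFD_biprod {A B : QRep k V} (hA : A.IsFD) (hB : B.IsFD) : (biprod A B).IsFD :=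
  isFD_extn hB hA

theorem dimZ_biprod {A B : QRep k V} (hA : A.IsFD) (hB : B.IsFD) :
    (biprod A B).dimZ = A.dimZ + B.dimZ :=
  dimZ_extn hB hA

theorem biprod_map {A B : QRep k V} {i j : V} (a : i ⟶ j) (x : A.obj j) (y : B.obj j) :
    (biprod A B).map a (x, y) = (A.map a x, B.map a y) :=
  (extn_map a x y).trans (Prod.ext (add_zero _) rfl)

theorem IsSub.zero_iff_bot {X : QRep k V} {U : ∀ v, Submodule k (X.obj v)} (hU : X.IsSub U) :
    (X.restrict U hU).IsZero ↔ ∀ v, U v = ⊥ :=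
  forall_congr' fun _ => Submodule.subsingleton_iff_eq_bot

theorem isFD_restrict {X : QRep k V} (hX : X.IsFD) {U : ∀ v, Submodule k (X.obj v)}
    (hU : X.IsSub U) : (X.restrict U hU).IsFD := fun v => by
  have := hX v
  exact inferInstanceAs (FiniteDimensional k (U v))

theorem isFD_quot {X : QRep k V} (hX : X.IsFD) {U : ∀ v, Submodule k (X.obj v)}
    (hU : X.IsSub U) : (X.quot U hU).IsFD := fun v => by
  have := hX v
  exact inferInstanceAs (FiniteDimensional k (X.obj v ⧸ U v))

theorem isHom_subtype {X : QRep k V} {U : ∀ v, Submodule k (X.obj v)} (hU : X.IsSub U) :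
    IsHom (X.restrict U hU) X fun v => (U v).subtype := fun _ _ _ _ => rfl

theorem isHom_mkQ {X : QRep k V} {U : ∀ v, Submodule k (X.obj v)} (hU : X.IsSub U) :
    IsHom X (X.quot U hU) fun v => (U v).mkQ := fun _ _ _ _ => rfl

theorem IsHom.isSub_ker {X Y : QRep k V} {f : ∀ v, X.obj v →ₗ[k] Y.obj v} (hf : IsHom X Y f) :
    X.IsSub fun v => LinearMap.ker (f v) := fun i j a x hx => by
  rw [LinearMap.mem_ker] at hx
  rw [Submodule.mem_comap, LinearMap.mem_ker, hf, hx, map_zero]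

theorem IsHom.isSub_range {X Y : QRep k V} {f : ∀ v, X.obj v →ₗ[k] Y.obj v} (hf : IsHom X Y f) :
    Y.IsSub fun v => LinearMap.range (f v) := by
  rintro i j a _ ⟨x, rfl⟩
  exact ⟨X.map a x, hf i j a x⟩

theorem iso_biprod_of_isCompl {X : QRep k V} {U W : ∀ v, Submodule k (X.obj v)} (hU : X.IsSub U)
    (hW : X.IsSub W) (h : ∀ v, IsCompl (U v) (W v)) :
    Iso X (biprod (X.restrict U hU) (X.restrict W hW)) := by
  refine Iso.symm ⟨fun v => Submodule.prodEquivOfIsCompl (U v) (W v) (h v), ?_⟩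
  rintro i j a ⟨x, y⟩
  rw [biprod_map]
  exact (map_add (X.map a) x.1 y.1).symm

theorem Iso.exists_isCompl {X A B : QRep k V} (h : Iso X (biprod A B)) :
    ∃ (U W : ∀ v, Submodule k (X.obj v)) (hU : X.IsSub U) (hW : X.IsSub W),
      (∀ v, IsCompl (U v) (W v)) ∧ Iso A (X.restrict U hU) ∧ Iso B (X.restrict W hW) := by
  obtain ⟨f, hf⟩ := h.symm
  have hA : IsHom A X fun v => (f v).toLinearMap ∘ₗ LinearMap.inl k (A.obj v) (B.obj v) := by
    intro i j a x
    have := hf i j a (x, 0)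
    rw [biprod_map, map_zero] at this
    exact this
  have hB : IsHom B X fun v => (f v).toLinearMap ∘ₗ LinearMap.inr k (A.obj v) (B.obj v) := by
    intro i j a x
    have := hf i j a (0, x)
    rw [biprod_map, map_zero] at this
    exact this
  refine ⟨_, _, hA.isSub_range, hB.isSub_range, fun v => ?_, ?_, ?_⟩
  · let g : (A.obj v × B.obj v) ≃ₗ[k] X.obj v := f v
    change IsCompl (LinearMap.range (g.toLinearMap ∘ₗ LinearMap.inl k (A.obj v) (B.obj v)))
      (LinearMap.range (g.toLinearMap ∘ₗ LinearMap.inr k (A.obj v) (B.obj v)))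
    rw [LinearMap.range_comp, LinearMap.range_comp]
    exact (Submodule.orderIsoMapComap g).isCompl_iff.1
      (LinearMap.isCompl_range_inl_inr (R := k) (M := A.obj v) (M₂ := B.obj v))
  · exact ⟨fun v => LinearEquiv.ofInjective _
      ((f v).injective.comp LinearMap.inl_injective), fun i j a x => Subtype.ext (hA i j a x)⟩
  · exact ⟨fun v => LinearEquiv.ofInjective _
      ((f v).injective.comp LinearMap.inr_injective), fun i j a x => Subtype.ext (hB i j a x)⟩

theorem Indec.isZero_or_isZero {X A B : QRep k V} (hX : X.Indec) (h : Iso X (biprod A B)) :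
    A.IsZero ∨ B.IsZero := by
  obtain ⟨U, W, hU, hW, hc, hA, hB⟩ := h.exists_isCompl
  rcases hX.2 U W hU hW hc with h | h
  · exact Or.inl (hA.symm.isZero (hU.zero_iff_bot.2 h))
  · exact Or.inr (hB.symm.isZero (hW.zero_iff_bot.2 h))

theorem indec_of_forall {X : QRep k V} (h0 : ¬ X.IsZero)
    (h : ∀ A B, Iso X (biprod A B) → A.IsZero ∨ B.IsZero) : X.Indec :=
  ⟨h0, fun _ _ hU hW hc => (h _ _ (iso_biprod_of_isCompl hU hW hc)).imp
    hU.zero_iff_bot.1 hW.zero_iff_bot.1⟩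

theorem Iso.indec {X Y : QRep k V} (h : Iso X Y) (hX : X.Indec) : Y.Indec :=
  indec_of_forall (fun h0 => hX.1 (h.symm.isZero h0)) fun _ _ h' =>
    hX.isZero_or_isZero (h.trans h')

theorem exists_iso_biprod_of_section {X P : QRep k V} (hX : X.IsFD)
    {f : ∀ v, X.obj v →ₗ[k] P.obj v}
    (hf : IsHom X P f) {s : ∀ v, P.obj v →ₗ[k] X.obj v} (hs : IsHom P X s)
    (h : ∀ v y, f v (s v y) = y) : ∃ X' : QRep k V, X'.IsFD ∧ Iso X (biprod X' P) := by
  refine ⟨X.restrict _ hf.isSub_ker, isFD_restrict hX _, Iso.symm ?_⟩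
  refine IsHom.iso_of_bijective (f := fun v => LinearMap.coprod
    (LinearMap.ker (f v)).subtype (s v)) ?_ fun v => ⟨?_, ?_⟩
  · rintro i j a ⟨x, y⟩
    rw [biprod_map]
    change X.map a x.1 + s i (P.map a y) = X.map a (x.1 + s j y)
    rw [hs, map_add]
  · refine (injective_iff_map_eq_zero (LinearMap.coprod (LinearMap.ker (f v)).subtype (s v))).2 ?_
    rintro ⟨x, y⟩ h0
    change (x : X.obj v) + s v y = 0 at h0
    have hy : y = 0 := by
      have := congrArg (f v) h0
      rwa [map_add, map_zero, h, LinearMap.mem_ker.1 x.2, zero_add] at this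
    rw [hy, map_zero, add_zero] at h0
    exact Prod.ext (Subtype.ext h0) hy
  · intro x
    refine ⟨(⟨x - s v (f v x), ?_⟩, f v x), ?_⟩
    · rw [LinearMap.mem_ker, map_sub, h, sub_self]
    · exact sub_add_cancel x _

section

variable [Finite V]

theorem isZero_of_hom_self {X : QRep k V} (hX : X.IsFD) (h : hom X X = 0) : X.IsZero := by
  intro v
  have h1 := (hom_eq_zero_iff hX hX).1 h _ (IsHom.id X)
  exact ⟨fun x y => by
    have hx := LinearMap.congr_fun (congr_fun h1 v) x
    have hy := LinearMap.congr_fun (congr_fun h1 v) y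
    exact hx.trans hy.symm⟩

theorem hom_eq_zero_of_isZero_left {X Y : QRep k V} (hX : X.IsZero) (hY : Y.IsFD) :
    hom X Y = 0 :=
  (hom_eq_zero_iff hX.isFD hY).2 fun _ _ => funext fun v => LinearMap.ext fun x => by
    have := hX v
    rw [Subsingleton.elim x 0, map_zero, map_zero]

theorem hom_eq_zero_of_isZero_right {X Y : QRep k V} (hX : X.IsFD) (hY : Y.IsZero) :
    hom X Y = 0 :=
  (hom_eq_zero_iff hX hY.isFD).2 fun _ _ => funext fun v => LinearMap.ext fun x => by
    have := hY v
    exact Subsingleton.elim _ _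

theorem hom_biprod_right {Z A B : QRep k V} (hZ : Z.IsFD) (hA : A.IsFD) (hB : B.IsFD) :
    hom Z (biprod A B) = hom Z A + hom Z B := by
  refine le_antisymm (hom_extn_right_le hZ hB hA) ?_
  have := hZ.finite_hom hA
  have := hZ.finite_hom hB
  have := hZ.finite_hom (isFD_biprod hA hB)
  let φ : (LinearMap.ker (extDiff Z A) × LinearMap.ker (extDiff Z B)) →ₗ[k]
      LinearMap.ker (extDiff Z (biprod A B)) :=
    { toFun := fun f => ⟨fun v => LinearMap.prod (f.1.1 v) (f.2.1 v),
        mem_ker_extDiff.2 fun i j a x => by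
          refine Eq.trans ?_ (biprod_map a _ _).symm
          exact Prod.ext (mem_ker_extDiff.1 f.1.2 i j a x) (mem_ker_extDiff.1 f.2.2 i j a x)⟩
      map_add' := fun f g => rfl
      map_smul' := fun c f => rfl }
  have h := LinearMap.finrank_le_finrank_of_injective (f := φ) ?_
  · rwa [Module.finrank_prod] at h
  rw [injective_iff_map_eq_zero]
  rintro ⟨f, g⟩ h0
  have h1 : ∀ v x, (f.1 v x, g.1 v x) = (0 : A.obj v × B.obj v) := fun v x =>
    LinearMap.congr_fun (congr_fun (congrArg Subtype.val h0) v) x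
  exact Prod.ext (Subtype.ext (funext fun v => LinearMap.ext fun x => congrArg Prod.fst (h1 v x)))
    (Subtype.ext (funext fun v => LinearMap.ext fun x => congrArg Prod.snd (h1 v x)))

theorem hom_biprod_left {Z A B : QRep k V} (hZ : Z.IsFD) (hA : A.IsFD) (hB : B.IsFD) :
    hom (biprod A B) Z = hom A Z + hom B Z := by
  refine le_antisymm (hom_extn_left_le hZ hB hA) ?_
  have := hA.finite_hom hZ
  have := hB.finite_hom hZ
  have := (isFD_biprod hA hB).finite_hom hZ
  let φ : (LinearMap.ker (extDiff A Z) × LinearMap.ker (extDiff B Z)) →ₗ[k]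
      LinearMap.ker (extDiff (biprod A B) Z) :=
    { toFun := fun f => ⟨fun v => LinearMap.coprod (f.1.1 v) (f.2.1 v),
        mem_ker_extDiff.2 fun i j a x => by
          obtain ⟨x, y⟩ := x
          rw [biprod_map]
          change f.1.1 i (A.map a x) + f.2.1 i (B.map a y) =
            Z.map a (f.1.1 j x + f.2.1 j y)
          rw [mem_ker_extDiff.1 f.1.2, mem_ker_extDiff.1 f.2.2, map_add]⟩
      map_add' := fun f g => by
        refine Subtype.ext (funext fun v => ?_)
        exact LinearMap.ext fun x => add_add_add_comm _ _ _ _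
      map_smul' := fun c f => by
        refine Subtype.ext (funext fun v => ?_)
        exact LinearMap.ext fun x => (smul_add c _ _).symm }
  have h := LinearMap.finrank_le_finrank_of_injective (f := φ) ?_
  · rwa [Module.finrank_prod] at h
  rw [injective_iff_map_eq_zero]
  rintro ⟨f, g⟩ h0
  have h1 : ∀ v x y, f.1 v x + g.1 v y = 0 := fun v x y =>
    LinearMap.congr_fun (congr_fun (congrArg Subtype.val h0) v) ((x, y) : A.obj v × B.obj v)
  refine Prod.ext (Subtype.ext (funext fun v => LinearMap.ext fun x => ?_))
    (Subtype.ext (funext fun v => LinearMap.ext fun x => ?_))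
  · have := h1 v x 0
    rwa [map_zero, add_zero] at this
  · have := h1 v 0 x
    rwa [map_zero, zero_add] at this

/-- Two nonzero summands would contribute two independent identities. -/
theorem indec_of_hom_self {X : QRep k V} (hX : X.IsFD) (h : hom X X = 1) : X.Indec := by
  refine indec_of_forall (fun h0 => ?_) fun A B hAB => ?_
  · rw [hom_eq_zero_of_isZero_left h0 hX] at h
    omega
  · by_contra hne
    push Not at hne
    obtain ⟨U, W, hU, hW, -, hA, hB⟩ := hAB.exists_isCompl
    have hA := hA.symm.isFD (isFD_restrict hX _)
    have hB := hB.symm.isFD (isFD_restrict hX _)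
    have h1 : hom A A ≠ 0 := fun h => hne.1 (isZero_of_hom_self hA h)
    have h2 : hom B B ≠ 0 := fun h => hne.2 (isZero_of_hom_self hB h)
    rw [hAB.hom_left hX hX, hAB.hom_right (isFD_biprod hA hB) hX,
      hom_biprod_left (isFD_biprod hA hB) hA hB, hom_biprod_right hA hA hB,
      hom_biprod_right hB hA hB] at h
    omega

end

section

variable [Fintype V] [∀ i j : V, Finite (i ⟶ j)]

theorem ext_biprod_left {Z A B : QRep k V} (hZ : Z.IsFD) (hA : A.IsFD) (hB : B.IsFD) :
    ext (biprod A B) Z = ext A Z + ext B Z := by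
  have h1 := hom_sub_ext (isFD_biprod hA hB) hZ
  have h2 := hom_sub_ext hA hZ
  have h3 := hom_sub_ext hB hZ
  rw [dimZ_biprod hA hB, euler_add_left, hom_biprod_left hZ hA hB] at h1
  omega

/-- Additivity of the Euler form carries the bound for `hom` over to `ext`. -/
theorem ext_extn_right_le {Z N L : QRep k V} (hZ : Z.IsFD) (hN : N.IsFD) (hL : L.IsFD)
    (z : ∀ i j : V, (i ⟶ j) → (N.obj j →ₗ[k] L.obj i)) :
    ext Z (extn N L z) ≤ ext Z L + ext Z N := by
  have h1 := hom_sub_ext hZ (isFD_extn (z := z) hN hL)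
  have h2 := hom_sub_ext hZ hL
  have h3 := hom_sub_ext hZ hN
  rw [dimZ_extn hN hL, euler_add_right] at h1
  have := hom_extn_right_le (z := z) hZ hN hL
  omega

end

end Biprod

/-! ### Modules over a finite field are determined by counting morphisms. -/

section Lovasz

variable {k V : Type u} [Field k] [Finite k] [Quiver.{u} V] [Finite V]

theorem IsFD.finite_obj {X : QRep k V} (hX : X.IsFD) (v : V) : Finite (X.obj v) := by
  have := hX v
  exact Module.finite_of_finite k

/-- The number of morphisms with a prescribed kernel. -/
def kerCard (Z X : QRep k V) (K : ∀ v, Submodule k (Z.obj v)) : ℕ :=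
  Nat.card {f : {f : ∀ v, Z.obj v →ₗ[k] X.obj v // IsHom Z X f} //
    (fun v => LinearMap.ker (f.1 v)) = K}

theorem IsFD.finite_linearMaps {X Y : QRep k V} (hX : X.IsFD) (hY : Y.IsFD) :
    Finite (∀ v, X.obj v →ₗ[k] Y.obj v) := by
  have := hX.finite_hom hY
  exact Module.finite_of_finite k

theorem IsFD.finite_submodules {X : QRep k V} (hX : X.IsFD) :
    Finite (∀ v, Submodule k (X.obj v)) := by
  have := hX.finite_obj
  infer_instance

theorem sum_kerCard {Z X : QRep k V} (hZ : Z.IsFD) (hX : X.IsFD)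
    [Fintype (∀ v, Submodule k (Z.obj v))] :
    ∑ K, kerCard Z X K = Nat.card k ^ hom Z X := by
  have := hZ.finite_linearMaps hX
  have := hZ.finite_hom hX
  rw [hom, ← Module.natCard_eq_pow_finrank,
    Nat.card_congr (Equiv.subtypeEquivRight fun f => mem_ker_extDiff (f := f)),
    ← Nat.card_congr (Equiv.sigmaFiberEquiv
      (fun f : {f : ∀ v, Z.obj v →ₗ[k] X.obj v // IsHom Z X f} => fun v => LinearMap.ker (f.1 v))),
    Nat.card_sigma]
  rfl

omit [Finite k] [Finite V] in
theorem kerCard_eq_quot (Z X : QRep k V) {K : ∀ v, Submodule k (Z.obj v)} (hK : Z.IsSub K) :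
    kerCard Z X K = kerCard (Z.quot K hK) X fun _ => ⊥ := by
  refine Nat.card_congr
    { toFun := fun f => ⟨⟨fun v => (K v).liftQ (f.1.1 v) (congr_fun f.2 v).ge, ?_⟩, ?_⟩
      invFun := fun g => ⟨⟨fun v => g.1.1 v ∘ₗ (K v).mkQ, g.1.2.comp (isHom_mkQ hK)⟩, ?_⟩
      left_inv := fun f => rfl
      right_inv := fun g => ?_ }
  · intro i j a x
    obtain ⟨x, rfl⟩ := Submodule.mkQ_surjective _ x
    exact f.1.2 i j a x
  · funext v
    have := congr_fun f.2 v
    refine Submodule.ker_liftQ_eq_bot _ _ _ this.le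
  · funext v
    have : LinearMap.ker (g.1.1 v) = ⊥ := congr_fun g.2 v
    let γ : (Z.obj v ⧸ K v) →ₗ[k] X.obj v := g.1.1 v
    change LinearMap.ker (γ ∘ₗ (K v).mkQ) = K v
    rw [LinearMap.ker_comp, show LinearMap.ker γ = ⊥ from this]
    exact (K v).ker_mkQ
  · refine Subtype.ext (Subtype.ext (funext fun v => LinearMap.ext fun x => ?_))
    obtain ⟨x, rfl⟩ := Submodule.mkQ_surjective _ x
    rfl

omit [Finite k] [Finite V] in
theorem kerCard_eq_zero (Z X : QRep k V) {K : ∀ v, Submodule k (Z.obj v)} (hK : ¬ Z.IsSub K) :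
    kerCard Z X K = 0 := by
  refine Nat.card_eq_zero.2 (Or.inl ⟨fun f => hK ?_⟩)
  rw [← f.2]
  exact f.1.2.isSub_ker

/-- The total dimension. -/
def totalDim [Fintype V] (X : QRep k V) : ℕ := ∑ v, X.dimVec v

theorem totalDim_quot_lt [Fintype V] {Z : QRep k V} (hZ : Z.IsFD)
    {K : ∀ v, Submodule k (Z.obj v)} (hK : Z.IsSub K)
    (h : K ≠ fun _ => ⊥) : (Z.quot K hK).totalDim < Z.totalDim := by
  have := fun v => hZ v
  have hv : ∀ v, (Z.quot K hK).dimVec v + Module.finrank k (K v) = Z.dimVec v := fun v =>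
    Submodule.finrank_quotient_add_finrank (K v)
  obtain ⟨v, hv0⟩ := Function.ne_iff.1 h
  refine Finset.sum_lt_sum (fun w _ => by have := hv w; omega) ⟨v, Finset.mem_univ v, ?_⟩
  have h1 := Nat.pos_of_ne_zero (mt Submodule.finrank_eq_zero.1 hv0)
  have := hv v
  omega

/-- Lovász's cancellation argument: morphisms are sorted by their kernels, and those with kernel `K
≠ 0` are the injective morphisms from the smaller module `Z / K`, equally many by induction. Hence
so are the injective ones from `Z`. -/
theorem kerCard_bot_eq {X Y : QRep k V} (hX : X.IsFD) (hY : Y.IsFD)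
    (h : ∀ Z : QRep k V, Z.IsFD → hom Z X = hom Z Y) (Z : QRep k V) (hZ : Z.IsFD) :
    kerCard Z X (fun _ => ⊥) = kerCard Z Y fun _ => ⊥ := by
  classical
  have := Fintype.ofFinite V
  induction hn : Z.totalDim using Nat.strong_induction_on generalizing Z with
  | _ n ih =>
    have := hZ.finite_submodules
    have := Fintype.ofFinite (∀ v, Submodule k (Z.obj v))
    have h1 := sum_kerCard hZ hX
    rw [h Z hZ, ← sum_kerCard hZ hY, ← Finset.add_sum_erase _ _ (Finset.mem_univ fun _ => ⊥),
      ← Finset.add_sum_erase (f := kerCard Z Y) _ (Finset.mem_univ fun _ => ⊥)] at h1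
    refine Nat.add_right_cancel (h1.trans (congrArg _ (Finset.sum_congr rfl fun K hK => ?_)))
    by_cases hs : Z.IsSub K
    · rw [kerCard_eq_quot Z X hs, kerCard_eq_quot Z Y hs]
      exact (ih _ (hn ▸ totalDim_quot_lt hZ hs (Finset.ne_of_mem_erase hK)) _
        (isFD_quot hZ hs) rfl).symm
    · rw [kerCard_eq_zero Z X hs, kerCard_eq_zero Z Y hs]

/-- A finite-dimensional module over a finite field is determined by the numbers of morphisms
into it. -/
theorem iso_of_hom_eq {X Y : QRep k V} (hX : X.IsFD) (hY : Y.IsFD)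
    (h : ∀ Z : QRep k V, Z.IsFD → hom Z X = hom Z Y) : Iso X Y := by
  have key : ∀ {X Y : QRep k V}, X.IsFD → Y.IsFD →
      (∀ Z : QRep k V, Z.IsFD → hom Z X = hom Z Y) →
      ∃ f, IsHom X Y f ∧ ∀ v, Function.Injective (f v) := by
    intro X Y hX hY h
    have := hX.finite_linearMaps hX
    have h1 := kerCard_bot_eq hX hY h X hX
    -- The identity is an injective endomorphism, so some injective morphism `X → Y` exists as well.
    have h2 : kerCard X X (fun _ => ⊥) ≠ 0 := by
      refine Nat.card_ne_zero.2 ⟨⟨⟨⟨fun _ => LinearMap.id, IsHom.id X⟩, ?_⟩⟩, inferInstance⟩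
      exact funext fun _ => LinearMap.ker_id
    rw [h1] at h2
    obtain ⟨⟨f, hf⟩⟩ := (Nat.card_ne_zero.1 h2).1
    exact ⟨f.1, f.2, fun v => LinearMap.ker_eq_bot.1 (congr_fun hf v)⟩
  obtain ⟨f, hf, hi⟩ := key hX hY h
  obtain ⟨g, -, hi'⟩ := key hY hX fun Z hZ => (h Z hZ).symm
  refine hf.iso_of_bijective fun v => ⟨hi v, ?_⟩
  have := hX v
  have := hY v
  have e := le_antisymm (LinearMap.finrank_le_finrank_of_injective (hi v))
    (LinearMap.finrank_le_finrank_of_injective (hi' v))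
  exact (LinearMap.injective_iff_surjective_of_finrank_eq_finrank e).1 (hi v)

end Lovasz

/-! ### Splitting off projective summands. -/

section Summand

variable {k V : Type u} [Field k] [Quiver.{u} V]

open Classical in
/-- The coefficients of an element of a projective module at the paths that end with an arrow. -/
def pathCoeff (k : Type u) {V : Type u} [Field k] [Quiver.{u} V] {u w : V} (a : u ⟶ w) (x : V) :
    (proj k w).obj x →ₗ[k] (proj k u).obj x :=
  Finsupp.lcomapDomain (fun p : Quiver.Path x u => p.cons a) fun p q h => by
    simpa using h

theorem pathCoeff_apply {u w x : V} (a : u ⟶ w) (y : (proj k w).obj x) (p : Quiver.Path x u) :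
    (show Quiver.Path x u →₀ k from pathCoeff k a x y) p =
      (show Quiver.Path x w →₀ k from y) (p.cons a) := rfl

theorem pathCoeff_pathVec_cons {u w x : V} (a : u ⟶ w) (p : Quiver.Path x u) :
    pathCoeff k a x (pathVec k (p.cons a)) = pathVec k p := by
  classical
  refine Finsupp.ext fun q => ?_
  refine (pathCoeff_apply a _ q).trans ?_
  refine (Finsupp.single_apply).trans (Eq.trans ?_ Finsupp.single_apply.symm)
  simp

theorem pathCoeff_pathVec_cons_of_ne {u u' w x : V} (a : u ⟶ w) (b : u' ⟶ w)
    (p : Quiver.Path x u') (h : (⟨u, a⟩ : Σ u, u ⟶ w) ≠ ⟨u', b⟩) :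
    pathCoeff k a x (pathVec k (p.cons b)) = 0 := by
  classical
  refine Finsupp.ext fun q => ?_
  refine (pathCoeff_apply a _ q).trans ?_
  refine (Finsupp.single_apply).trans ?_
  rw [if_neg]
  · rfl
  · intro e
    obtain ⟨rfl, -, hb⟩ := Quiver.Path.cons.inj e
    exact h (by rw [eq_of_heq hb])

/-- Prolonging a path at its start keeps its last arrow unless the path is trivial; `hj` excludes
that case. -/
theorem pathCoeff_proj_map {u w : V} (a : u ⟶ w) {i j : V} (b : i ⟶ j) (hj : j ≠ w)
    (y : (proj k w).obj j) :
    pathCoeff k a i ((proj k w).map b y) = (proj k u).map b (pathCoeff k a j y) := by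
  refine LinearMap.congr_fun (f := pathCoeff k a i ∘ₗ (proj k w).map b)
    (g := (proj k u).map b ∘ₗ pathCoeff k a j) (proj_hom_ext fun p => ?_) y
  rw [LinearMap.comp_apply, LinearMap.comp_apply, proj_map_pathVec]
  cases p with
  | nil => exact absurd rfl hj
  | @cons u' _ p c =>
    rw [Quiver.Path.comp_cons]
    by_cases h : (⟨u, a⟩ : Σ u, u ⟶ w) = ⟨u', c⟩
    · obtain ⟨rfl, h⟩ := Sigma.mk.inj h
      obtain rfl := eq_of_heq h
      rw [pathCoeff_pathVec_cons, pathCoeff_pathVec_cons, proj_map_pathVec]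
    · rw [pathCoeff_pathVec_cons_of_ne a c _ h, pathCoeff_pathVec_cons_of_ne a c _ h, map_zero]

variable [∀ i j : V, Finite (i ⟶ j)]

/-- A module with a nonzero morphism to an indecomposable projective module has an indecomposable
projective direct summand. -/
theorem exists_iso_biprod_proj [Finite V] (hQ : IsAcyclic V) {X : QRep k V} (hX : X.IsFD) {v : V}
    (h : hom X (proj k v) ≠ 0) :
    ∃ (w : V) (X' : QRep k V), X'.IsFD ∧ Iso X (biprod X' (proj k w)) := by
  -- At a minimal such vertex the component `f w` is nonzero: otherwise the coefficients of `f` at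
  -- paths ending with a given arrow `u ⟶ w` would form a morphism to `P_u`, which vanishes by
  -- minimality.
  obtain ⟨w, hw, hmin⟩ := (wellFounded_arrow hQ).has_min {v | hom X (proj k v) ≠ 0} ⟨v, h⟩
  obtain ⟨f, hf, hf0⟩ := (hom_ne_zero_iff hX (isFD_proj hQ w)).1 hw
  have hfw : f w ≠ 0 := by
    intro h0
    refine hf0 (funext fun x => LinearMap.ext fun y => Finsupp.ext fun p => ?_)
    cases p with
    | nil => exact DFunLike.congr_fun (F := Quiver.Path w w →₀ k) (LinearMap.congr_fun h0 y) _
    | @cons u _ p a =>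
      have hu : hom X (proj k u) = 0 := by
        by_contra hu
        exact hmin u hu ⟨a⟩
      have hg : IsHom X (proj k u) fun x => pathCoeff k a x ∘ₗ f x := by
        intro i j b y
        rw [LinearMap.comp_apply, LinearMap.comp_apply, hf]
        by_cases hj : j = w
        · subst hj
          rw [h0, LinearMap.zero_apply, map_zero, map_zero, map_zero, map_zero]
        · exact pathCoeff_proj_map a b hj _
      have h1 := (hom_eq_zero_iff hX (isFD_proj hQ u)).1 hu _ hg
      exact DFunLike.congr_fun (F := Quiver.Path x u →₀ k)
        (LinearMap.congr_fun (congr_fun h1 x) y) p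
  obtain ⟨y, hy⟩ : ∃ y, f w y ≠ 0 := by
    by_contra hy
    push Not at hy
    exact hfw (LinearMap.ext hy)
  have hnil : ∀ p : Quiver.Path w w, p = .nil := fun p =>
    Quiver.Path.eq_nil_of_length_zero p (hQ w p)
  obtain ⟨c, hc⟩ : ∃ c : k, f w y = c • nilVec k w := by
    refine ⟨(show Quiver.Path w w →₀ k from f w y) .nil, Finsupp.ext fun p => ?_⟩
    rw [hnil p]
    refine Eq.trans (mul_one _).symm ?_
    exact congrArg _ (Finsupp.single_eq_same (M := k)).symm
  have hc0 : c ≠ 0 := by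
    rintro rfl
    rw [zero_smul] at hc
    exact hy hc
  -- By acyclicity `f w y` is `c` times the trivial path, so `c⁻¹ • y` defines a section of `f`.
  have hs := isHom_yoneda (c⁻¹ • y)
  have hfs := eq_zero_of_nilVec ((hf.comp hs).sub (IsHom.id _)) (by
    refine sub_eq_zero.2 ?_
    refine (congrArg (f w) (yoneda_pathVec (c⁻¹ • y) _)).trans ?_
    change f w (c⁻¹ • y) = nilVec k w
    rw [map_smul, hc, inv_smul_smul₀ hc0])
  obtain ⟨X', hX', e⟩ := exists_iso_biprod_of_section hX hf hs fun v y =>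
    sub_eq_zero.1 (LinearMap.congr_fun (congr_fun hfs v) y)
  exact ⟨w, X', hX', e⟩

end Summand

/-! ### The translate up to isomorphism. -/

section TauIso

variable {k V : Type u} [Field k] [Finite k] [Quiver.{u} V] [Fintype V]
  [∀ i j : V, Finite (i ⟶ j)]

/-- Both translates receive equally many morphisms from every module, by the Auslander-Reiten
formula; functoriality of `τ` is bypassed. -/
theorem Iso.tau (hQ : IsAcyclic V) {X Y : QRep k V} (h : Iso X Y) (hX : X.IsFD) :
    Iso (tau X) (tau Y) :=
  iso_of_hom_eq (isFD_tau hQ hX) (isFD_tau hQ (h.isFD hX)) fun Z hZ => by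
    rw [hom_tau' hQ hX hZ, hom_tau' hQ (h.isFD hX) hZ, h.ext_left hX hZ]

theorem tau_biprod (hQ : IsAcyclic V) {A B : QRep k V} (hA : A.IsFD) (hB : B.IsFD) :
    Iso (tau (biprod A B)) (biprod (tau A) (tau B)) :=
  iso_of_hom_eq (isFD_tau hQ (isFD_biprod hA hB)) (isFD_biprod (isFD_tau hQ hA) (isFD_tau hQ hB))
    fun Z hZ => by
      rw [hom_tau' hQ (isFD_biprod hA hB) hZ, hom_biprod_right hZ (isFD_tau hQ hA)
        (isFD_tau hQ hB), hom_tau' hQ hA hZ, hom_tau' hQ hB hZ, ext_biprod_left hZ hA hB]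

/-- Splitting off all projective direct summands. -/
theorem exists_projective_free (hQ : IsAcyclic V) {X : QRep k V} (hX : X.IsFD) :
    ∃ X' : QRep k V, X'.IsFD ∧ (∀ v, hom X' (proj k v) = 0) ∧
      (∀ Z : QRep k V, Z.IsFD → hom X' Z ≤ hom X Z) ∧ Iso (tau X) (tau X') := by
  induction hn : X.totalDim using Nat.strong_induction_on generalizing X with
  | _ n ih =>
    by_cases h : ∀ v, hom X (proj k v) = 0
    · exact ⟨X, hX, h, fun _ _ => le_rfl, Iso.refl _⟩
    · push Not at h
      obtain ⟨v, hv⟩ := h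
      obtain ⟨w, X', hX', e⟩ := exists_iso_biprod_proj hQ hX hv
      have hP := isFD_proj (k := k) hQ w
      have hdim : X'.totalDim < X.totalDim := by
        have hd : ∀ u, X.dimVec u = X'.dimVec u + (proj k w).dimVec u := fun u => by
          rw [e.dimVec_eq]
          exact dimVec_extn hP hX' u
        have h1 : (proj k w).dimVec w = 1 := by
          rw [← hom_proj hQ hP, hom_proj_self hQ]
        exact Finset.sum_lt_sum (fun u _ => by have := hd u; omega)
          ⟨w, Finset.mem_univ w, by have := hd w; omega⟩
      obtain ⟨Y, hY, hY0, hle, hiso⟩ := ih _ (hn ▸ hdim) hX' rfl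
      refine ⟨Y, hY, hY0, fun Z hZ => (hle Z hZ).trans ?_, Iso.trans ?_ hiso⟩
      · rw [e.hom_left hX hZ, hom_biprod_left hZ hX' hP]
        omega
      · refine iso_of_hom_eq (isFD_tau hQ hX) (isFD_tau hQ hX') fun Z hZ => ?_
        rw [hom_tau' hQ hX hZ, hom_tau' hQ hX' hZ, e.ext_left hX hZ, ext_biprod_left hZ hX' hP,
          ext_proj hQ hZ, add_zero]

/-- Splitting off the projective summands of `X`, which `τ` kills, reduces to `hom_tau_tau`; what
they contribute to `hom X Z` makes this an inequality. -/
theorem hom_tau_tau_le (hQ : IsAcyclic V) {X Z : QRep k V} (hX : X.IsFD) (hZ : Z.IsFD) :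
    hom (tau X) (tau Z) ≤ hom X Z := by
  obtain ⟨X', hX', h0, hle, e⟩ := exists_projective_free hQ hX
  rw [e.hom_left (isFD_tau hQ hX) (isFD_tau hQ hZ), hom_tau_tau hQ hX' hZ h0]
  exact hle Z hZ

end TauIso

end QRep

/-! ### The opposite quiver -/

/-- The opposite quiver has the same vertices and the reversed arrows. -/
structure Op (V : Type u) : Type u where
  unop : V

instance (V : Type u) [Quiver.{u} V] : Quiver.{u} (Op V) := ⟨fun a b => b.unop ⟶ a.unop⟩

/-- The vertices of the opposite quiver. -/
def opEquiv (V : Type u) : V ≃ Op V := ⟨Op.mk, Op.unop, fun _ => rfl, fun _ => rfl⟩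

instance (V : Type u) [Fintype V] : Fintype (Op V) := Fintype.ofEquiv V (opEquiv V)

instance (V : Type u) [Finite V] : Finite (Op V) := Finite.of_equiv V (opEquiv V)

theorem isAcyclic_op {V : Type u} [Quiver.{u} V] (hQ : IsAcyclic V) :
    IsAcyclic (Op V) := by
  have key : ∀ {v w : Op V} (p : Quiver.Path v w), ∃ q : Quiver.Path w.unop v.unop,
      q.length = p.length := by
    intro v w p
    induction p with
    | nil => exact ⟨.nil, rfl⟩
    | @cons b c p a ih =>
      obtain ⟨q, hq⟩ := ih
      let a' : c.unop ⟶ b.unop := a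
      refine ⟨a'.toPath.comp q, ?_⟩
      rw [Quiver.Path.length_comp, hq, Quiver.Path.length_cons, Quiver.Path.length_toPath, add_comm]
  intro v p
  obtain ⟨q, hq⟩ := key p
  rw [← hq]
  exact hQ _ q

namespace QRep

/-! ### Duality and the inverse translate. -/

section Duality

variable {k V : Type u} [Field k] [Quiver.{u} V]

/-- The dual of a module, as a module over the opposite quiver. -/
def dual (X : QRep k V) : QRep k (Op V) where
  obj v := Module.Dual k (X.obj v.unop)
  map {i j} a := (X.map (i := j.unop) (j := i.unop) a).dualMap

/-- The dual of a module over the opposite quiver. -/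
def dualOp (X : QRep k (Op V)) : QRep k V where
  obj v := Module.Dual k (X.obj ⟨v⟩)
  map {i j} a := (X.map (i := ⟨j⟩) (j := ⟨i⟩) a).dualMap

theorem isFD_dual {X : QRep k V} (hX : X.IsFD) : X.dual.IsFD := fun v => by
  have := hX v.unop
  exact inferInstanceAs (FiniteDimensional k (Module.Dual k (X.obj v.unop)))

theorem isFD_dualOp {X : QRep k (Op V)} (hX : X.IsFD) : X.dualOp.IsFD := fun v => by
  have := hX ⟨v⟩
  exact inferInstanceAs (FiniteDimensional k (Module.Dual k (X.obj ⟨v⟩)))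

theorem dimZ_dual (X : QRep k V) : X.dual.dimZ = fun v => X.dimZ v.unop :=
  funext fun _ => congrArg Nat.cast Subspace.dual_finrank_eq

theorem dimZ_dualOp (X : QRep k (Op V)) : X.dualOp.dimZ = fun v => X.dimZ ⟨v⟩ :=
  funext fun _ => congrArg Nat.cast Subspace.dual_finrank_eq

theorem iso_dualOp_dual {X : QRep k V} (hX : X.IsFD) : Iso X X.dual.dualOp := by
  have := fun v => hX v
  exact ⟨fun v => Module.evalEquiv k (X.obj v), fun i j a x => rfl⟩

theorem iso_dual_dualOp {X : QRep k (Op V)} (hX : X.IsFD) : Iso X X.dualOp.dual := by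
  have := fun v => hX v
  exact ⟨fun v => Module.evalEquiv k (X.obj v), fun i j a x => rfl⟩

theorem Iso.dualOp {X Y : QRep k (Op V)} (h : Iso X Y) : Iso X.dualOp Y.dualOp := by
  obtain ⟨f, hf⟩ := h.symm
  refine ⟨fun v => (f ⟨v⟩).dualMap, fun i j a φ => LinearMap.ext fun y => ?_⟩
  exact congrArg (show Module.Dual k (X.obj ⟨j⟩) from φ) (hf ⟨j⟩ ⟨i⟩ a y).symm

theorem dualOp_biprod (A B : QRep k (Op V)) :
    Iso (biprod A B).dualOp (biprod A.dualOp B.dualOp) := by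
  refine Iso.symm ⟨fun v => Module.dualProdDualEquivDual k (A.obj ⟨v⟩) (B.obj ⟨v⟩), ?_⟩
  rintro i j a ⟨φ, ψ⟩
  rw [biprod_map]
  refine LinearMap.ext fun x => ?_
  obtain ⟨x, y⟩ := x
  have h := biprod_map (A := A) (B := B) (i := ⟨j⟩) (j := ⟨i⟩) a x y
  exact (congrArg (Module.dualProdDualEquivDual k (A.obj ⟨j⟩) (B.obj ⟨j⟩) (φ, ψ)) h).symm

/-- Both sides consist of the same bilinear pairings with the two arguments exchanged. -/
theorem hom_dualOp_right (Z : QRep k V) (W : QRep k (Op V)) :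
    hom Z W.dualOp = hom W Z.dual := by
  refine LinearEquiv.finrank_eq
    { toFun := fun f => ⟨fun v => LinearMap.flip (f.1 v.unop), mem_ker_extDiff.2 fun i j a w => ?_⟩
      invFun := fun f => ⟨fun v => LinearMap.flip (f.1 ⟨v⟩), mem_ker_extDiff.2 fun i j a w => ?_⟩
      map_add' := fun _ _ => rfl
      map_smul' := fun _ _ => rfl
      left_inv := fun _ => rfl
      right_inv := fun _ => rfl }
  · refine LinearMap.ext fun z => ?_
    exact (LinearMap.congr_fun (mem_ker_extDiff.1 f.2 j.unop i.unop a z) w).symm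
  · refine LinearMap.ext fun z => ?_
    exact (LinearMap.congr_fun (mem_ker_extDiff.1 f.2 ⟨j⟩ ⟨i⟩ a z) w).symm

theorem hom_dualOp_left [Finite V] {Z : QRep k V} {W : QRep k (Op V)} (hZ : Z.IsFD)
    (hW : W.IsFD) : hom W.dualOp Z = hom Z.dual W := by
  rw [(iso_dualOp_dual hZ).hom_right (isFD_dualOp hW) hZ, hom_dualOp_right,
    ← (iso_dual_dualOp hW).hom_right (isFD_dual hZ) hW]

theorem euler_op [Fintype V] (x y : V → ℤ) :
    euler (fun v : Op V => x v.unop) (fun v => y v.unop) = euler y x := by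
  unfold euler
  rw [← (opEquiv V).sum_comp, ← (opEquiv V).sum_comp]
  congr 1
  · exact Finset.sum_congr rfl fun v _ => mul_comm _ _
  · rw [Finset.sum_comm, ← (opEquiv V).sum_comp, Finset.sum_comm]
    rw [Finset.sum_comm]
    refine Finset.sum_congr rfl fun i _ => Finset.sum_congr rfl fun j _ => ?_
    rw [mul_comm (y i)]
    rfl

variable [Fintype V] [∀ i j : V, Finite (i ⟶ j)]

theorem ext_dual {Y Z : QRep k V} (hY : Y.IsFD) (hZ : Z.IsFD) : ext Y.dual Z.dual = ext Z Y := by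
  have h1 := hom_sub_ext (isFD_dual hY) (isFD_dual hZ)
  have h2 := hom_sub_ext hZ hY
  rw [dimZ_dual, dimZ_dual, euler_op] at h1
  rw [← hom_dualOp_right, ← (iso_dualOp_dual hY).hom_right hZ hY] at h1
  omega

variable [Finite k]

/-- The inverse Auslander-Reiten translation. -/
def tauInv (Y : QRep k V) : QRep k V := (tau Y.dual).dualOp

omit [Finite k] in
theorem isFD_tauInv (hQ : IsAcyclic V) {Y : QRep k V} (hY : Y.IsFD) : (tauInv Y).IsFD :=
  isFD_dualOp (isFD_tau (isAcyclic_op hQ) (isFD_dual hY))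

omit [Finite k] in
-- The Auslander-Reiten formula over the opposite quiver, read through duality.
theorem hom_tauInv (hQ : IsAcyclic V) {Y Z : QRep k V} (hY : Y.IsFD) (hZ : Z.IsFD) :
    hom (tauInv Y) Z = ext Z Y := by
  rw [tauInv, hom_dualOp_left hZ (isFD_tau (isAcyclic_op hQ) (isFD_dual hY)),
    hom_tau' (isAcyclic_op hQ) (isFD_dual hY) (isFD_dual hZ), ext_dual hY hZ]

theorem iso_inj_dualOp_proj (hQ : IsAcyclic V) (v : V) :
    Iso (inj k v) (proj k (⟨v⟩ : Op V)).dualOp :=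
  iso_of_hom_eq (isFD_inj hQ v) (isFD_dualOp (isFD_proj (isAcyclic_op hQ) _)) fun Z hZ => by
    rw [hom_inj hQ hZ, hom_dualOp_right, hom_proj (isAcyclic_op hQ) (isFD_dual hZ)]
    exact Subspace.dual_finrank_eq.symm

theorem hom_dual_proj (hQ : IsAcyclic V) {Y : QRep k V} (hY : Y.IsFD) (v : V) :
    hom Y.dual (proj k (⟨v⟩ : Op V)) = hom (inj k v) Y := by
  rw [(iso_inj_dualOp_proj hQ v).hom_left (isFD_inj hQ v) hY,
    hom_dualOp_left hY (isFD_proj (isAcyclic_op hQ) _)]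

/-- The condition `h0` expresses the absence of injective summands; it is dual to the condition in
`euler_tau`, which is applied over the opposite quiver. -/
theorem euler_tauInv (hQ : IsAcyclic V) {Y : QRep k V} (hY : Y.IsFD)
    (h0 : ∀ v, hom (inj k v) Y = 0) (z : V → ℤ) :
    euler (tauInv Y).dimZ z = - euler z Y.dimZ := by
  have h := euler_tau (isAcyclic_op hQ) (isFD_dual hY) (fun v => by
    rw [← h0 v.unop, ← hom_dual_proj hQ hY]) fun v => z v.unop
  have h1 := euler_op z (tauInv Y).dimZ
  rw [dimZ_dual, euler_op] at h
  rw [← h1, ← h, tauInv, dimZ_dualOp]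

theorem ext_tauInv (hQ : IsAcyclic V) {Y Z : QRep k V} (hY : Y.IsFD) (hZ : Z.IsFD)
    (h0 : ∀ v, hom (inj k v) Y = 0) : ext (tauInv Y) Z = hom Z Y := by
  have h1 := hom_sub_ext (isFD_tauInv hQ hY) hZ
  have h2 := hom_sub_ext hZ hY
  rw [euler_tauInv hQ hY h0, hom_tauInv hQ hY hZ] at h1
  omega

omit [Finite k] in
theorem hom_tauInv_proj (hQ : IsAcyclic V) {Y : QRep k V} (hY : Y.IsFD) (v : V) :
    hom (tauInv Y) (proj k v) = 0 := by
  rw [hom_tauInv hQ hY (isFD_proj hQ v), ext_proj hQ hY]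

/-- Using both formulas, `hom Z (τ τ⁻ Y) = ext (τ⁻ Y) Z = hom Z Y` for every `Z`. -/
theorem iso_tau_tauInv (hQ : IsAcyclic V) {Y : QRep k V} (hY : Y.IsFD)
    (h0 : ∀ v, hom (inj k v) Y = 0) : Iso Y (tau (tauInv Y)) :=
  iso_of_hom_eq hY (isFD_tau hQ (isFD_tauInv hQ hY)) fun Z hZ => by
    rw [hom_tau' hQ (isFD_tauInv hQ hY) hZ, ext_tauInv hQ hY hZ h0]

theorem iso_of_hom_eq_left {X Y : QRep k V} (hX : X.IsFD) (hY : Y.IsFD)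
    (h : ∀ Z : QRep k V, Z.IsFD → hom X Z = hom Y Z) : Iso X Y := by
  have e : Iso X.dual Y.dual := iso_of_hom_eq (isFD_dual hX) (isFD_dual hY) fun W hW => by
    rw [← hom_dualOp_right, ← hom_dualOp_right, h _ (isFD_dualOp hW)]
  exact ((iso_dualOp_dual hX).trans e.dualOp).trans (iso_dualOp_dual hY).symm

/-- A module with a nonzero morphism from an indecomposable injective module has an indecomposable
injective direct summand. -/
theorem exists_iso_biprod_inj (hQ : IsAcyclic V) {Y : QRep k V} (hY : Y.IsFD) {v : V}
    (h : hom (inj k v) Y ≠ 0) :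
    ∃ (w : V) (Y' : QRep k V), Y'.IsFD ∧ Iso Y (biprod Y' (inj k w)) := by
  rw [← hom_dual_proj hQ hY] at h
  obtain ⟨w, X', hX', e⟩ := exists_iso_biprod_proj (isAcyclic_op hQ) (isFD_dual hY) h
  refine ⟨w.unop, X'.dualOp, isFD_dualOp hX', ?_⟩
  refine (((iso_dualOp_dual hY).trans e.dualOp).trans (dualOp_biprod _ _)).trans ?_
  obtain ⟨f, hf⟩ := (iso_inj_dualOp_proj (k := k) hQ w.unop).symm
  refine ⟨fun v => LinearEquiv.prodCongr (LinearEquiv.refl k _) (f v), ?_⟩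
  rintro i j a ⟨x, y⟩
  rw [biprod_map]
  refine Eq.trans ?_ (biprod_map a _ _).symm
  exact Prod.ext rfl (hf i j a y)

end Duality

/-! ### Regular, preprojective and preinjective modules. -/

section Regular

variable {k V : Type u} [Field k] [Quiver.{u} V]

theorem biprod_comm (A B : QRep k V) : Iso (biprod A B) (biprod B A) := by
  refine ⟨fun v => LinearEquiv.prodComm k (A.obj v) (B.obj v), ?_⟩
  rintro i j a ⟨x, y⟩
  rw [biprod_map]
  exact (biprod_map a y x).symm

theorem IsHom.iso_restrict_range {X Y : QRep k V} {f : ∀ v, X.obj v →ₗ[k] Y.obj v}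
    (hf : IsHom X Y f) (hi : ∀ v, Function.Injective (f v)) :
    Iso X (Y.restrict _ hf.isSub_range) :=
  ⟨fun v => LinearEquiv.ofInjective _ (hi v), fun i j a x => Subtype.ext (hf i j a x)⟩

theorem Iso.isPreinjectiveIndec {X Y : QRep k V} (h : Iso X Y) (hX : X.IsPreinjectiveIndec) :
    Y.IsPreinjectiveIndec := by
  obtain ⟨hi, m, v, e⟩ := hX
  exact ⟨h.indec hi, m, v, h.symm.trans e⟩

/-- No direct summand is an indecomposable preinjective module. -/
def NoPreinj (Y : QRep k V) : Prop :=
  ∀ A B : QRep k V, Iso Y (biprod A B) → ¬ A.IsPreinjectiveIndec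

theorem IsRegular.noPreinj {X : QRep k V} (hX : X.IsRegular) : X.NoPreinj := by
  intro A B h hA
  obtain ⟨U, W, hU, hW, hc, hAU, -⟩ := h.exists_isCompl
  exact (hX.2 U W hU hW hc).2 (hAU.isPreinjectiveIndec hA)

theorem isRegular_of_forall {X : QRep k V} (hX : X.IsFD)
    (h : ∀ A B : QRep k V, Iso X (biprod A B) →
      ¬ A.IsPreprojectiveIndec ∧ ¬ A.IsPreinjectiveIndec) : X.IsRegular :=
  ⟨hX, fun _ _ hU hW hc => h _ _ (iso_biprod_of_isCompl hU hW hc)⟩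

variable [Finite k] [Fintype V] [∀ i j : V, Finite (i ⟶ j)]

omit [Finite k] in
theorem isFD_tau_iterate (hQ : IsAcyclic V) {X : QRep k V} (hX : X.IsFD) (m : ℕ) :
    (tau^[m] X).IsFD := by
  induction m with
  | zero => exact hX
  | succ m ih =>
    rw [Function.iterate_succ_apply']
    exact isFD_tau hQ ih

theorem Iso.tau_iterate (hQ : IsAcyclic V) {X Y : QRep k V} (h : Iso X Y) (hX : X.IsFD) (m : ℕ) :
    Iso (QRep.tau^[m] X) (QRep.tau^[m] Y) := by
  induction m with
  | zero => exact h
  | succ m ih =>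
    rw [Function.iterate_succ_apply', Function.iterate_succ_apply']
    exact ih.tau hQ (isFD_tau_iterate hQ hX m)

theorem Iso.isPreprojectiveIndec (hQ : IsAcyclic V) {X Y : QRep k V} (h : Iso X Y) (hX : X.IsFD)
    (h' : X.IsPreprojectiveIndec) : Y.IsPreprojectiveIndec := by
  obtain ⟨hi, m, v, e⟩ := h'
  exact ⟨h.indec hi, m, v, (h.symm.tau_iterate hQ (h.isFD hX) m).trans e⟩

omit [Finite k] in
theorem isFD_of_iso_biprod {X A B : QRep k V} (h : Iso X (biprod A B)) (hX : X.IsFD) :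
    A.IsFD ∧ B.IsFD := by
  obtain ⟨U, W, hU, hW, -, hA, hB⟩ := h.exists_isCompl
  exact ⟨hA.symm.isFD (isFD_restrict hX _), hB.symm.isFD (isFD_restrict hX _)⟩

theorem IsRegular.not_isPreprojectiveIndec (hQ : IsAcyclic V) {X A B : QRep k V}
    (hX : X.IsRegular) (h : Iso X (biprod A B)) : ¬ A.IsPreprojectiveIndec := by
  intro hA
  have hfd := (isFD_of_iso_biprod h hX.1).1
  obtain ⟨U, W, hU, hW, hc, hAU, -⟩ := h.exists_isCompl
  exact (hX.2 U W hU hW hc).1 (hAU.isPreprojectiveIndec hQ hfd hA)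

theorem Iso.isRegular (hQ : IsAcyclic V) {X Y : QRep k V} (h : Iso X Y) (hX : X.IsRegular) :
    Y.IsRegular :=
  isRegular_of_forall (h.isFD hX.1) fun _ _ e =>
    ⟨hX.not_isPreprojectiveIndec hQ (h.trans e), hX.noPreinj _ _ (h.trans e)⟩

theorem IsRegularSimple.isZero_or_surjective (hQ : IsAcyclic V) {A X : QRep k V}
    (hX : X.IsRegularSimple) {f : ∀ v, A.obj v →ₗ[k] X.obj v} (hf : IsHom A X f)
    (hi : ∀ v, Function.Injective (f v)) (hA : A.IsRegular) :
    A.IsZero ∨ ∀ v, Function.Surjective (f v) := by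
  have e := hf.iso_restrict_range hi
  rcases hX.2.2 _ hf.isSub_range (e.isRegular hQ hA) with h | h
  · exact Or.inl (e.symm.isZero (hf.isSub_range.zero_iff_bot.2 h))
  · exact Or.inr fun v => LinearMap.range_eq_top.1 (h v)

theorem Iso.isRegularSimple (hQ : IsAcyclic V) {X Y : QRep k V} (h : Iso X Y)
    (hX : X.IsRegularSimple) : Y.IsRegularSimple := by
  refine ⟨h.indec hX.1, h.isRegular hQ hX.2.1, fun U hU hr => ?_⟩
  obtain ⟨f, hf⟩ := h.symm
  have hg : IsHom (Y.restrict U hU) X fun v => (f v).toLinearMap ∘ₗ (U v).subtype :=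
    fun i j a x => hf i j a x.1
  rcases hX.isZero_or_surjective hQ hg
    (fun v => (f v).injective.comp Subtype.val_injective) hr with h0 | h0
  · exact Or.inl (hU.zero_iff_bot.1 h0)
  · refine Or.inr fun v => Submodule.eq_top_iff'.2 fun y => ?_
    obtain ⟨x, hx⟩ := h0 v (f v y)
    rw [← (f v).injective hx]
    exact x.2

theorem isPreinjectiveIndec_inj (hQ : IsAcyclic V) (v : V) :
    (inj k v).IsPreinjectiveIndec :=
  ⟨indec_of_hom_self (isFD_inj hQ v) (hom_inj_self hQ v), 0, v, Iso.refl _⟩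

theorem NoPreinj.hom_inj (hQ : IsAcyclic V) {Y : QRep k V} (hY : Y.IsFD) (h : Y.NoPreinj) (v : V) :
    hom (inj k v) Y = 0 := by
  by_contra h0
  obtain ⟨w, Y', -, e⟩ := exists_iso_biprod_inj hQ hY h0
  exact h _ _ (e.trans (biprod_comm _ _)) (isPreinjectiveIndec_inj hQ w)

theorem IsRegular.hom_proj (hQ : IsAcyclic V) {X : QRep k V} (hX : X.IsRegular) (v : V) :
    hom X (proj k v) = 0 := by
  by_contra h0
  obtain ⟨w, X', -, e⟩ := exists_iso_biprod_proj hQ hX.1 h0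
  exact hX.not_isPreprojectiveIndec hQ (e.trans (biprod_comm _ _))
    ⟨indec_of_hom_self (isFD_proj hQ w) (hom_proj_self hQ w), 0, w, Iso.refl _⟩

/-- The translate of an indecomposable module without projective summands is indecomposable. -/
theorem Indec.tau (hQ : IsAcyclic V) {N : QRep k V} (hN : N.IsFD) (hi : N.Indec)
    (h0 : ∀ v, hom N (proj k v) = 0) : (tau N).Indec := by
  have hτ := isFD_tau hQ hN
  refine indec_of_forall (fun hz => hi.1 (isZero_of_hom_self hN ?_)) fun A B e => ?_
  · rw [← hom_tau_tau hQ hN hN h0, hom_eq_zero_of_isZero_left hz hτ]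
  · obtain ⟨hA, hB⟩ := isFD_of_iso_biprod e hτ
    have hAB : ∀ v, hom (inj k v) A = 0 ∧ hom (inj k v) B = 0 := fun v => by
      have h1 := hom_inj_tau hQ hN v
      rw [e.hom_right (isFD_inj hQ v) hτ, hom_biprod_right (isFD_inj hQ v) hA hB] at h1
      omega
    -- A decomposition of `τ N` is carried back to `N` by the inverse translate; `hom (τ N) (τ Z) =
    -- hom N Z` identifies the result.
    have e2 : Iso N (biprod (tauInv A) (tauInv B)) := by
      refine iso_of_hom_eq_left hN (isFD_biprod (isFD_tauInv hQ hA) (isFD_tauInv hQ hB))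
        fun Z hZ => ?_
      have hτZ := isFD_tau hQ hZ
      rw [← hom_tau_tau hQ hN hZ h0, e.hom_left hτ hτZ, hom_biprod_left hτZ hA hB,
        hom_biprod_left hZ (isFD_tauInv hQ hA) (isFD_tauInv hQ hB), hom_tau' hQ hZ hA,
        hom_tau' hQ hZ hB, hom_tauInv hQ hA hZ, hom_tauInv hQ hB hZ]
    -- A summand with zero inverse translate is zero, because `hom C C = ext (τ⁻ C) C`.
    have key : ∀ {C : QRep k V}, C.IsFD → (∀ v, hom (inj k v) C = 0) → (tauInv C).IsZero →
        C.IsZero := fun {C} hC hC0 hz => isZero_of_hom_self hC (by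
      rw [← ext_tauInv hQ hC hC hC0]
      have h1 := hom_sub_ext (isFD_tauInv hQ hC) hC
      have h2 : (tauInv C).dimZ = 0 := funext fun v => by
        have := hz v
        exact congrArg Nat.cast Module.finrank_zero_of_subsingleton
      rw [hom_eq_zero_of_isZero_left hz hC, h2, euler_zero_left] at h1
      omega)
    exact (hi.isZero_or_isZero e2).imp (key hA fun v => (hAB v).1) (key hB fun v => (hAB v).2)

/-- A summand `τ^m I` of `τ⁻ Y` would give the indecomposable summand `τ^(m+1) I` of `τ τ⁻ Y ≅ Y`.
-/
theorem NoPreinj.tauInv (hQ : IsAcyclic V) {Y : QRep k V} (hY : Y.IsFD) (h : Y.NoPreinj) :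
    (tauInv Y).NoPreinj := by
  rintro N Y' e ⟨hi, m, v, e'⟩
  have hfd := isFD_tauInv hQ hY
  obtain ⟨hN, hY'⟩ := isFD_of_iso_biprod e hfd
  have h0 : ∀ v, hom N (proj k v) = 0 := fun v => by
    have h1 := hom_tauInv_proj hQ hY v
    rw [e.hom_left hfd (isFD_proj hQ v), hom_biprod_left (isFD_proj hQ v) hN hY'] at h1
    omega
  refine h _ _ (((iso_tau_tauInv hQ hY (h.hom_inj hQ hY)).trans (e.tau hQ hfd)).trans
    (tau_biprod hQ hN hY')) ⟨hi.tau hQ hN h0, m + 1, v, ?_⟩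
  rw [Function.iterate_succ_apply']
  exact e'.tau hQ hN

/-- Writing `Y ≅ τ (τ⁻ Y)` and cancelling `τ` lowers `t`; for `t = 0`, a nonzero morphism from an
injective splits off an injective summand. -/
theorem NoPreinj.hom_tau_iterate_inj (hQ : IsAcyclic V) (t : ℕ) (v : V) :
    ∀ {Y : QRep k V}, Y.IsFD → Y.NoPreinj → hom (QRep.tau^[t] (inj k v)) Y = 0 := by
  induction t with
  | zero => exact fun hY h => h.hom_inj hQ hY v
  | succ t ih =>
    intro Y hY h
    have hI := isFD_tau_iterate hQ (isFD_inj (k := k) hQ v) t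
    have hY' := isFD_tauInv hQ hY
    rw [Function.iterate_succ_apply', (iso_tau_tauInv hQ hY (h.hom_inj hQ hY)).hom_right
      (isFD_tau hQ hI) hY]
    have := hom_tau_tau_le hQ hI hY'
    rw [ih hY' (h.tauInv hQ hY)] at this
    omega

theorem isFD_tauInv_iterate (hQ : IsAcyclic V) {Y : QRep k V} (hY : Y.IsFD) (t : ℕ) :
    (QRep.tauInv^[t] Y).IsFD := by
  induction t with
  | zero => exact hY
  | succ t ih =>
    rw [Function.iterate_succ_apply']
    exact isFD_tauInv hQ ih

theorem NoPreinj.tauInv_iterate (hQ : IsAcyclic V) {Y : QRep k V} (hY : Y.IsFD) (h : Y.NoPreinj)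
    (t : ℕ) : (QRep.tauInv^[t] Y).NoPreinj := by
  induction t with
  | zero => exact h
  | succ t ih =>
    rw [Function.iterate_succ_apply']
    exact ih.tauInv hQ (isFD_tauInv_iterate hQ hY t)

theorem NoPreinj.iso_tau_tauInv_iterate (hQ : IsAcyclic V) (t : ℕ) :
    ∀ {Y : QRep k V}, Y.IsFD → Y.NoPreinj → Iso Y (QRep.tau^[t] (QRep.tauInv^[t] Y)) := by
  induction t with
  | zero => exact fun _ _ => Iso.refl _
  | succ t ih =>
    intro Y hY h
    rw [Function.iterate_succ_apply', Function.iterate_succ_apply]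
    exact (iso_tau_tauInv hQ hY (h.hom_inj hQ hY)).trans
      ((ih (isFD_tauInv hQ hY) (h.tauInv hQ hY)).tau hQ (isFD_tauInv hQ hY))

theorem Iso.tauInv (hQ : IsAcyclic V) {X Y : QRep k V} (h : Iso X Y) (hX : X.IsFD) :
    Iso (tauInv X) (tauInv Y) :=
  iso_of_hom_eq_left (isFD_tauInv hQ hX) (isFD_tauInv hQ (h.isFD hX)) fun Z hZ => by
    rw [hom_tauInv hQ hX hZ, hom_tauInv hQ (h.isFD hX) hZ, h.ext_right hZ hX]

theorem Iso.tauInv_iterate (hQ : IsAcyclic V) {X Y : QRep k V} (h : Iso X Y) (hX : X.IsFD)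
    (m : ℕ) : Iso (QRep.tauInv^[m] X) (QRep.tauInv^[m] Y) := by
  induction m with
  | zero => exact h
  | succ m ih =>
    rw [Function.iterate_succ_apply', Function.iterate_succ_apply']
    exact ih.tauInv hQ (isFD_tauInv_iterate hQ hX m)

/-- Applying `τ` to both sides `m` times turns `N` into a projective and leaves one inverse
translate on the source; an inverse translate has no nonzero morphism to a projective. -/
theorem hom_tauInv_iterate_preproj (hQ : IsAcyclic V) {Y : QRep k V} (hY : Y.IsFD)
    (h : Y.NoPreinj) (v : V) (m : ℕ) : ∀ {N : QRep k V}, N.IsFD →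
      Iso (QRep.tau^[m] N) (proj k v) → hom (QRep.tauInv^[m + 1] Y) N = 0 := by
  induction m with
  | zero =>
    intro N hN e
    have e : Iso N (proj k v) := e
    rw [e.hom_right (isFD_tauInv_iterate hQ hY _) hN]
    exact hom_tauInv_proj hQ hY v
  | succ m ih =>
    intro N hN e
    have hfd := isFD_tauInv_iterate hQ hY (m + 1)
    have hn := h.tauInv_iterate hQ hY (m + 1)
    rw [Function.iterate_succ_apply', ← hom_tau_tau hQ (isFD_tauInv hQ hfd) hN
      (hom_tauInv_proj hQ hfd), ← (iso_tau_tauInv hQ hfd (hn.hom_inj hQ hfd)).hom_left hfd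
      (isFD_tau hQ hN)]
    exact ih (isFD_tau hQ hN) e

omit [Finite k] in
theorem Indec.hom_self_ne_zero {X : QRep k V} (h : X.Indec) (hX : X.IsFD) : hom X X ≠ 0 :=
  fun h0 => h.1 (isZero_of_hom_self hX h0)

omit [Finite k] in
theorem Indec.hom_ne_zero_of_iso_biprod {X A B : QRep k V} (hX : X.IsFD)
    (e : Iso X (biprod A B)) (hA : A.Indec) : hom X A ≠ 0 ∧ hom A X ≠ 0 := by
  obtain ⟨hfA, hfB⟩ := isFD_of_iso_biprod e hX
  have := hA.hom_self_ne_zero hfA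
  rw [e.hom_left hX hfA, e.hom_right hfA hX, hom_biprod_left hfA hfA hfB,
    hom_biprod_right hfA hfA hfB]
  omega

/-- There are only finitely many isomorphism classes of modules of bounded dimension. -/
theorem exists_lt_iso_of_bounded {X : ℕ → QRep k V} (hX : ∀ t, (X t).IsFD) (B : ℕ)
    (hB : ∀ t v, (X t).dimVec v ≤ B) : ∃ a b, a < b ∧ Iso (X a) (X b) := by
  -- A module of dimension at most `B` at each vertex is encoded by its dimension vector and its
  -- maps in coordinates; there are finitely many codes since `k` is finite.
  let T : Type u := Σ d : V → Fin (B + 1),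
    ∀ i j : V, (i ⟶ j) → ((Fin (d j) → k) →ₗ[k] (Fin (d i) → k))
  have : Finite T := by
    have : ∀ d : V → Fin (B + 1), Finite (∀ i j : V, (i ⟶ j) →
        ((Fin (d j) → k) →ₗ[k] (Fin (d i) → k))) := fun d => by
      have : ∀ i j : V, Finite ((Fin (d j) → k) →ₗ[k] (Fin (d i) → k)) := fun i j =>
        Module.finite_of_finite k
      infer_instance
    infer_instance
  let toRep : T → QRep k V := fun x =>
    { obj := fun v => Fin (x.1 v) → k
      map := fun {i j} a => x.2 i j a }
  have := fun t v => hX t v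
  let e : ∀ t v, (X t).obj v ≃ₗ[k] (Fin ((X t).dimVec v) → k) := fun t v =>
    (Module.finBasis k ((X t).obj v)).equivFun
  let code : ℕ → T := fun t => ⟨fun v => ⟨(X t).dimVec v, Nat.lt_succ_of_le (hB t v)⟩,
    fun i j a => (e t i).toLinearMap ∘ₗ (X t).map a ∘ₗ (e t j).symm.toLinearMap⟩
  have hiso : ∀ t, Iso (X t) (toRep (code t)) := fun t =>
    ⟨fun v => e t v, fun i j a x => by
      change e t i ((X t).map a x) = e t i ((X t).map a ((e t j).symm (e t j x)))
      rw [LinearEquiv.symm_apply_apply]⟩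
  obtain ⟨a, b, hab, h⟩ := Finite.exists_ne_map_eq_of_infinite code
  have hiso' : Iso (X a) (X b) := by
    have h1 := hiso a
    rw [h] at h1
    exact h1.trans (hiso b).symm
  rcases lt_or_gt_of_ne hab with h' | h'
  · exact ⟨a, b, h', hiso'⟩
  · exact ⟨b, a, h', hiso'.symm⟩

/-- If the iterated inverse translates of a module are bounded, then it has no nonzero morphisms to
preprojective modules. -/
theorem NoPreinj.hom_preproj_of_bounded (hQ : IsAcyclic V) {K : QRep k V} (hK : K.IsFD)
    (h : K.NoPreinj) (B : ℕ) (hB : ∀ t v, (QRep.tauInv^[t] K).dimVec v ≤ B) {N : QRep k V}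
    (hN : N.IsFD) (hp : N.IsPreprojectiveIndec) : hom K N = 0 := by
  obtain ⟨-, m, v, e⟩ := hp
  obtain ⟨a, b, hab, hiso⟩ := exists_lt_iso_of_bounded (isFD_tauInv_iterate hQ hK) B hB
  obtain ⟨d, rfl⟩ := Nat.exists_eq_add_of_lt hab
  rw [add_assoc, Function.iterate_add_apply] at hiso
  -- Two of the inverse translates are isomorphic; applying `τ` to them `a` times shows that `K`
  -- itself is periodic.
  have hK1 : Iso K (QRep.tauInv^[d + 1] K) :=
    ((h.iso_tau_tauInv_iterate hQ a hK).trans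
      (hiso.tau_iterate hQ (isFD_tauInv_iterate hQ hK a) a)).trans
      (NoPreinj.iso_tau_tauInv_iterate hQ a (isFD_tauInv_iterate hQ hK _)
        (h.tauInv_iterate hQ hK _)).symm
  have hKn : ∀ n, Iso K (QRep.tauInv^[n * (d + 1)] K) := by
    intro n
    induction n with
    | zero => rw [zero_mul]; exact Iso.refl _
    | succ n ih =>
      rw [add_mul, one_mul, Function.iterate_add_apply]
      exact ih.trans (hK1.tauInv_iterate hQ hK _)
  have h1 := hKn (m + 1)
  -- By periodicity `K` is an `(m + 1)`-fold inverse translate, which is what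
  -- `hom_tauInv_iterate_preproj` requires.
  have h2 : (m + 1) * (d + 1) = (m + 1) + (m + 1) * d := by ring
  rw [h2, Function.iterate_add_apply] at h1
  rw [h1.hom_left hK hN]
  exact hom_tauInv_iterate_preproj hQ (isFD_tauInv_iterate hQ hK _)
    (h.tauInv_iterate hQ hK _) v m hN e

end Regular

/-! ### A Schur lemma for the regular simple modules of a tube. -/

section Tube

variable {k V : Type u} [Field k] [Finite k] [Quiver.{u} V] [Fintype V]
  [∀ i j : V, Finite (i ⟶ j)] {r : ℕ} {E : ZMod r → QRep k V}

namespace IsNonhomogeneousTube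

omit [Finite k] [Fintype V] [∀ i j : V, Finite (i ⟶ j)] in
theorem isFD (hE : IsNonhomogeneousTube r E) (j : ZMod r) : (E j).IsFD :=
  (hE.regularSimple j).2.1.1

theorem hom_proj (hE : IsNonhomogeneousTube r E) (hQ : IsAcyclic V) (j : ZMod r) (v : V) :
    hom (E j) (proj k v) = 0 :=
  (hE.regularSimple j).2.1.hom_proj hQ v

theorem ext_right (hE : IsNonhomogeneousTube r E) (hQ : IsAcyclic V) (j : ZMod r) {Z : QRep k V}
    (hZ : Z.IsFD) : ext Z (E j) = hom (E (j + 1)) Z := by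
  rw [← (hE.tau_iso j).ext_right hZ (isFD_tau hQ (hE.isFD _)),
    ext_tau hQ (hE.isFD _) hZ (hE.hom_proj hQ _)]

theorem hom_right (hE : IsNonhomogeneousTube r E) (hQ : IsAcyclic V) (j : ZMod r) {Z : QRep k V}
    (hZ : Z.IsFD) : hom Z (E j) = ext (E (j + 1)) Z := by
  rw [← (hE.tau_iso j).hom_right hZ (isFD_tau hQ (hE.isFD _)), hom_tau' hQ (hE.isFD _) hZ]

theorem euler_right (hE : IsNonhomogeneousTube r E) (hQ : IsAcyclic V) (j : ZMod r) (z : V → ℤ) :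
    euler z (E j).dimZ = - euler (E (j + 1)).dimZ z := by
  rw [← (hE.tau_iso j).dimZ_eq, euler_tau hQ (hE.isFD _) (hE.hom_proj hQ _)]

theorem hom_tau_iterate_inj (hE : IsNonhomogeneousTube r E) (hQ : IsAcyclic V) (j : ZMod r)
    (m : ℕ) (v : V) : hom (QRep.tau^[m] (inj k v)) (E j) = 0 :=
  (hE.regularSimple j).2.1.noPreinj.hom_tau_iterate_inj hQ m v (hE.isFD j)

/-- Translation permutes the tube, so it can be applied to both sides until the target is
projective. -/
theorem hom_preproj (hE : IsNonhomogeneousTube r E) (hQ : IsAcyclic V) (m : ℕ) (v : V) :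
    ∀ (j : ZMod r) {N : QRep k V}, N.IsFD → Iso (QRep.tau^[m] N) (proj k v) →
      hom (E j) N = 0 := by
  induction m with
  | zero =>
    intro j N hN e
    have e : Iso N (proj k v) := e
    rw [e.hom_right (hE.isFD j) hN]
    exact hE.hom_proj hQ j v
  | succ m ih =>
    intro j N hN e
    have hj := hE.tau_iso (j - 1)
    rw [sub_add_cancel] at hj
    rw [← hom_tau_tau hQ (hE.isFD j) hN (hE.hom_proj hQ j),
      hj.hom_left (isFD_tau hQ (hE.isFD j)) (isFD_tau hQ hN)]
    exact ih (j - 1) (isFD_tau hQ hN) e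

/-- A nonzero morphism from a regular simple module in a tube to a regular simple module is
bijective. -/
theorem bijective (hE : IsNonhomogeneousTube r E) (hQ : IsAcyclic V) (j : ZMod r) {S : QRep k V}
    (hS : S.IsRegularSimple) {g : ∀ v, (E j).obj v →ₗ[k] S.obj v} (hg : IsHom (E j) S g)
    (h0 : g ≠ 0) (v : V) : Function.Bijective (g v) := by
  have hEj := hE.isFD j
  have hSfd := hS.2.1.1
  have hsurj : ∀ v, Function.Surjective (g v) := by
    have hI := isFD_restrict hSfd hg.isSub_range
    have hgI : IsHom (E j) (S.restrict _ hg.isSub_range) fun v => (g v).rangeRestrict :=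
      fun i j a x => Subtype.ext (hg i j a x)
    -- A preprojective summand of the image would receive a nonzero morphism from `E j`, and a
    -- preinjective one would embed in `S`. So the image is regular, hence all of `S`.
    have hreg : (S.restrict _ hg.isSub_range).IsRegular := by
      refine isRegular_of_forall hI fun A B e => ⟨?_, ?_⟩
      · rintro ⟨hi, m, w, e'⟩
        have hA := (isFD_of_iso_biprod e hI).1
        have h1 := (hi.hom_ne_zero_of_iso_biprod hI e).1
        have h2 := hom_le_of_surjective hEj hA hgI fun v => (g v).surjective_rangeRestrict
        rw [hE.hom_preproj hQ m w j hA e'] at h2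
        omega
      · rintro ⟨hi, m, w, e'⟩
        have hA := (isFD_of_iso_biprod e hI).1
        have h1 := (hi.hom_ne_zero_of_iso_biprod hI e).2
        have h2 := hom_le_of_injective hA hSfd (isHom_subtype hg.isSub_range)
          fun v => Subtype.val_injective
        rw [e'.hom_left hA hSfd, hS.2.1.noPreinj.hom_tau_iterate_inj hQ m w hSfd] at h2
        omega
    rcases hS.isZero_or_surjective hQ (isHom_subtype hg.isSub_range)
      (fun v => Subtype.val_injective) hreg with h | h
    · refine absurd (funext fun v => LinearMap.ext fun x => ?_) h0
      have := hg.isSub_range.zero_iff_bot.1 h v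
      exact LinearMap.congr_fun (LinearMap.range_eq_bot.1 this) x
    · intro v y
      obtain ⟨⟨y, x, rfl⟩, rfl⟩ := h v y
      exact ⟨x, rfl⟩
  refine ⟨?_, hsurj v⟩
  have hK := isFD_restrict hEj hg.isSub_ker
  set K := (E j).restrict _ hg.isSub_ker with hKdef
  have hdim : K.dimZ + S.dimZ = (E j).dimZ := by
    funext w
    have := hEj w
    have h1 := LinearMap.finrank_range_add_finrank_ker (g w)
    rw [LinearMap.range_eq_top.2 (hsurj w), finrank_top, add_comm] at h1
    exact congrArg (Nat.cast (R := ℤ)) h1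
  have hKE : ∀ A : QRep k V, A.IsFD → hom A K ≤ hom A (E j) := fun A hA =>
    hom_le_of_injective hA hEj (isHom_subtype hg.isSub_ker) fun v => Subtype.val_injective
  have hKn : K.NoPreinj := by
    rintro A B e ⟨hi, m, w, e'⟩
    have hA := (isFD_of_iso_biprod e hK).1
    have h1 := (hi.hom_ne_zero_of_iso_biprod hK e).2
    have h2 := hKE A hA
    rw [e'.hom_left hA hEj, hE.hom_tau_iterate_inj hQ] at h2
    omega
  have hSn := hS.2.1.noPreinj
  -- Neither the kernel `K` nor `S` has preinjective summands, so each inverse translate changes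
  -- dimension vectors by the same linear map, which shifts the index in the tube.
  have hdim_t : ∀ t, (QRep.tauInv^[t] K).dimZ + (QRep.tauInv^[t] S).dimZ = (E (j + t)).dimZ := by
    intro t
    induction t with
    | zero => simpa using hdim
    | succ t ih =>
      rw [Function.iterate_succ_apply', Function.iterate_succ_apply']
      refine eq_of_euler_left k hQ fun z => ?_
      have h1 := isFD_tauInv_iterate hQ hK t
      have h2 := isFD_tauInv_iterate hQ hSfd t
      rw [euler_add_left, euler_tauInv hQ h1 ((hKn.tauInv_iterate hQ hK t).hom_inj hQ h1),
        euler_tauInv hQ h2 ((hSn.tauInv_iterate hQ hSfd t).hom_inj hQ h2), ← neg_add,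
        ← euler_add_right, ih, hE.euler_right hQ, neg_neg, Nat.cast_add, Nat.cast_one, add_assoc]
  have : NeZero r := ⟨by have := hE.two_le; omega⟩
  -- The tube has only `r` regular simples, so all inverse translates of `K` are bounded. This
  -- excludes preprojective summands of `K`; thus `K` is regular, and regular simplicity of `E j`
  -- makes it zero.
  obtain ⟨B, hB⟩ : ∃ B, ∀ (i : ZMod r) (w : V), (E i).dimVec w ≤ B :=
    ⟨∑ i, ∑ w, (E i).dimVec w, fun i w =>
      (Finset.single_le_sum (f := fun w => (E i).dimVec w) (fun _ _ => Nat.zero_le _)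
        (Finset.mem_univ w)).trans
      (Finset.single_le_sum (f := fun i => ∑ w, (E i).dimVec w) (fun _ _ => Nat.zero_le _)
        (Finset.mem_univ i))⟩
  have hKB : ∀ t w, (QRep.tauInv^[t] K).dimVec w ≤ B := fun t w => by
    have h1 := congr_fun (hdim_t t) w
    have h2 := hB (j + t) w
    simp only [dimZ, Pi.add_apply] at h1
    omega
  have hKreg : K.IsRegular := by
    refine isRegular_of_forall hK fun A B' e => ⟨fun hp => ?_, hKn _ _ e⟩
    have hA := (isFD_of_iso_biprod e hK).1
    exact (hp.1.hom_ne_zero_of_iso_biprod hK e).1 (hKn.hom_preproj_of_bounded hQ hK B hKB hA hp)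
  rcases (hE.regularSimple j).2.2 _ hg.isSub_ker hKreg with h | h
  · exact LinearMap.ker_eq_bot.1 (h v)
  · exact absurd (funext fun v => LinearMap.ker_eq_top.1 (h v)) h0

theorem iso_of_hom_ne_zero (hE : IsNonhomogeneousTube r E) (hQ : IsAcyclic V) (j : ZMod r)
    {S : QRep k V} (hS : S.IsRegularSimple) (h : hom (E j) S ≠ 0) : Iso (E j) S := by
  obtain ⟨g, hg, h0⟩ := (hom_ne_zero_iff (hE.isFD j) hS.2.1.1).1 h
  exact hg.iso_of_bijective (hE.bijective hQ j hS hg h0)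

theorem hom_of_ne (hE : IsNonhomogeneousTube r E) (hQ : IsAcyclic V) {i j : ZMod r} (hij : i ≠ j) :
    hom (E i) (E j) = 0 := by
  by_contra h
  exact hij (hE.injective i j (hE.iso_of_hom_ne_zero hQ i (hE.regularSimple j) h))

end IsNonhomogeneousTube

/-- The endomorphism algebra. -/
def endAlg (X : QRep k V) : Subalgebra k (∀ v, Module.End k (X.obj v)) where
  carrier := {f | IsHom X X f}
  mul_mem' hf hg := IsHom.comp hf hg
  add_mem' {f g} hf hg i j a x := by simp [hf i j a x, hg i j a x]
  algebraMap_mem' c i j a x := by simp [Algebra.algebraMap_eq_smul_one]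

omit [Finite k] [Fintype V] [∀ i j : V, Finite (i ⟶ j)] in
theorem finrank_endAlg (X : QRep k V) : Module.finrank k (endAlg X) = hom X X :=
  LinearEquiv.finrank_eq
    { toFun := fun f => ⟨f.1, mem_ker_extDiff.2 f.2⟩
      invFun := fun f => ⟨f.1, mem_ker_extDiff.1 f.2⟩
      map_add' := fun _ _ => rfl
      map_smul' := fun _ _ => rfl
      left_inv := fun _ => rfl
      right_inv := fun _ => rfl }

omit [Finite k] [∀ i j : V, Finite (i ⟶ j)] in
/-- If all nonzero endomorphisms are bijective, then the dimension of the endomorphism algebra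
divides the dimension vector. -/
theorem hom_self_dvd {X : QRep k V} (hX : X.IsFD) (h0 : ¬ X.IsZero)
    (h : ∀ f, IsHom X X f → f ≠ 0 → ∀ v, Function.Injective (f v)) (v : V) :
    hom X X ∣ X.dimVec v := by
  have := hX.finite_hom hX
  have : FiniteDimensional k (endAlg X) :=
    FiniteDimensional.of_injective (endAlg X).val.toLinearMap Subtype.val_injective
  have : Nontrivial (endAlg X) := by
    refine ⟨⟨0, 1, fun h1 => h0 fun v => ⟨fun x y => ?_⟩⟩⟩
    have h2 : ∀ x : X.obj v, 0 = x := fun x =>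
      LinearMap.congr_fun (congr_fun (congrArg Subtype.val h1) v) x
    rw [← h2 x, ← h2 y]
  have : NoZeroDivisors (endAlg X) := ⟨fun {f g} hfg => by
    by_contra hne
    push Not at hne
    refine hne.2 (Subtype.ext (funext fun v => LinearMap.ext fun x => ?_))
    refine h f.1 f.2 (fun hf => hne.1 (Subtype.ext hf)) v ?_
    exact (LinearMap.congr_fun (congr_fun (congrArg Subtype.val hfg) v) x).trans
      (map_zero (f.1 v)).symm⟩
  have : IsDomain (endAlg X) := NoZeroDivisors.to_isDomain _
  -- A finite-dimensional domain is a division algebra, and each space of `X` is a vector space over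
  -- it.
  letI := divisionRingOfFiniteDimensional k (endAlg X)
  letI : Module (endAlg X) (X.obj v) := Module.compHom (X.obj v)
    ((Pi.evalRingHom (fun v => Module.End k (X.obj v)) v).comp (endAlg X).val.toRingHom)
  have : IsScalarTower k (endAlg X) (X.obj v) := ⟨fun c f x => rfl⟩
  have h1 := Module.finrank_mul_finrank k (endAlg X) (X.obj v)
  rw [finrank_endAlg] at h1
  exact ⟨_, h1.symm⟩

namespace IsNonhomogeneousTube

theorem ne_add_one (hE : IsNonhomogeneousTube r E) (j : ZMod r) : j + 1 ≠ j := by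
  have : Fact (1 < r) := ⟨hE.two_le⟩
  simp

/-- Let d be the dimension of End(E_j). Since `ext (E j) (E j) = hom (E (j + 1)) (E j) = 0`, the
Euler form of the dimension vector with itself is d. But d divides the dimension vector, so d²
divides d. -/
theorem hom_self (hE : IsNonhomogeneousTube r E) (hQ : IsAcyclic V) (j : ZMod r) :
    hom (E j) (E j) = 1 := by
  have hEj := hE.isFD j
  have hdvd := hom_self_dvd hEj (hE.regularSimple j).1.1 fun f hf h0 v =>
    (hE.bijective hQ j (hE.regularSimple j) hf h0 v).1
  choose c hc using hdvd
  have h1 := hom_sub_ext hEj hEj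
  rw [hE.ext_right hQ j hEj, hE.hom_of_ne hQ (hE.ne_add_one j)] at h1
  have h2 : (E j).dimZ = (hom (E j) (E j) : ℤ) • fun v => (c v : ℤ) := by
    funext v
    rw [Pi.smul_apply, smul_eq_mul]
    rw [← Nat.cast_mul, ← hc v]
    rfl
  rw [h2, euler_smul_left, euler_smul_right] at h1
  have h3 : hom (E j) (E j) ≠ 0 := (hE.regularSimple j).1.hom_self_ne_zero hEj
  have h4 : (hom (E j) (E j) : ℤ) * euler (fun v => (c v : ℤ)) (fun v => (c v : ℤ)) = 1 := by
    have h5 : (hom (E j) (E j) : ℤ) ≠ 0 := by exact_mod_cast h3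
    refine mul_left_cancel₀ h5 ?_
    rw [← h1]
    simp
  rcases Int.eq_one_or_neg_one_of_mul_eq_one h4 with h | h <;> omega

end IsNonhomogeneousTube

end Tube

/-! ### Exact sequences and extension classes. -/

section ExtensionClass

variable {k V : Type u} [Field k] [Quiver.{u} V]

theorem extDiff_apply {X Y : QRep k V} (f : ∀ v, X.obj v →ₗ[k] Y.obj v) {i j : V} (a : i ⟶ j)
    (x : X.obj j) : extDiff X Y f i j a x = Y.map a (f j x) - f i (X.map a x) := rfl

/-- A short exact sequence is given by a cocycle, and splits if the cocycle is a coboundary. -/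
theorem exists_iso_extn_of_exact {L X N : QRep k V} {f : ∀ v, L.obj v →ₗ[k] X.obj v}
    (hf : IsHom L X f) (hi : ∀ v, Function.Injective (f v)) {g : ∀ v, X.obj v →ₗ[k] N.obj v}
    (hg : IsHom X N g) (hs : ∀ v, Function.Surjective (g v))
    (he : ∀ v x, g v x = 0 ↔ ∃ y, f v y = x) :
    ∃ z : ∀ i j : V, (i ⟶ j) → (N.obj j →ₗ[k] L.obj i), Iso X (extn N L z) ∧
      (z ∈ LinearMap.range (extDiff N L) → ∃ s, IsHom N X s ∧ ∀ v y, g v (s v y) = y) := by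
  choose σ hσ using fun v => (g v).exists_rightInverse_of_surjective (LinearMap.range_eq_top.2 (hs v))
  choose ρ hρ using fun v => (f v).exists_leftInverse_of_injective (LinearMap.ker_eq_bot.2 (hi v))
  have hσ : ∀ v y, g v (σ v y) = y := fun v => LinearMap.congr_fun (hσ v)
  have hρ : ∀ v y, ρ v (f v y) = y := fun v => LinearMap.congr_fun (hρ v)
  have hfρ : ∀ v x, g v x = 0 → f v (ρ v x) = x := by
    intro v x hx
    obtain ⟨y, rfl⟩ := (he v x).1 hx
    rw [hρ]
  have hgf : ∀ v y, g v (f v y) = 0 := fun v y => (he v _).2 ⟨y, rfl⟩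
  let z : ∀ i j : V, (i ⟶ j) → (N.obj j →ₗ[k] L.obj i) := fun i j a =>
    ρ i ∘ₗ (X.map a ∘ₗ σ j - σ i ∘ₗ N.map a)
  have hz : ∀ {i j : V} (a : i ⟶ j) y, f i (z i j a y) = X.map a (σ j y) - σ i (N.map a y) := by
    intro i j a y
    refine hfρ i _ ?_
    rw [LinearMap.sub_apply, map_sub, LinearMap.comp_apply, LinearMap.comp_apply, hg, hσ, hσ,
      sub_self]
  refine ⟨z, Iso.symm (IsHom.iso_of_bijective (f := fun v => LinearMap.coprod (f v) (σ v)) ?_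
    fun v => ⟨?_, ?_⟩), ?_⟩
  · rintro i j a ⟨x, y⟩
    rw [extn_map]
    change f i (L.map a x + z i j a y) + σ i (N.map a y) = X.map a (f j x + σ j y)
    rw [map_add, map_add, hz, hf]
    abel
  · refine (injective_iff_map_eq_zero (LinearMap.coprod (f v) (σ v))).2 ?_
    rintro ⟨x, y⟩ h0
    change f v x + σ v y = 0 at h0
    have hy : y = 0 := by
      have := congrArg (g v) h0
      rwa [map_add, map_zero, hσ, hgf, zero_add] at this
    rw [hy, map_zero, add_zero] at h0
    exact Prod.ext (hi v (h0.trans (map_zero _).symm)) hy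
  · intro x
    refine ⟨(ρ v (x - σ v (g v x)), g v x), ?_⟩
    change f v (ρ v (x - σ v (g v x))) + σ v (g v x) = x
    rw [hfρ, sub_add_cancel]
    rw [map_sub, hσ, sub_self]
  · rintro ⟨h, hh⟩
    refine ⟨fun v => σ v - f v ∘ₗ h v, fun i j a y => ?_, fun v y => ?_⟩
    · have h1 := hz a y
      rw [← hh, extDiff_apply, map_sub, hf] at h1
      rw [LinearMap.sub_apply, LinearMap.sub_apply, map_sub, LinearMap.comp_apply,
        LinearMap.comp_apply, sub_eq_sub_iff_sub_eq_sub, ← neg_inj, neg_sub, ← h1]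
      abel
    · rw [LinearMap.sub_apply, map_sub, hσ, LinearMap.comp_apply, hgf, sub_zero]

/-- The middle term does not change when the submodule is replaced by an isomorphic copy, the class
is scaled by a nonzero constant, or a coboundary is subtracted. -/
theorem iso_extn {N L L' : QRep k V} {φ : ∀ v, L.obj v →ₗ[k] L'.obj v} (hφ : IsHom L L' φ)
    (hb : ∀ v, Function.Bijective (φ v)) {c : k} (hc : c ≠ 0) (h : ∀ v, N.obj v →ₗ[k] L'.obj v)
    (z : ∀ i j : V, (i ⟶ j) → (N.obj j →ₗ[k] L.obj i)) :
    Iso (extn N L z) (extn N L' (c • cochainPush N φ z - extDiff N L' h)) := by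
  refine IsHom.iso_of_bijective
    (f := fun v => LinearMap.prod (LinearMap.coprod (c • φ v) (h v)) (LinearMap.snd k _ _)) ?_
    fun v => ⟨?_, ?_⟩
  · rintro i j a ⟨x, y⟩
    rw [extn_map]
    refine Prod.ext ?_ rfl
    change c • φ i (L.map a x + z i j a y) + h i (N.map a y) =
      L'.map a (c • φ j x + h j y) + (c • φ i (z i j a y) - (L'.map a (h j y) - h i (N.map a y)))
    rw [map_add, map_add, hφ, map_smul, smul_add]
    abel
  · refine (injective_iff_map_eq_zero (LinearMap.prod (LinearMap.coprod (c • φ v) (h v))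
      (LinearMap.snd k (L.obj v) (N.obj v)))).2 ?_
    rintro ⟨x, y⟩ h0
    obtain ⟨h1, h2⟩ := Prod.ext_iff.1 h0
    change c • φ v x + h v y = 0 at h1
    change y = 0 at h2
    rw [h2, map_zero, add_zero, smul_eq_zero_iff_right hc] at h1
    exact Prod.ext ((hb v).1 (h1.trans (map_zero _).symm)) h2
  · rintro ⟨x, y⟩
    obtain ⟨w, hw⟩ := (hb v).2 (c⁻¹ • (x - h v y))
    refine ⟨(w, y), Prod.ext ?_ rfl⟩
    change c • φ v w + h v y = x
    rw [hw, smul_inv_smul₀ hc, sub_add_cancel]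

/-- A morphism on the submodule that extends to the whole module kills the extension class. -/
theorem cochainPush_mem_range {N L Z : QRep k V}
    {z : ∀ i j : V, (i ⟶ j) → (N.obj j →ₗ[k] L.obj i)}
    {f : ∀ v, (extn N L z).obj v →ₗ[k] Z.obj v} (hf : IsHom (extn N L z) Z f) :
    cochainPush N (fun v => f v ∘ₗ extnInl N L z v) z ∈ LinearMap.range (extDiff N Z) := by
  refine ⟨fun v => f v ∘ₗ LinearMap.inr k (L.obj v) (N.obj v), ?_⟩
  funext i j a
  refine LinearMap.ext fun y => ?_
  rw [extDiff_apply]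
  change Z.map a (f j ((0, y) : L.obj j × N.obj j)) - f i ((0, N.map a y) : L.obj i × N.obj i) =
    f i ((z i j a y, 0) : L.obj i × N.obj i)
  have h := hf i j a ((0, y) : L.obj j × N.obj j)
  rw [extn_map, map_zero, zero_add] at h
  rw [← h]
  refine (map_sub (f i) _ _).symm.trans ?_
  exact congrArg (f i) (Prod.ext (sub_zero _) (sub_self _))

/-- A morphism out of an extension that vanishes on the submodule factors through the quotient. -/
theorem isHom_comp_inr {N L Z : QRep k V} {z : ∀ i j : V, (i ⟶ j) → (N.obj j →ₗ[k] L.obj i)}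
    {f : ∀ v, (extn N L z).obj v →ₗ[k] Z.obj v} (hf : IsHom (extn N L z) Z f)
    (hl : (fun v => f v ∘ₗ extnInl N L z v) = 0) :
    (∀ v x y, f v ((x, y) : L.obj v × N.obj v) = f v ((0, y) : L.obj v × N.obj v)) ∧
      IsHom N Z fun v => f v ∘ₗ LinearMap.inr k (L.obj v) (N.obj v) := by
  have hl : ∀ v x, f v ((x, 0) : L.obj v × N.obj v) = 0 := fun v x =>
    LinearMap.congr_fun (congr_fun hl v) x
  have hxy : ∀ v x y, f v ((x, y) : L.obj v × N.obj v) = f v ((0, y) : L.obj v × N.obj v) := by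
    intro v x y
    have e : ((x, y) : L.obj v × N.obj v) = (x, 0) + (0, y) := by simp
    rw [e]
    exact (map_add (f v) _ _).trans (by rw [hl, zero_add])
  refine ⟨hxy, fun i j a y => ?_⟩
  have h := hf i j a ((0, y) : L.obj j × N.obj j)
  rw [extn_map, hxy] at h
  exact h

theorem extn_hom_eq_zero [Finite V] {N L Z : QRep k V} (hN : N.IsFD) (hZ : Z.IsFD)
    {z : ∀ i j : V, (i ⟶ j) → (N.obj j →ₗ[k] L.obj i)} (h0 : hom N Z = 0)
    {f : ∀ v, (extn N L z).obj v →ₗ[k] Z.obj v} (hf : IsHom (extn N L z) Z f)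
    (hl : (fun v => f v ∘ₗ extnInl N L z v) = 0) : f = 0 := by
  obtain ⟨hxy, hr⟩ := isHom_comp_inr hf hl
  have hr := (hom_eq_zero_iff hN hZ).1 h0 _ hr
  refine funext fun v => LinearMap.ext fun x => ?_
  obtain ⟨x, y⟩ := x
  rw [hxy]
  exact LinearMap.congr_fun (congr_fun hr v) y

theorem hom_extn_left_eq [Finite V] {N L Z : QRep k V} (hN : N.IsFD) (hL : L.IsFD) (hZ : Z.IsFD)
    (z : ∀ i j : V, (i ⟶ j) → (N.obj j →ₗ[k] L.obj i)) (h0 : hom L Z = 0) :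
    hom (extn N L z) Z = hom N Z := by
  refine le_antisymm ?_ ?_
  · have := hom_extn_left_le (z := z) hZ hN hL
    omega
  · exact hom_le_of_surjective (isFD_extn hN hL) hZ (isHom_extnSnd (z := z)) extnSnd_surjective

end ExtensionClass

/-! ### Iterated nonsplit extensions in a tube. -/

section Tower

variable {k V : Type u} [Field k] [Quiver.{u} V] {r : ℕ}

/-- The iterated nonsplit extensions of `E i, E (i + 1), …, E (i + l - 1)`. -/
def Tower (E : ZMod r → QRep k V) (i : ZMod r) : ℕ → QRep k V → Prop
  | 0, X => X.IsZero
  | l + 1, X => ∃ (L : QRep k V) (z : ∀ v w : V, (v ⟶ w) → ((E (i + l)).obj w →ₗ[k] L.obj v)),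
      -- In the bottom layer `L` is zero and every cocycle is a coboundary, so nonsplitness is
      -- required only from the second layer on.
      Tower E i l L ∧ (l ≠ 0 → z ∉ LinearMap.range (extDiff (E (i + l)) L)) ∧
      Iso X (extn (E (i + l)) L z)

variable {E : ZMod r → QRep k V} {i : ZMod r}

theorem Tower.of_iso {l : ℕ} {X Y : QRep k V} (h : Tower E i l X) (e : Iso X Y) :
    Tower E i l Y := by
  cases l with
  | zero => exact e.isZero h
  | succ l =>
    obtain ⟨L, z, hL, hz, e'⟩ := h
    exact ⟨L, z, hL, hz, e.symm.trans e'⟩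

theorem Tower.isFD (hE : IsNonhomogeneousTube r E) {l : ℕ} : ∀ {X : QRep k V}, Tower E i l X →
    X.IsFD := by
  induction l with
  | zero => exact fun h => IsZero.isFD h
  | succ l ih =>
    rintro X ⟨L, z, hL, -, e⟩
    exact e.symm.isFD (isFD_extn (hE.isFD _) (ih hL))

variable [Finite k] [Fintype V] [∀ i j : V, Finite (i ⟶ j)]

omit [Finite k] in
theorem Tower.ext_right_eq_zero (hE : IsNonhomogeneousTube r E) {l : ℕ} {S : QRep k V}
    (hS : S.IsFD) : ∀ {X : QRep k V}, Tower E i l X → (∀ m < l, ext S (E (i + (m : ℕ))) = 0) →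
      ext S X = 0 := by
  induction l with
  | zero =>
    intro X h _
    have hX : X.IsFD := IsZero.isFD h
    have h1 := hom_sub_ext hS hX
    have h2 : X.dimZ = 0 := funext fun v => by
      have := h v
      exact congrArg Nat.cast Module.finrank_zero_of_subsingleton
    rw [hom_eq_zero_of_isZero_right hS h, h2, euler_zero_right] at h1
    omega
  | succ l ih =>
    rintro X ⟨L, z, hL, -, e⟩ h
    have hfd := isFD_extn (z := z) (hE.isFD _) (hL.isFD hE)
    rw [e.ext_right hS (e.symm.isFD hfd)]
    have h1 := ext_extn_right_le hS (hE.isFD _) (hL.isFD hE) z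
    rw [ih hL fun m hm => h m (by omega), h l (by omega)] at h1
    omega

omit [Finite k] [∀ i j : V, Finite (i ⟶ j)] in
theorem Tower.hom_right_eq_zero (hE : IsNonhomogeneousTube r E) {l : ℕ} {S : QRep k V}
    (hS : S.IsFD) : ∀ {X : QRep k V}, Tower E i l X → (∀ m < l, hom S (E (i + (m : ℕ))) = 0) →
      hom S X = 0 := by
  induction l with
  | zero => exact fun h _ => hom_eq_zero_of_isZero_right hS h
  | succ l ih =>
    rintro X ⟨L, z, hL, -, e⟩ h
    have hfd := isFD_extn (z := z) (hE.isFD _) (hL.isFD hE)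
    rw [e.hom_right hS (e.symm.isFD hfd)]
    have h1 := hom_extn_right_le (z := z) hS (hE.isFD _) (hL.isFD hE)
    rw [ih hL fun m hm => h m (by omega), h l (by omega)] at h1
    omega

/-- A nonzero morphism either stays nonzero on the submodule `L`, where induction applies, or
factors through the top layer, where the Schur lemma applies. -/
theorem Tower.surjective (hE : IsNonhomogeneousTube r E) (hQ : IsAcyclic V) {l : ℕ} {j : ZMod r} :
    ∀ {X : QRep k V}, Tower E i l X → ∀ {f : ∀ v, X.obj v →ₗ[k] (E j).obj v},
      IsHom X (E j) f → f ≠ 0 → ∀ v, Function.Surjective (f v) := by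
  induction l with
  | zero =>
    intro X h f _ h0
    refine absurd (funext fun v => LinearMap.ext fun x => ?_) h0
    have := h v
    rw [Subsingleton.elim x 0, map_zero, map_zero]
  | succ l ih =>
    rintro X ⟨L, z, hL, -, e⟩ f hf h0 v
    obtain ⟨g, hg, hb⟩ := e.symm.exists_isHom
    obtain ⟨G, hG, hGf⟩ : ∃ G, IsHom (extn (E (i + l)) L z) (E j) G ∧ ∀ v x, G v x = f v (g v x) :=
      ⟨_, hf.comp hg, fun _ _ => rfl⟩
    by_cases h1 : (fun v => G v ∘ₗ extnInl (E (i + l)) L z v) = 0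
    · obtain ⟨h2, h3⟩ := isHom_comp_inr hG h1
      by_cases h4 : (fun v => G v ∘ₗ LinearMap.inr k (L.obj v) ((E (i + l)).obj v)) = 0
      · refine absurd (funext fun v => LinearMap.ext fun x => ?_) h0
        obtain ⟨⟨x, y⟩, rfl⟩ := (hb v).2 x
        refine (hGf v _).symm.trans ((h2 v x y).trans ?_)
        exact LinearMap.congr_fun (congr_fun h4 v) y
      · intro y
        obtain ⟨x, hx⟩ := (hE.bijective hQ _ (hE.regularSimple j) h3 h4 v).2 y
        exact ⟨_, (hGf v _).symm.trans hx⟩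
    · intro y
      obtain ⟨x, hx⟩ := ih hL (hG.comp isHom_extnInl) h1 v y
      exact ⟨_, (hGf v _).symm.trans hx⟩

/-- Only the top layer is a quotient. By induction a further one could only come from the top `E j`
of `L`, with the map `L → E j` extending to `X`. Pushing forward along it is then an isomorphism
between the lines `Ext¹(E (j + 1), L)` and `Ext¹(E (j + 1), E j)`, yet it kills the class of `X`,
which contradicts nonsplitness. -/
theorem Tower.hom_eq (hE : IsNonhomogeneousTube r E) (hQ : IsAcyclic V) {l : ℕ} :
    ∀ {X : QRep k V}, Tower E i (l + 1) X → ∀ j, hom X (E j) = if j = i + l then 1 else 0 := by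
  induction l with
  | zero =>
    rintro X ⟨L, z, hL, -, e⟩ j
    have hfd := isFD_extn (z := z) (hE.isFD _) (hL.isFD hE)
    rw [e.hom_left (e.symm.isFD hfd) (hE.isFD j), hom_extn_left_eq (hE.isFD _) (hL.isFD hE)
      (hE.isFD j) z (hom_eq_zero_of_isZero_left hL (hE.isFD j))]
    split_ifs with h
    · rw [h, hE.hom_self hQ]
    · exact hE.hom_of_ne hQ (Ne.symm h)
  | succ l ih =>
    rintro X ⟨L, z, hL, hz, e⟩ j
    have hz := hz (Nat.succ_ne_zero l)
    have hLfd := hL.isFD hE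
    have hfd := isFD_extn (z := z) (hE.isFD _) hLfd
    rw [e.hom_left (e.symm.isFD hfd) (hE.isFD j)]
    have hll : i + ((l + 1 : ℕ) : ZMod r) = i + l + 1 := by
      rw [Nat.cast_add, Nat.cast_one, add_assoc]
    by_cases hj : j = i + l
    · have hne : i + ((l + 1 : ℕ) : ZMod r) ≠ j := by
        rw [hll, hj]
        exact hE.ne_add_one _
      rw [if_neg (Ne.symm hne), hom_eq_zero_iff hfd (hE.isFD j)]
      intro f hf
      refine extn_hom_eq_zero (hE.isFD _) (hE.isFD j) (hE.hom_of_ne hQ hne) hf ?_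
      by_contra h1
      refine hz ?_
      have hs := hL.surjective hE hQ (hf.comp isHom_extnInl) h1
      have hsur := extPush_surjective (C := E (i + ((l + 1 : ℕ) : ZMod r)))
        (hf.comp isHom_extnInl) hs
      have e1 : ext (E (i + ((l + 1 : ℕ) : ZMod r))) L = 1 := by
        rw [hll, ← hE.hom_right hQ _ hLfd, ih hL, if_pos rfl]
      have e2 : ext (E (i + ((l + 1 : ℕ) : ZMod r))) (E j) = 1 := by
        rw [hll, ← hj, ← hE.hom_right hQ _ (hE.isFD j), hE.hom_self hQ]
      have := (hE.isFD (i + ((l + 1 : ℕ) : ZMod r))).finite_ext hLfd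
      have := (hE.isFD (i + ((l + 1 : ℕ) : ZMod r))).finite_ext (hE.isFD j)
      have hinj := (LinearMap.injective_iff_surjective_of_finrank_eq_finrank
        (e1.trans e2.symm)).2 hsur
      have h2 := cochainPush_mem_range hf
      refine (Submodule.Quotient.mk_eq_zero _).1 (hinj ?_)
      rw [map_zero, extPush_mk]
      exact (Submodule.Quotient.mk_eq_zero _).2 h2
    · rw [hom_extn_left_eq (hE.isFD _) hLfd (hE.isFD j) z (by rw [ih hL, if_neg hj])]
      split_ifs with h
      · rw [h, hE.hom_self hQ]
      · exact hE.hom_of_ne hQ (Ne.symm h)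

theorem Tower.ext_eq_one (hE : IsNonhomogeneousTube r E) (hQ : IsAcyclic V) {l : ℕ}
    {L : QRep k V} (hL : Tower E i l L) (hl : l ≠ 0) : ext (E (i + l)) L = 1 := by
  obtain ⟨l, rfl⟩ := Nat.exists_eq_succ_of_ne_zero hl
  have hll : i + ((l + 1 : ℕ) : ZMod r) = i + l + 1 := by
    rw [Nat.cast_add, Nat.cast_one, add_assoc]
  rw [Nat.succ_eq_add_one, hll, ← hE.hom_right hQ _ (hL.isFD hE), hL.hom_eq hE hQ, if_pos rfl]

/-- The classes of both modules are nonzero in a one-dimensional extension group, so they agree up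
to a nonzero scalar and a coboundary. -/
theorem Tower.iso (hE : IsNonhomogeneousTube r E) (hQ : IsAcyclic V) {l : ℕ} :
    ∀ {X Y : QRep k V}, Tower E i l X → Tower E i l Y → Iso X Y := by
  induction l with
  | zero => exact fun h h' => IsZero.iso h h'
  | succ l ih =>
    rintro X Y ⟨L, z, hL, hz, e⟩ ⟨L', z', hL', hz', e'⟩
    refine (e.trans ?_).trans e'.symm
    obtain ⟨φ, hφ, hb⟩ := (ih hL hL').exists_isHom
    by_cases hl : l = 0
    · subst hl
      have : z' = (1 : k) • cochainPush _ φ z - extDiff _ L' 0 := by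
        funext a b c
        refine LinearMap.ext fun x => ?_
        have : Subsingleton (L'.obj a) := hL' a
        exact Subsingleton.elim _ _
      rw [this]
      exact iso_extn hφ hb one_ne_zero 0 z
    · have hne : (Submodule.Quotient.mk (cochainPush (E (i + l)) φ z) : Ext1 (E (i + l)) L') ≠ 0 := by
        intro h0
        refine hz hl ?_
        have hinj : Function.Injective (extPush (E (i + l)) hφ) := by
          have := (hE.isFD (i + l)).finite_ext (hL.isFD hE)
          have := (hE.isFD (i + l)).finite_ext (hL'.isFD hE)
          exact (LinearMap.injective_iff_surjective_of_finrank_eq_finrank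
            ((hL.ext_eq_one hE hQ hl).trans (hL'.ext_eq_one hE hQ hl).symm)).2
            (extPush_surjective hφ fun v => (hb v).2)
        refine (Submodule.Quotient.mk_eq_zero _).1 (hinj ?_)
        rw [map_zero, extPush_mk]
        exact h0
      obtain ⟨c, hc⟩ := exists_smul_eq_of_finrank_eq_one (hL'.ext_eq_one hE hQ hl) hne
        (Submodule.Quotient.mk z')
      have hc0 : c ≠ 0 := by
        rintro rfl
        rw [zero_smul] at hc
        exact hz' hl ((Submodule.Quotient.mk_eq_zero _).1 hc.symm)
      rw [← Submodule.Quotient.mk_smul, Submodule.Quotient.eq] at hc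
      obtain ⟨h, hh⟩ := hc
      have : z' = c • cochainPush _ φ z - extDiff _ L' h := by
        rw [hh, sub_sub_cancel]
      rw [this]
      exact iso_extn hφ hb hc0 h z

end Tower

/-! ### The modules E_i[l] as iterated nonsplit extensions. -/

section TubeModule

variable {k V : Type u} [Field k] [Finite k] [Quiver.{u} V] [Fintype V]
  [∀ i j : V, Finite (i ⟶ j)] {r : ℕ} {E : ZMod r → QRep k V} {i : ZMod r}

omit [Finite k] [Fintype V] [∀ i j : V, Finite (i ⟶ j)] in
theorem exists_exact_subquot {M : QRep k V} {U W : ∀ v, Submodule k (M.obj v)} (hU : M.IsSub U)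
    (hW : M.IsSub W) (hle : ∀ v, U v ≤ W v) :
    ∃ (f : ∀ v, (M.restrict U hU).obj v →ₗ[k] (M.restrict W hW).obj v)
      (g : ∀ v, (M.restrict W hW).obj v →ₗ[k] (M.subquot U W hU hW).obj v),
      IsHom _ _ f ∧ (∀ v, Function.Injective (f v)) ∧ IsHom _ _ g ∧
      (∀ v, Function.Surjective (g v)) ∧ (∀ v x, g v x = 0 ↔ ∃ y, f v y = x) ∧
      ∀ v (x : W v), g v x = 0 ↔ x.1 ∈ U v := by
  refine ⟨fun v => Submodule.inclusion (hle v), fun v => ((U v).comap (W v).subtype).mkQ,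
    fun _ _ _ _ => rfl, fun v => Submodule.inclusion_injective (hle v),
    isHom_mkQ (X := M.restrict W hW) fun i j a x hx => hU i j a hx,
    fun v => Submodule.mkQ_surjective ((U v).comap (W v).subtype), fun v x => ?_,
    fun v x => Submodule.Quotient.mk_eq_zero ((U v).comap (W v).subtype)⟩
  refine (Submodule.Quotient.mk_eq_zero ((U v).comap (W v).subtype)).trans
    ⟨fun h => ⟨⟨x.1, h⟩, rfl⟩, ?_⟩
  rintro ⟨y, rfl⟩
  exact y.2

/-- Uniqueness of the regular simple submodule makes every step of the chain nonsplit. Nonsplitness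
forces the new factor to be the inverse translate of the top of the preceding step, which fixes all
factors once the first is `E i`. -/
theorem tower_of_chain (hE : IsNonhomogeneousTube r E) (hQ : IsAcyclic V) {M : QRep k V}
    {l : ℕ} {F : ℕ → ∀ v, Submodule k (M.obj v)} (hF : ∀ j, M.IsSub (F j))
    (h0 : ∀ v, F 0 v = ⊥)
    (hs : ∀ j < l, (∀ v, F j v ≤ F (j + 1) v) ∧
      (M.subquot (F j) (F (j + 1)) (hF j) (hF (j + 1))).IsRegularSimple)
    (hq : M.HasQuasiSocle (E i)) : ∀ j ≤ l, Tower E i j (M.restrict (F j) (hF j)) := by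
  obtain ⟨U, hU, hUE, hW⟩ := hq
  have hiso : 0 < l → Iso (M.subquot (F 0) (F 1) (hF 0) (hF 1)) (M.restrict (F 1) (hF 1)) := by
    intro hl
    obtain ⟨f, g, -, -, hg, hgs, -, hgU⟩ := exists_exact_subquot (hF 0) (hF 1) (hs 0 hl).1
    refine Iso.symm (hg.iso_of_bijective fun v =>
      ⟨(injective_iff_map_eq_zero (g v)).2 fun x hx => ?_, hgs v⟩)
    have h1 := (hgU v x).1 hx
    rw [h0 v] at h1
    exact Subtype.ext h1
  have hF1 : 0 < l → F 1 = U := fun hl =>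
    (hW _ (hF 1)).1 (Iso.isRegularSimple hQ (hiso hl) (hs 0 hl).2)
  have hmono : ∀ j, 1 ≤ j → j ≤ l → ∀ v, F 1 v ≤ F j v := by
    intro j hj
    induction j, hj using Nat.le_induction with
    | base => exact fun _ _ => le_rfl
    | succ j hj ih => exact fun hjl v => (ih (by omega) v).trans ((hs j (by omega)).1 v)
  intro j
  induction j with
  | zero => exact fun _ => (hF 0).zero_iff_bot.2 h0
  | succ j ih =>
    intro hj
    have hjl : j < l := hj
    have hL := ih hjl.le
    obtain ⟨hle, hS⟩ := hs j hjl
    have hLfd := hL.isFD hE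
    have hSfd := hS.2.1.1
    obtain ⟨f, g, hf, hfi, hg, hgs, hex, hgU⟩ := exists_exact_subquot (hF j) (hF (j + 1)) hle
    -- The image of a section is regular simple, so it equals `U = F 1`; but this lies in `F j`,
    -- which is zero in the factor.
    have hnosec : j ≠ 0 → ¬ ∃ s, IsHom (M.subquot (F j) (F (j + 1)) (hF j) (hF (j + 1)))
        (M.restrict (F (j + 1)) (hF (j + 1))) s ∧ ∀ v y, g v (s v y) = y := by
      rintro hj0 ⟨s, hsh, hsr⟩
      have hcomp := (isHom_subtype (hF (j + 1))).comp hsh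
      have hi : ∀ v, Function.Injective (((F (j + 1) v).subtype) ∘ₗ s v) := fun v =>
        Subtype.val_injective.comp
          (Function.LeftInverse.injective (f := s v) (g := g v) (hsr v))
      have hWU := (hW _ hcomp.isSub_range).1
        (Iso.isRegularSimple hQ (hcomp.iso_restrict_range hi) hS)
      refine hS.1.1 fun v => subsingleton_of_forall_eq 0 fun y => ?_
      rw [← hsr v y]
      refine (hgU v (s v y)).2 ?_
      have h1 : (s v y : F (j + 1) v).1 ∈ U v := by
        rw [← hWU]
        exact ⟨y, rfl⟩
      rw [← hF1 (by omega)] at h1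
      exact hmono j (by omega) hjl.le v h1
    have hSE : Iso (M.subquot (F j) (F (j + 1)) (hF j) (hF (j + 1))) (E (i + j)) := by
      by_cases hj0 : j = 0
      · subst hj0
        have e1 : Iso (M.restrict (F 1) (hF 1)) (M.restrict U hU) := by
          have := hF1 (by omega)
          subst this
          exact Iso.refl _
        rw [Nat.cast_zero, add_zero]
        exact (hiso hjl).trans (e1.trans hUE)
      · obtain ⟨z, -, hz⟩ := exists_iso_extn_of_exact hf hfi hg hgs hex
        have hne : ext (M.subquot (F j) (F (j + 1)) (hF j) (hF (j + 1)))
            (M.restrict (F j) (hF j)) ≠ 0 := fun h =>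
          hnosec hj0 (hz ((ext_eq_zero_iff hSfd hLfd).1 h z))
        -- Some layer has a nonzero extension with the factor, which identifies the factor with `E
        -- (i + m + 1)`. Then `F j` maps nontrivially to `E (i + m)`, so by `Tower.hom_eq` that
        -- layer has the index of the top.
        obtain ⟨m, hm, hm'⟩ : ∃ m < j, ext (M.subquot (F j) (F (j + 1)) (hF j) (hF (j + 1)))
            (E (i + (m : ℕ))) ≠ 0 := by
          by_contra hcon
          push Not at hcon
          exact hne (hL.ext_right_eq_zero hE hSfd hcon)
        rw [hE.ext_right hQ _ hSfd] at hm'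
        have e1 := hE.iso_of_hom_ne_zero hQ _ hS hm'
        rw [← e1.ext_left (hE.isFD _) hLfd, ← hE.hom_right hQ _ hLfd] at hne
        obtain ⟨j, rfl⟩ := Nat.exists_eq_succ_of_ne_zero hj0
        rw [hL.hom_eq hE hQ] at hne
        have hmj : i + (m : ZMod r) = i + j := by
          by_contra hcon
          rw [if_neg hcon] at hne
          exact hne rfl
        rw [hmj] at e1
        rw [Nat.succ_eq_add_one, Nat.cast_add, Nat.cast_one, ← add_assoc]
        exact e1.symm
    obtain ⟨φ, hφ, hb⟩ := hSE.exists_isHom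
    obtain ⟨G, hG, hGg⟩ : ∃ G, IsHom (M.restrict (F (j + 1)) (hF (j + 1))) (E (i + j)) G ∧
        ∀ v x, G v x = φ v (g v x) := ⟨_, hφ.comp hg, fun _ _ => rfl⟩
    obtain ⟨z, hz, hz'⟩ := exists_iso_extn_of_exact hf hfi hG
      (fun v y => by
        obtain ⟨x, rfl⟩ := (hb v).2 y
        obtain ⟨x, rfl⟩ := hgs v x
        exact ⟨x, hGg v x⟩) fun v x => by
        rw [hGg, ← hex v x]
        exact map_eq_zero_iff (φ v) (hb v).1
    refine ⟨_, z, hL, fun hj0 hzr => hnosec hj0 ?_, hz⟩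
    obtain ⟨s, hsh, hsr⟩ := hz' hzr
    exact ⟨_, hsh.comp hφ, fun v y => (hb v).1 ((hGg v _).symm.trans (hsr v (φ v y)))⟩

theorem IsTubeModule.tower (hE : IsNonhomogeneousTube r E) (hQ : IsAcyclic V) {M : QRep k V}
    {l : ℕ} (h : IsTubeModule (E i) l M) : Tower E i l M := by
  unfold IsTubeModule at h
  split_ifs at h with hl
  · subst hl
    exact h
  · obtain ⟨-, -, hq, F, hF, h0, h1, hs⟩ := h
    refine (tower_of_chain hE hQ hF h0 hs hq l le_rfl).of_iso ?_
    refine (isHom_subtype (hF l)).iso_of_bijective fun v => ⟨Subtype.val_injective, fun x => ?_⟩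
    exact ⟨⟨x, by rw [h1 v]; trivial⟩, rfl⟩

end TubeModule

end QRep

/-! ### Subspaces of a product as graphs. -/

section GraphSub

variable {k L N : Type*} [Field k] [AddCommGroup L] [Module k L] [AddCommGroup N] [Module k N]

/-- The subspace of `L × N` given by subspaces `A` of `L` and `C` of `N` and the graph of a linear
map `C → L / A`. -/
def graphSub (A : Submodule k L) (C : Submodule k N) (h : C →ₗ[k] L ⧸ A) : Submodule k (L × N) where
  carrier := {x | ∃ y : C, (y : N) = x.2 ∧ A.mkQ x.1 = h y}
  add_mem' := by
    rintro x x' ⟨y, hy, hx⟩ ⟨y', hy', hx'⟩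
    refine ⟨y + y', congrArg₂ (· + ·) hy hy', ?_⟩
    rw [map_add, ← hx, ← hx', ← map_add]
    rfl
  zero_mem' := ⟨0, rfl, by rw [map_zero]; exact map_zero _⟩
  smul_mem' := by
    rintro c x ⟨y, hy, hx⟩
    refine ⟨c • y, congrArg (c • ·) hy, ?_⟩
    rw [map_smul, ← hx, ← map_smul]
    rfl

variable {A : Submodule k L} {C : Submodule k N}

theorem graphSub_comap_inl (h : C →ₗ[k] L ⧸ A) :
    (graphSub A C h).comap (LinearMap.inl k L N) = A := by
  ext x
  refine ⟨?_, fun hx => ⟨0, rfl, ?_⟩⟩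
  · rintro ⟨y, hy, hx⟩
    have : y = 0 := Subtype.ext hy
    rw [this, map_zero] at hx
    exact (Submodule.Quotient.mk_eq_zero A).1 hx
  · rw [map_zero]
    exact (Submodule.Quotient.mk_eq_zero A).2 hx

theorem graphSub_map_snd (h : C →ₗ[k] L ⧸ A) :
    (graphSub A C h).map (LinearMap.snd k L N) = C := by
  ext y
  refine ⟨?_, fun hy => ?_⟩
  · rintro ⟨x, ⟨y, hy, -⟩, rfl⟩
    rw [LinearMap.snd_apply, ← hy]
    exact y.2
  · obtain ⟨x, hx⟩ := A.mkQ_surjective (h ⟨y, hy⟩)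
    exact ⟨(x, y), ⟨⟨y, hy⟩, rfl, hx⟩, rfl⟩

theorem graphSub_injective : Function.Injective (graphSub A C) := by
  intro h h' e
  refine LinearMap.ext fun y => ?_
  obtain ⟨x, hx⟩ := A.mkQ_surjective (h y)
  have h1 : ((x, (y : N)) : L × N) ∈ graphSub A C h := ⟨y, rfl, hx⟩
  rw [e] at h1
  obtain ⟨y', hy, hx'⟩ := h1
  rw [← hx, ← Subtype.ext hy]
  exact hx'

/-- The map sends `y` to the first coordinate of any element of `W` over `y`; two choices differ by
an element of the intersection with `L`. -/
theorem exists_graphSub (W : Submodule k (L × N)) :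
    ∃ h, graphSub (W.comap (LinearMap.inl k L N)) (W.map (LinearMap.snd k L N)) h = W := by
  let p : W →ₗ[k] W.map (LinearMap.snd k L N) :=
    (LinearMap.snd k L N).restrict fun x hx => ⟨x, hx, rfl⟩
  have hp : Function.Surjective p := by
    rintro ⟨_, x, hx, rfl⟩
    exact ⟨⟨x, hx⟩, rfl⟩
  obtain ⟨s, hs⟩ := p.exists_rightInverse_of_surjective (LinearMap.range_eq_top.2 hp)
  have hs : ∀ y, (s y).1.2 = y.1 := fun y => congrArg Subtype.val (LinearMap.congr_fun hs y)
  refine ⟨Submodule.mkQ _ ∘ₗ LinearMap.fst k L N ∘ₗ W.subtype ∘ₗ s, ?_⟩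
  have key : ∀ (x : L) (y : W.map (LinearMap.snd k L N)),
      (W.comap (LinearMap.inl k L N)).mkQ x = (W.comap (LinearMap.inl k L N)).mkQ (s y).1.1 ↔
        (x, (y : N)) ∈ W := by
    intro x y
    refine (Submodule.Quotient.eq _).trans ?_
    have e : ((x, (y : N)) : L × N) = LinearMap.inl k L N (x - (s y).1.1) + (s y).1 :=
      Prod.ext (sub_add_cancel _ _).symm ((zero_add _).trans (hs y)).symm
    rw [e, Submodule.add_mem_iff_left _ (s y).2]
    rfl
  ext ⟨x, y⟩
  refine ⟨?_, fun h => ⟨⟨y, (x, y), h, rfl⟩, rfl, (key x ⟨y, (x, y), h, rfl⟩).2 h⟩⟩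
  rintro ⟨y, rfl, h⟩
  exact (key x y).1 h

theorem finrank_eq_comap_add_map [FiniteDimensional k L] [FiniteDimensional k N]
    (W : Submodule k (L × N)) : Module.finrank k W =
      Module.finrank k (W.comap (LinearMap.inl k L N)) +
        Module.finrank k (W.map (LinearMap.snd k L N)) := by
  rw [← LinearMap.finrank_range_add_finrank_ker ((LinearMap.snd k L N).domRestrict W), add_comm,
    LinearMap.range_domRestrict]
  congr 1
  refine LinearEquiv.finrank_eq (LinearEquiv.symm (LinearEquiv.ofBijective
    ((LinearMap.inl k L N).restrict (p := W.comap (LinearMap.inl k L N)) (q := W)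
      (fun x hx => hx) |>.codRestrict _ fun x => ?_) ⟨?_, ?_⟩))
  · exact LinearMap.mem_ker.2 rfl
  · intro x y h
    have h1 := congrArg (fun w : LinearMap.ker ((LinearMap.snd k L N).domRestrict W) => w.1.1.1) h
    exact Subtype.ext h1
  · rintro ⟨⟨⟨x, y⟩, hW⟩, h⟩
    have hy : y = 0 := LinearMap.mem_ker.1 h
    subst hy
    exact ⟨⟨x, hW⟩, rfl⟩

end GraphSub

namespace QRep

/-! ### Submodules of an extension. -/

section Submodules

variable {k V : Type u} [Field k] [Quiver.{u} V]

theorem IsSub.comap {X Y : QRep k V} {f : ∀ v, X.obj v →ₗ[k] Y.obj v} (hf : IsHom X Y f)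
    {U : ∀ v, Submodule k (Y.obj v)} (hU : Y.IsSub U) : X.IsSub fun v => (U v).comap (f v) := by
  intro i j a x hx
  change f i (X.map a x) ∈ U i
  rw [hf]
  exact hU i j a hx

theorem IsSub.map {X Y : QRep k V} {f : ∀ v, X.obj v →ₗ[k] Y.obj v} (hf : IsHom X Y f)
    {U : ∀ v, Submodule k (X.obj v)} (hU : X.IsSub U) : Y.IsSub fun v => (U v).map (f v) := by
  rintro i j a _ ⟨x, hx, rfl⟩
  exact ⟨X.map a x, hU i j a hx, hf i j a x⟩

/-- The extension class induced on subquotients. -/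
def cochainRes {N L : QRep k V} (z : ∀ i j : V, (i ⟶ j) → (N.obj j →ₗ[k] L.obj i))
    {A : ∀ v, Submodule k (L.obj v)} (hA : L.IsSub A) {C : ∀ v, Submodule k (N.obj v)}
    (hC : N.IsSub C) :
    ∀ i j : V, (i ⟶ j) → ((N.restrict C hC).obj j →ₗ[k] (L.quot A hA).obj i) :=
  cochainPush (Y' := L.quot A hA) (N.restrict C hC) (fun v => (A v).mkQ)
    (cochainPull (C' := N.restrict C hC) L (fun v => (C v).subtype) z)

/-- Stability under the arrows says that the graph map trivialises, up to sign, the cocycle induced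
on `C` and `L / A`. -/
theorem isSub_graphSub_iff {N L : QRep k V} (z : ∀ i j : V, (i ⟶ j) → (N.obj j →ₗ[k] L.obj i))
    {A : ∀ v, Submodule k (L.obj v)} (hA : L.IsSub A) {C : ∀ v, Submodule k (N.obj v)}
    (hC : N.IsSub C) (h : ∀ v, (N.restrict C hC).obj v →ₗ[k] (L.quot A hA).obj v) :
    (extn N L z).IsSub (fun v => graphSub (A v) (C v) (h v)) ↔
      extDiff (N.restrict C hC) (L.quot A hA) h = -cochainRes z hA hC := by
  have key : ∀ {i j : V} (a : i ⟶ j) (x : L.obj j) (y : C j), (A j).mkQ x = h j y →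
      ((((L.map a x + z i j a y, N.map a y) : L.obj i × N.obj i) ∈
        graphSub (A i) (C i) (h i)) ↔ (L.quot A hA).map a (h j y) - h i ((N.restrict C hC).map a y)
          = -(A i).mkQ (z i j a y)) := by
    intro i j a x y hx
    have e1 : (L.quot A hA).map a (h j y) = (A i).mkQ (L.map a x) := by
      rw [← hx]
      rfl
    have e3 : ∀ {G : Type u} [AddCommGroup G] (p q w : G), p + w = q ↔ p - q = -w :=
      fun p q w => by rw [sub_eq_iff_eq_add, neg_add_eq_sub, eq_sub_iff_add_eq]
    rw [e1]
    refine Iff.trans ?_ (e3 _ _ _)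
    have e2 : (A i).mkQ (L.map a x + z i j a y) = (A i).mkQ (L.map a x) + (A i).mkQ (z i j a y) :=
      map_add _ _ _
    refine ⟨?_, fun hh => ⟨⟨N.map a y, hC i j a y.2⟩, rfl, e2.trans hh⟩⟩
    rintro ⟨y', hy', hh⟩
    have : y' = (⟨N.map a y, hC i j a y.2⟩ : C i) := Subtype.ext hy'
    rw [this] at hh
    exact e2.symm.trans hh
  constructor
  · intro hW
    funext i j a
    refine LinearMap.ext fun y => ?_
    obtain ⟨x, hx⟩ := (A j).mkQ_surjective (h j y)
    exact (key a x y hx).1 (hW i j a (show ((x, (y : C j).1) : L.obj j × N.obj j) ∈ _ from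
      ⟨y, rfl, hx⟩))
  · rintro hh i j a ⟨x, y⟩ ⟨y, rfl, hx⟩
    exact (key a x y hx).2 (LinearMap.congr_fun (congr_fun (congr_fun (congr_fun hh i) j) a) y)

/-- The submodules of an extension with prescribed intersection with the submodule and prescribed
image in the quotient. -/
theorem card_isSub_extn {N L : QRep k V} (z : ∀ i j : V, (i ⟶ j) → (N.obj j →ₗ[k] L.obj i))
    {A : ∀ v, Submodule k (L.obj v)} (hA : L.IsSub A) {C : ∀ v, Submodule k (N.obj v)}
    (hC : N.IsSub C) :
    Nat.card {W // (extn N L z).IsSub W ∧ (fun v => (W v).comap (extnInl N L z v)) = A ∧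
        (fun v => (W v).map (extnSnd N L z v)) = C} =
      Nat.card {h // extDiff (N.restrict C hC) (L.quot A hA) h = -cochainRes z hA hC} := by
  refine (Nat.card_congr (Equiv.ofBijective (fun h => ⟨fun v => graphSub (A v) (C v) (h.1 v),
    (isSub_graphSub_iff z hA hC h.1).2 h.2, funext fun v => graphSub_comap_inl _,
    funext fun v => graphSub_map_snd _⟩) ⟨?_, ?_⟩)).symm
  · intro h h' e
    exact Subtype.ext (funext fun v => graphSub_injective (congr_fun (congrArg Subtype.val e) v))
  · rintro ⟨W, hW, rfl, rfl⟩
    choose h hh using fun v => exists_graphSub (k := k) (L := L.obj v) (N := N.obj v) (W v)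
    have hh' : (fun v => graphSub _ _ (h v)) = W := funext hh
    refine ⟨⟨h, (isSub_graphSub_iff z hA hC h).1 ?_⟩, Subtype.ext hh'⟩
    have hW' := hW
    rw [← hh'] at hW'
    exact hW'

end Submodules

/-! ### Counting the submodules over a given pair. -/

section Counting

variable {k V : Type u} [Field k] [Finite k] [Quiver.{u} V] [Fintype V]
  [∀ i j : V, Finite (i ⟶ j)]

theorem card_linear_fiber {X Y : QRep k V} (hX : X.IsFD) (hY : Y.IsFD)
    {w : ∀ i j : V, (i ⟶ j) → (X.obj j →ₗ[k] Y.obj i)}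
    (hw : w ∈ LinearMap.range (extDiff X Y)) :
    Nat.card {h // extDiff X Y h = w} = Nat.card k ^ hom X Y := by
  obtain ⟨h0, rfl⟩ := hw
  have := hX.finite_hom hY
  rw [hom, ← Module.natCard_eq_pow_finrank (K := k)]
  refine Nat.card_congr
    { toFun := fun h => ⟨h.1 - h0, by rw [LinearMap.mem_ker, map_sub, h.2, sub_self]⟩
      invFun := fun h => ⟨h.1 + h0, by rw [map_add, LinearMap.mem_ker.1 h.2, zero_add]⟩
      left_inv := fun h => Subtype.ext (sub_add_cancel _ _)
      right_inv := fun h => Subtype.ext (add_sub_cancel_right _ _) }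

omit [Finite k] in
-- Both `Ext¹(N, L) → Ext¹(C, L)` and `Ext¹(C, L) → Ext¹(C, L / A)` are onto, and the class of `z`
-- spans the first group; its image spans the last one, so it is zero only if that group is.
theorem cochainRes_notMem_range {N L : QRep k V} (hN : N.IsFD) (hL : L.IsFD)
    {z : ∀ i j : V, (i ⟶ j) → (N.obj j →ₗ[k] L.obj i)} (h1 : ext N L = 1)
    (hz : z ∉ LinearMap.range (extDiff N L)) {A : ∀ v, Submodule k (L.obj v)} (hA : L.IsSub A)
    {C : ∀ v, Submodule k (N.obj v)} (hC : N.IsSub C)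
    (h0 : ext (N.restrict C hC) (L.quot A hA) ≠ 0) :
    -cochainRes z hA hC ∉ LinearMap.range (extDiff (N.restrict C hC) (L.quot A hA)) := by
  intro hr
  rw [neg_mem_iff] at hr
  refine h0 ((ext_eq_zero_iff (isFD_restrict hN hC) (isFD_quot hL hA)).2 fun w => ?_)
  obtain ⟨x, hx⟩ := extPush_surjective (C := N.restrict C hC) (isHom_mkQ hA)
    (fun v => (A v).mkQ_surjective) (Submodule.Quotient.mk w)
  obtain ⟨y, rfl⟩ := extPull_surjective (Y := L) (isHom_subtype hC) (fun v => Subtype.val_injective) x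
  obtain ⟨c, rfl⟩ := exists_smul_eq_of_finrank_eq_one h1
    (mt (Submodule.Quotient.mk_eq_zero _).1 hz) y
  rw [map_smul, map_smul] at hx
  refine (Submodule.Quotient.mk_eq_zero _).1 (hx.symm.trans ?_)
  have : extPush (N.restrict C hC) (isHom_mkQ hA) (extPull L (isHom_subtype hC)
      (Submodule.Quotient.mk z)) = 0 := (Submodule.Quotient.mk_eq_zero _).2 hr
  rw [this, smul_zero]

end Counting

/-! ### The forms Λ and ⟨ , ⟩ on the exponents. -/

section Forms

variable {V : Type u} [Fintype V] [DecidableEq V] [Quiver.{u} V]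

theorem sum_mul_euler_left (c x : V → ℤ) :
    ∑ v, c v * euler (Pi.single v 1) x = euler c x := by
  conv_rhs => rw [eq_sum_single c, euler_sum_left]
  exact Finset.sum_congr rfl fun v _ => (euler_smul_left _ _ _).symm

theorem sum_mul_euler_right (c x : V → ℤ) :
    ∑ v, c v * euler x (Pi.single v 1) = euler x c := by
  simp only [euler_single_right]
  simp only [euler, mul_sub, Finset.sum_sub_distrib, Finset.mul_sum]
  congr 1
  · exact Finset.sum_congr rfl fun _ _ => mul_comm _ _
  · rw [Finset.sum_comm]
    exact Finset.sum_congr rfl fun _ _ => Finset.sum_congr rfl fun _ _ => by ring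

/-- The vector `(Ĩ - R̃) m`. -/
def gZ (m : V → ℤ) : V ⊕ V → ℤ := (matIt V - matRt V).mulVec m

theorem gZ_add (m n : V → ℤ) : gZ (m + n) = gZ m + gZ n := Matrix.mulVec_add _ _ _

theorem gZ_inl (m : V → ℤ) (v : V) : gZ m (Sum.inl v) = euler (Pi.single v 1) m := by
  rw [euler_single_left, gZ, Matrix.sub_mulVec, Pi.sub_apply]
  congr 1
  · simp [matIt, Matrix.mulVec, dotProduct]
  · exact Finset.sum_congr rfl fun u _ => mul_comm _ _

theorem gZ_inr (m : V → ℤ) (v : V) : gZ m (Sum.inr v) = 0 := by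
  rw [gZ, Matrix.sub_mulVec, Pi.sub_apply]
  have h : ∀ u : V, numArrows (Sum.inl u : V ⊕ V) (Sum.inr v) = 0 := fun u =>
    @Nat.card_of_isEmpty _ (inferInstanceAs (IsEmpty PEmpty))
  simp [matIt, matRt, Matrix.mulVec, dotProduct, h]

theorem matBt_mulVec_inl (m : V → ℤ) (v : V) :
    (matBt V).mulVec m (Sum.inl v) = euler (Pi.single v 1) m - euler m (Pi.single v 1) := by
  rw [euler_single_left, euler_single_right, sub_sub_sub_cancel_left, ← Finset.sum_sub_distrib]
  refine Finset.sum_congr rfl fun u _ => ?_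
  change ((numArrows v u : ℤ) - numArrows u v) * m u = _
  ring

theorem matBt_mulVec_inr (m : V → ℤ) (v : V) : (matBt V).mulVec m (Sum.inr v) = m v := by
  have h : ∀ u : V, numArrows (Sum.inl u : V ⊕ V) (Sum.inr v) = 0 := fun u =>
    @Nat.card_of_isEmpty _ (inferInstanceAs (IsEmpty PEmpty))
  have h' : ∀ u : V, numArrows (Sum.inr v : V ⊕ V) (Sum.inl u) = if v = u then 1 else 0 := by
    intro u
    have : numArrows (Sum.inr v : V ⊕ V) (Sum.inl u) = Nat.card (PLift (v = u)) :=
      Nat.card_congr Equiv.ulift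
    rw [this]
    split_ifs with e
    · exact @Nat.card_unique _ ⟨⟨e⟩⟩ _
    · exact @Nat.card_of_isEmpty _ ⟨fun x => e x.down⟩
  simp [matBt, Matrix.mulVec, dotProduct, h, h']

variable {Λ : Matrix (V ⊕ V) (V ⊕ V) ℤ}

theorem form_add_left (e e' f : V ⊕ V → ℤ) : form Λ (e + e') f = form Λ e f + form Λ e' f :=
  add_dotProduct _ _ _

theorem form_neg_left (e f : V ⊕ V → ℤ) : form Λ (-e) f = -form Λ e f := neg_dotProduct _ _

theorem form_add_right (e f f' : V ⊕ V → ℤ) : form Λ e (f + f') = form Λ e f + form Λ e f' := by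
  simp only [form, Matrix.mulVec_add, dotProduct_add]

theorem form_neg_right (e f : V ⊕ V → ℤ) : form Λ e (-f) = -form Λ e f := by
  simp only [form, Matrix.mulVec_neg, dotProduct_neg]

theorem form_skew (hskew : Λ.transpose = -Λ) (e f : V ⊕ V → ℤ) : form Λ e f = -form Λ f e := by
  rw [form, Matrix.dotProduct_mulVec, ← Matrix.mulVec_transpose, hskew, Matrix.neg_mulVec,
    neg_dotProduct, dotProduct_comm]
  rfl

theorem form_matBt_right (hcompat : Λ * (-matBt V) = matIt V) (e : V ⊕ V → ℤ) (m : V → ℤ) :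
    form Λ e ((matBt V).mulVec m) = -∑ v, e (Sum.inl v) * m v := by
  have h : Λ.mulVec ((matBt V).mulVec m) = -(matIt V).mulVec m := by
    rw [← hcompat, Matrix.mulVec_mulVec, Matrix.mul_neg, Matrix.neg_mulVec, neg_neg]
  rw [form, h, dotProduct_neg]
  simp [dotProduct, matIt, Matrix.mulVec]

/-- The commutation exponent of the monomials in the products of quantum cluster characters. -/
theorem form_monomials (hskew : Λ.transpose = -Λ) (hcompat : Λ * (-matBt V) = matIt V)
    (a l c n : V → ℤ) :
    form Λ ((matBt V).mulVec a - gZ l) ((matBt V).mulVec c - gZ n) =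
      form Λ (gZ l) (gZ n) - euler a (n - c) + euler c (l - a) := by
  -- Compatibility turns `Λ` against a vector of the form `B̃ m` into minus the dot product of `m`
  -- with the principal coordinates, and those coordinates are Euler pairings with unit vectors.
  have h1 : form Λ ((matBt V).mulVec a) ((matBt V).mulVec c) = euler a c - euler c a := by
    rw [form_matBt_right hcompat, ← sum_mul_euler_left c a, ← sum_mul_euler_right c a,
      ← Finset.sum_sub_distrib, ← Finset.sum_neg_distrib]
    refine Finset.sum_congr rfl fun v _ => ?_
    rw [matBt_mulVec_inl]
    ring
  have h2 : ∀ m x : V → ℤ, form Λ (gZ m) ((matBt V).mulVec x) = -euler x m := fun m x => by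
    rw [form_matBt_right hcompat, ← sum_mul_euler_left x m]
    congr 1
    exact Finset.sum_congr rfl fun v _ => by rw [gZ_inl, mul_comm]
  rw [sub_eq_add_neg, sub_eq_add_neg, form_add_left, form_add_right, form_add_right, form_neg_left,
    form_neg_left, form_neg_right, form_neg_right, h1, h2, form_skew hskew _ (gZ n), h2,
    euler_sub_right, euler_sub_right]
  ring

end Forms

/-! ### The socle of the frozen injective module. -/

section Socle

variable {k V : Type u} [Field k] [Fintype V] [DecidableEq V] [Quiver.{u} V]

/-- Every path from a frozen to a principal vertex has a last arrow, and an element killed by that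
arrow has coefficient zero at the path. -/
theorem socDim_frozenInj_inl (m : V → ℕ) (v : V) :
    (frozenInj k m).socDim (Sum.inl v) = 0 := by
  have h : (⨅ (w : V ⊕ V) (a : w ⟶ Sum.inl v), LinearMap.ker ((frozenInj k m).map a) :
      Submodule k ((frozenInj k m).obj (Sum.inl v))) = ⊥ := by
    rw [Submodule.eq_bot_iff]
    intro x hx
    simp only [Submodule.mem_iInf] at hx
    funext j c p
    cases p with
    | cons p a => exact congr_fun (congr_fun (congr_fun (hx _ a) j) c) p
  rw [socDim, h]
  exact finrank_bot _ _

/-- No arrow ends at a frozen vertex, so only trivial paths do. -/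
theorem finrank_frozenInj_inr (m : V → ℕ) (v : V) :
    Module.finrank k ((frozenInj k m).obj (Sum.inr v)) = m v := by
  have hp : ∀ j (p : Quiver.Path (Sum.inr j : V ⊕ V) (Sum.inr v)), j = v := by
    intro j p
    cases p with
    | nil => rfl
    | @cons w _ p a => cases w <;> exact PEmpty.elim a
  have hu : ∀ p : Quiver.Path (Sum.inr v : V ⊕ V) (Sum.inr v), p = Quiver.Path.nil := by
    intro p
    cases p with
    | nil => rfl
    | @cons w _ p a => cases w <;> exact PEmpty.elim a
  let e : (frozenInj k m).obj (Sum.inr v) ≃ₗ[k] (Fin (m v) → k) :=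
    { toFun := fun x c => x v c Quiver.Path.nil
      map_add' := fun _ _ => rfl
      map_smul' := fun _ _ => rfl
      invFun := fun y j c p => y (Fin.cast (congrArg m (hp j p)) c)
      left_inv := fun x => by
        funext j c p
        obtain rfl := hp j p
        rw [hu p]
        rfl
      right_inv := fun y => rfl }
  rw [e.finrank_eq, Module.finrank_fintype_fun_eq_card, Fintype.card_fin]

theorem socDim_frozenInj_inr (m : V → ℕ) (v : V) :
    (frozenInj k m).socDim (Sum.inr v) = m v := by
  have h : (⨅ (w : V ⊕ V) (a : w ⟶ Sum.inr v), LinearMap.ker ((frozenInj k m).map a) :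
      Submodule k ((frozenInj k m).obj (Sum.inr v))) = ⊤ := by
    refine eq_top_iff.2 (le_iInf fun w => le_iInf fun a => ?_)
    cases w <;> exact PEmpty.elim a
  rw [socDim, h]
  exact (finrank_top _ _).trans (finrank_frozenInj_inr m v)

/-- The monomial of an extra term in the multiplication formula. -/
theorem matBt_mulVec_sub_gZ {n l l' t : V → ℤ} (m : V → ℕ) (hm : ∀ v, (m v : ℤ) = n v)
    (hl : l = l' + t) (ht : ∀ x, euler x t = -euler n x) :
    (matBt V).mulVec n - gZ l - gZ n =
      -gZ l' + fun v => ((frozenInj k m).socDim v : ℤ) := by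
  funext v
  rw [hl, gZ_add]
  cases v with
  | inl v =>
    simp only [Pi.sub_apply, Pi.add_apply, Pi.neg_apply, matBt_mulVec_inl, gZ_inl,
      socDim_frozenInj_inl, ht]
    push_cast
    ring
  | inr v =>
    simp only [Pi.sub_apply, Pi.add_apply, Pi.neg_apply, matBt_mulVec_inr, gZ_inr,
      socDim_frozenInj_inr, hm]
    ring

end Socle

/-! ### Characters as sums over submodules. -/

section Characters

variable {k V : Type u} [Field k] [Finite k] [Fintype V] [DecidableEq V] [Quiver.{u} V]

/-- The submodules of a module over a finite field. -/
def IsFD.subs {X : QRep k V} (hX : X.IsFD) : Finset (∀ v, Submodule k (X.obj v)) :=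
  have := hX.finite_submodules
  (Set.toFinite {U | X.IsSub U}).toFinset

omit [DecidableEq V] in
theorem IsFD.mem_subs {X : QRep k V} (hX : X.IsFD) {U : ∀ v, Submodule k (X.obj v)} :
    U ∈ hX.subs ↔ X.IsSub U := by
  have := hX.finite_submodules
  exact Set.Finite.mem_toFinset _

/-- The dimension vector of a family of subspaces. -/
def subDim {X : QRep k V} (U : ∀ v, Submodule k (X.obj v)) : V → ℤ := fun v =>
  (Module.finrank k (U v) : ℤ)

/-- The term of a submodule of dimension vector `e` in the character of a module of dimension
vector `m`. -/
def ccTerm (Λ : Matrix (V ⊕ V) (V ⊕ V) ℤ) (m : V → ℤ) (c : V ⊕ V → ℤ) (e : V → ℤ) : Torus k Λ :=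
  (sqrtCard k ^ (-euler e (m - e))) • QuantumTorus.X ((matBt V).mulVec e - gZ m + c)

theorem ccSum_eq (Λ : Matrix (V ⊕ V) (V ⊕ V) ℤ) {M : QRep k V} (hM : M.IsFD) (c : V ⊕ V → ℤ) :
    ccSum Λ M c = ∑ U ∈ hM.subs, ccTerm Λ M.dimZ c (subDim U) := by
  classical
  have := hM.finite_submodules
  have hmaps : ∀ U ∈ hM.subs, (fun v => Module.finrank k (U v)) ∈ Finset.Iic M.dimVec := by
    intro U _
    refine Finset.mem_Iic.2 fun v => ?_
    have := hM v
    exact (U v).finrank_le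
  rw [← Finset.sum_fiberwise_of_maps_to hmaps, ccSum]
  refine Finset.sum_congr rfl fun e _ => ?_
  have h1 : ∀ U ∈ hM.subs.filter (fun U => (fun v => Module.finrank k (U v)) = e),
      ccTerm (k := k) Λ M.dimZ c (subDim U) = ccTerm Λ M.dimZ c fun v => (e v : ℤ) := by
    intro U hU
    rw [← (Finset.mem_filter.1 hU).2]
    rfl
  rw [Finset.sum_congr rfl h1, Finset.sum_const]
  have h2 : (M.Gr e).ncard =
      (hM.subs.filter (fun U => (fun v => Module.finrank k (U v)) = e)).card := by
    rw [← Set.ncard_coe_finset]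
    congr 1
    ext U
    simp only [Finset.coe_filter, Set.mem_ofPred_eq, hM.mem_subs, Gr, funext_iff]
  rw [h2, mul_smul, Nat.cast_smul_eq_nsmul]
  rfl

omit [Fintype V] [DecidableEq V] [Finite k] in
theorem Iso.ncard_Gr_le [Finite k] [Fintype V] {X Y : QRep k V} (h : Iso X Y) (hY : Y.IsFD)
    (e : V → ℕ) : (X.Gr e).ncard ≤ (Y.Gr e).ncard := by
  obtain ⟨f, hf⟩ := h
  have := hY.finite_submodules
  refine Set.ncard_le_ncard_of_injOn (fun U v => (U v).map (f v).toLinearMap) ?_ ?_ (Set.toFinite _)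
  · rintro U ⟨hU, hd⟩
    refine ⟨hU.map (f := fun v => (f v).toLinearMap) hf, fun v => ?_⟩
    rw [← hd v]
    exact LinearEquiv.finrank_map_eq (f v) (U v)
  · intro U _ W _ hUW
    exact funext fun v => Submodule.map_injective_of_injective (f v).injective (congr_fun hUW v)

theorem Iso.ccSum_eq {X Y : QRep k V} (h : Iso X Y) (hX : X.IsFD)
    (Λ : Matrix (V ⊕ V) (V ⊕ V) ℤ) (c : V ⊕ V → ℤ) : ccSum Λ X c = ccSum Λ Y c := by
  have h1 : ∀ e, (X.Gr e).ncard = (Y.Gr e).ncard := fun e =>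
    le_antisymm (h.ncard_Gr_le (h.isFD hX) e) (h.symm.ncard_Gr_le hX e)
  simp only [ccSum, h.dimVec_eq, h1]

theorem card_pow_smul (Λ : Matrix (V ⊕ V) (V ⊕ V) ℤ) (h : ℕ) (x : Torus k Λ) :
    (Nat.card k ^ h) • x = (sqrtCard k ^ (2 * (h : ℤ))) • x := by
  have h1 : ((sqrtCard k ^ 2 : (halfRing k)ˣ) : halfRing k) = (Nat.card k : halfRing k) := by
    refine Subtype.ext ?_
    exact Real.sq_sqrt (Nat.cast_nonneg _)
  have h2 : ((sqrtCard k ^ (2 * (h : ℤ)) : (halfRing k)ˣ) : halfRing k) =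
      ((Nat.card k ^ h : ℕ) : halfRing k) := by
    rw [Nat.cast_pow, ← h1, zpow_mul, zpow_natCast]
    rfl
  rw [Units.smul_def, h2, Nat.cast_smul_eq_nsmul]

/-- The term `2 * euler c (l - a)` is a factor q^⟨c, l - a⟩: the number of submodules over the pair
when the extension group vanishes. -/
theorem ccTerm_mul {Λ : Matrix (V ⊕ V) (V ⊕ V) ℤ} (hskew : Λ.transpose = -Λ)
    (hcompat : Λ * (-matBt V) = matIt V) (a l c n : V → ℤ) :
    (ccTerm Λ l 0 a * ccTerm Λ n 0 c : Torus k Λ) =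
      (sqrtCard k ^ (form Λ (gZ l) (gZ n) + 2 * euler c (l - a))) •
        ccTerm Λ (l + n) 0 (a + c) := by
  have e1 : ∀ (s t : (halfRing k)ˣ) (x y : Torus k Λ), (s • x) * (t • y) = (s * t) • (x * y) := by
    intro s t x y
    change QuantumTorus.mulLin ((s : halfRing k) • x) ((t : halfRing k) • y) =
      ((s * t : (halfRing k)ˣ) : halfRing k) • QuantumTorus.mulLin x y
    rw [map_smul, map_smul, LinearMap.smul_apply, smul_smul, Units.val_mul, mul_comm]
  rw [ccTerm, ccTerm, e1, add_zero, add_zero, QuantumTorus.X_mul_X, smul_smul, ccTerm, smul_smul,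
    ← zpow_add, ← zpow_add, ← zpow_add, form_monomials hskew hcompat, add_zero, gZ_add,
    Matrix.mulVec_add]
  congr 2
  · simp only [euler_add_left, euler_add_right, euler_sub_right]
    ring
  · funext v
    simp only [Pi.add_apply, Pi.sub_apply]
    ring

end Characters

/-! ### The multiplication formula for a one-dimensional extension group. -/

section Multiplication

variable {k V : Type u} [Field k] [Finite k] [Fintype V] [DecidableEq V] [Quiver.{u} V]

theorem ccSum_extn (Λ : Matrix (V ⊕ V) (V ⊕ V) ℤ) {N L : QRep k V} (hN : N.IsFD) (hL : L.IsFD)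
    (z : ∀ i j : V, (i ⟶ j) → (N.obj j →ₗ[k] L.obj i)) (c : V ⊕ V → ℤ) :
    ccSum Λ (extn N L z) c = ∑ A ∈ hL.subs, ∑ C ∈ hN.subs,
      Nat.card {W // (extn N L z).IsSub W ∧ (fun v => (W v).comap (extnInl N L z v)) = A ∧
        (fun v => (W v).map (extnSnd N L z v)) = C} •
      ccTerm Λ (L.dimZ + N.dimZ) c (subDim A + subDim C) := by
  classical
  have hfd := isFD_extn (z := z) hN hL
  have hmaps : ∀ W ∈ hfd.subs, ((fun v => (W v).comap (extnInl N L z v),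
      fun v => (W v).map (extnSnd N L z v)) :
        (∀ v, Submodule k (L.obj v)) × (∀ v, Submodule k (N.obj v))) ∈ hL.subs ×ˢ hN.subs := by
    intro W hW
    rw [hfd.mem_subs] at hW
    exact Finset.mem_product.2 ⟨hL.mem_subs.2 (hW.comap isHom_extnInl),
      hN.mem_subs.2 (hW.map isHom_extnSnd)⟩
  rw [ccSum_eq Λ hfd, ← Finset.sum_product', ← Finset.sum_fiberwise_of_maps_to hmaps]
  refine Finset.sum_congr rfl fun x _ => ?_
  rw [Nat.subtype_card (hfd.subs.filter fun W => ((fun v => (W v).comap (extnInl N L z v),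
      fun v => (W v).map (extnSnd N L z v)) :
        (∀ v, Submodule k (L.obj v)) × (∀ v, Submodule k (N.obj v))) = x) fun W => by
        rw [Finset.mem_filter, hfd.mem_subs, Prod.ext_iff], ← Finset.sum_const]
  refine Finset.sum_congr rfl fun W hW => ?_
  rw [dimZ_extn hN hL, ← (Finset.mem_filter.1 hW).2]
  congr 1
  funext v
  have := hN v
  have := hL v
  exact (congrArg Nat.cast (finrank_eq_comap_add_map (k := k) (L := L.obj v) (N := N.obj v)
    (W v))).trans (Nat.cast_add _ _)

omit [DecidableEq V] in
/-- The submodules contained in the kernel of a surjection are those of the kernel. -/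
theorem sum_subs_of_exact {B : Type*} [AddCommMonoid B] {X Y T : QRep k V} (hX : X.IsFD)
    (hY : Y.IsFD) {f : ∀ v, X.obj v →ₗ[k] Y.obj v} (hf : IsHom X Y f)
    (hi : ∀ v, Function.Injective (f v)) {p : ∀ v, Y.obj v →ₗ[k] T.obj v}
    (hex : ∀ v y, p v y = 0 ↔ ∃ x, f v x = y) (φ : (V → ℤ) → B)
    [DecidablePred fun A : ∀ v, Submodule k (Y.obj v) => ∀ v, A v ≤ LinearMap.ker (p v)] :
    ∑ A ∈ hY.subs, (if ∀ v, A v ≤ LinearMap.ker (p v) then φ (subDim A) else 0) =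
      ∑ A ∈ hX.subs, φ (subDim A) := by
  have hr : ∀ v, LinearMap.ker (p v) = LinearMap.range (f v) := fun v => by
    ext y
    exact hex v y
  rw [← Finset.sum_filter]
  symm
  refine Finset.sum_bij (fun A _ v => (A v).map (f v)) ?_ ?_ ?_ ?_
  · intro A hA
    refine Finset.mem_filter.2 ⟨hY.mem_subs.2 ((hX.mem_subs.1 hA).map hf), fun v => ?_⟩
    rw [hr]
    exact LinearMap.map_le_range
  · intro A _ A' _ h
    exact funext fun v => Submodule.map_injective_of_injective (hi v) (congr_fun h v)
  · intro A hA
    obtain ⟨hA, hAp⟩ := Finset.mem_filter.1 hA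
    refine ⟨fun v => (A v).comap (f v), hX.mem_subs.2 ((hY.mem_subs.1 hA).comap hf), ?_⟩
    funext v
    rw [Submodule.map_comap_eq, inf_eq_right, ← hr]
    exact hAp v
  · intro A _
    congr 1
    funext v
    exact congrArg Nat.cast
      (LinearEquiv.finrank_eq (Submodule.equivMapOfInjective (f v) (hi v) (A v)))

omit [Finite k] [Fintype V] [DecidableEq V] in
theorem iso_restrict_top {X : QRep k V} {U : ∀ v, Submodule k (X.obj v)} (hU : X.IsSub U)
    (h : ∀ v, U v = ⊤) : Iso (X.restrict U hU) X :=
  (isHom_subtype hU).iso_of_bijective fun v =>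
    ⟨Subtype.val_injective, fun x => ⟨⟨x, (h v).symm ▸ Submodule.mem_top⟩, rfl⟩⟩

omit [Finite k] [Fintype V] [DecidableEq V] in
theorem dimZ_quot {X : QRep k V} (hX : X.IsFD) {U : ∀ v, Submodule k (X.obj v)} (hU : X.IsSub U) :
    (X.quot U hU).dimZ = X.dimZ - subDim U := by
  funext v
  have := hX v
  have h := Submodule.finrank_quotient_add_finrank (U v)
  have h1 : (X.quot U hU).dimVec v + Module.finrank k (U v) = X.dimVec v := h
  change ((X.quot U hU).dimVec v : ℤ) = (X.dimVec v : ℤ) - (Module.finrank k (U v) : ℤ)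
  omega

variable [∀ i j : V, Finite (i ⟶ j)]

omit [DecidableEq V] in
/-- The pairs of submodules whose extension group does not vanish. -/
theorem ext_restrict_quot_ne_zero_iff {N T L : QRep k V} (hN : N.IsFD) (hT : T.IsFD) (hL : L.IsFD)
    {p : ∀ v, L.obj v →ₗ[k] T.obj v} (hp : IsHom L T p) (hp0 : p ≠ 0) (hLT : hom L T = 1)
    (hAR : ∀ {Z : QRep k V}, Z.IsFD → ext N Z = hom Z T)
    (hsub : ∀ (C : ∀ v, Submodule k (N.obj v)) (hC : N.IsSub C), C ≠ ⊤ →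
      ext (N.restrict C hC) L = 0)
    {A : ∀ v, Submodule k (L.obj v)} (hA : L.IsSub A) {C : ∀ v, Submodule k (N.obj v)}
    (hC : N.IsSub C) :
    ext (N.restrict C hC) (L.quot A hA) ≠ 0 ↔ C = ⊤ ∧ ∀ v, A v ≤ LinearMap.ker (p v) := by
  have hQ := isFD_quot hL hA
  have hR := isFD_restrict hN hC
  have htop : C = ⊤ → (ext (N.restrict C hC) (L.quot A hA) ≠ 0 ↔
      ∀ v, A v ≤ LinearMap.ker (p v)) := by
    rintro rfl
    have e := iso_restrict_top hC fun _ => rfl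
    rw [e.ext_left hR hQ, hAR hQ, hom_ne_zero_iff hQ hT]
    constructor
    · rintro ⟨g, hg, hg0⟩ v x hx
      have hpk : (⟨p, mem_ker_extDiff.2 hp⟩ : LinearMap.ker (extDiff L T)) ≠ 0 := fun h =>
        hp0 (congrArg Subtype.val h)
      -- Hom(L, T) is the line spanned by `p`, so a nonzero morphism from `L / A` lifts to a nonzero
      -- multiple of `p`, and `p` vanishes on `A`.
      obtain ⟨c, hc⟩ := exists_smul_eq_of_finrank_eq_one hLT hpk
        ⟨_, mem_ker_extDiff.2 (hg.comp (isHom_mkQ hA))⟩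
      have hc : ∀ v y, c • p v y = g v ((A v).mkQ y) := fun v y =>
        LinearMap.congr_fun (congr_fun (congrArg Subtype.val hc) v) y
      have hc0 : c ≠ 0 := by
        rintro rfl
        refine hg0 (funext fun v => LinearMap.ext fun y => ?_)
        obtain ⟨y, rfl⟩ := (A v).mkQ_surjective y
        exact (hc v y).symm.trans (zero_smul k _)
      have h1 := hc v x
      rw [show (A v).mkQ x = 0 from (Submodule.Quotient.mk_eq_zero _).2 hx] at h1
      exact LinearMap.mem_ker.2
        ((smul_eq_zero_iff_right hc0).1 (h1.trans (map_zero (g v))))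
    · intro h
      refine ⟨fun v => (A v).liftQ (p v) (h v), fun i j a x => ?_, fun h0 => hp0 ?_⟩
      · obtain ⟨x, rfl⟩ := (A j).mkQ_surjective x
        exact hp i j a x
      · funext v
        refine LinearMap.ext fun x => ?_
        exact LinearMap.congr_fun (congr_fun h0 v) ((A v).mkQ x)
  refine ⟨fun h => ?_, fun h => (htop h.1).2 h.2⟩
  have hCt : C = ⊤ := by
    by_contra hCt
    have h1 := ext_le_of_surjective hR hL (isHom_mkQ hA) fun v => (A v).mkQ_surjective
    rw [hsub C hC hCt] at h1
    omega
  exact ⟨hCt, (htop hCt).1 h⟩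

/-- The identity holds for each pair of submodules `(A, C)`. If `Ext¹(C, L / A) = 0`, the product of
the two terms is the contribution of the submodules of the extension over that pair. Otherwise `C =
N` and `A` lies in the image of `L'`; no submodule lies over the pair, and the product is the term
of `A` in the second character. -/
theorem cc_mul_cc {Λ : Matrix (V ⊕ V) (V ⊕ V) ℤ} (hskew : Λ.transpose = -Λ)
    (hcompat : Λ * (-matBt V) = matIt V) {N T L L' : QRep k V} (hN : N.IsFD) (hT : T.IsFD)
    (hL : L.IsFD) (hL' : L'.IsFD) {f : ∀ v, L'.obj v →ₗ[k] L.obj v} (hf : IsHom L' L f)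
    (hi : ∀ v, Function.Injective (f v)) {p : ∀ v, L.obj v →ₗ[k] T.obj v} (hp : IsHom L T p)
    (hex : ∀ v y, p v y = 0 ↔ ∃ x, f v x = y) (hd : L.dimZ = L'.dimZ + T.dimZ) (hp0 : p ≠ 0)
    (hLT : hom L T = 1) (hAR : ∀ {Z : QRep k V}, Z.IsFD → ext N Z = hom Z T)
    (hsub : ∀ (C : ∀ v, Submodule k (N.obj v)) (hC : N.IsSub C), C ≠ ⊤ →
      ext (N.restrict C hC) L = 0)
    (hτ : ∀ x, euler x T.dimZ = -euler N.dimZ x) (h0 : hom N L = 0)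
    {z : ∀ i j : V, (i ⟶ j) → (N.obj j →ₗ[k] L.obj i)}
    (hz : z ∉ LinearMap.range (extDiff N L)) :
    cc Λ L * cc Λ N =
      (sqrtCard k ^ form Λ (gvec L.dimVec) (gvec N.dimVec)) • cc Λ (extn N L z) +
      (sqrtCard k ^ (form Λ (gvec L.dimVec) (gvec N.dimVec) - 1)) •
        ccShift Λ L' (frozenInj k N.dimVec) := by
  classical
  have h1 : ext N L = 1 := (hAR hL).trans hLT
  have hnl : euler N.dimZ L.dimZ = -1 := by
    rw [← hom_sub_ext hN hL, h0, h1]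
    rfl
  set lam := form Λ (gvec L.dimVec) (gvec N.dimVec) with hlam
  have hlam' : form Λ (gZ L.dimZ) (gZ N.dimZ) = lam := rfl
  have hterm : ∀ A ∈ hL.subs, ∀ C ∈ hN.subs,
      (ccTerm Λ L.dimZ 0 (subDim A) * ccTerm Λ N.dimZ 0 (subDim C) : Torus k Λ) =
      (sqrtCard k ^ lam) • (Nat.card {W // (extn N L z).IsSub W ∧
        (fun v => (W v).comap (extnInl N L z v)) = A ∧
        (fun v => (W v).map (extnSnd N L z v)) = C} •
          ccTerm Λ (L.dimZ + N.dimZ) 0 (subDim A + subDim C)) +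
      (if C = ⊤ then (if ∀ v, A v ≤ LinearMap.ker (p v) then (sqrtCard k ^ (lam - 1)) •
        ccTerm Λ L'.dimZ (fun v => ((frozenInj k N.dimVec).socDim v : ℤ)) (subDim A) else 0)
        else 0) := by
    intro A hA C hC
    rw [hL.mem_subs] at hA
    rw [hN.mem_subs] at hC
    have hiff := ext_restrict_quot_ne_zero_iff hN hT hL hp hp0 hLT hAR hsub hA hC
    have hR := isFD_restrict hN hC
    have hQ := isFD_quot hL hA
    rw [card_isSub_extn z hA hC, ccTerm_mul hskew hcompat, hlam', ← ite_and]
    by_cases he : ext (N.restrict C hC) (L.quot A hA) = 0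
    · rw [if_neg (mt hiff.2 (not_not.2 he)), add_zero]
      have heu := hom_sub_ext hR hQ
      rw [he, dimZ_quot hL hA] at heu
      rw [card_linear_fiber hR hQ ((ext_eq_zero_iff hR hQ).1 he _), card_pow_smul, smul_smul,
        ← zpow_add]
      congr 3
      have : (N.restrict C hC).dimZ = subDim C := rfl
      rw [this] at heu
      rw [← heu]
      simp
    · obtain ⟨hCt, hAp⟩ := hiff.1 he
      rw [if_pos ⟨hCt, hAp⟩]
      have hcard : Nat.card {h // extDiff (N.restrict C hC) (L.quot A hA) h =
          -cochainRes z hA hC} = 0 := by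
        refine Nat.card_eq_zero.2 (Or.inl ⟨fun h => ?_⟩)
        exact cochainRes_notMem_range hN hL h1 hz hA hC he ⟨h.1, h.2⟩
      have hCn : subDim C = N.dimZ := by
        rw [hCt]
        funext v
        exact congrArg Nat.cast (finrank_top k (N.obj v))
      have hmon := matBt_mulVec_sub_gZ (k := k) N.dimVec (fun _ => rfl) hd hτ
      rw [hcard, zero_smul, smul_zero, zero_add, hCn, ccTerm, ccTerm, smul_smul, smul_smul,
        ← zpow_add, ← zpow_add]
      congr 2
      -- The shift by one is `⟨N, L⟩ = -1`; by `hτ` the pairings of `A` with `N` and with `T`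
      -- cancel, which leaves the exponent of `A` as a submodule of `L'`.
      · rw [add_sub_add_right_eq_sub, euler_add_left, euler_sub_right, euler_sub_right,
          euler_sub_right, hnl, hd, euler_add_right, hτ]
        ring
      · rw [Matrix.mulVec_add, gZ_add, add_zero, add_sub_add_comm, ← sub_eq_zero]
        have h2 : (matBt V).mulVec N.dimZ - gZ N.dimZ - gZ L.dimZ = _ :=
          (sub_right_comm _ _ _).trans hmon
        rw [show ∀ a b c d : V ⊕ V → ℤ, a - b + (c - d) = a + (c - d - b) from
          fun a b c d => by abel, h2]
        abel
  rw [cc, cc, cc, ccShift, ccSum_eq Λ hL, ccSum_eq Λ hN, ccSum_eq Λ hL', ccSum_extn Λ hN hL,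
    Finset.sum_mul_sum, Finset.sum_congr rfl fun A hA => Finset.sum_congr rfl (hterm A hA)]
  simp only [Finset.sum_add_distrib, Finset.smul_sum]
  congr 1
  have hmem : (⊤ : ∀ v, Submodule k (N.obj v)) ∈ hN.subs :=
    hN.mem_subs.2 fun _ _ _ _ _ => Submodule.mem_top
  refine Eq.trans ?_ (sum_subs_of_exact hL' hL hf hi hex fun e => (sqrtCard k ^ (lam - 1)) •
    ccTerm Λ L'.dimZ (fun v => ((frozenInj k N.dimVec).socDim v : ℤ)) e)
  refine Finset.sum_congr rfl fun A _ => ?_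
  rw [Finset.sum_ite_eq' hN.subs, if_pos hmem]

omit [Finite k] [Fintype V] [DecidableEq V] [∀ i j : V, Finite (i ⟶ j)] in
theorem Iso.exists_exact_extn {N L X : QRep k V}
    {z : ∀ i j : V, (i ⟶ j) → (N.obj j →ₗ[k] L.obj i)} (h : Iso X (extn N L z)) :
    ∃ (f : ∀ v, L.obj v →ₗ[k] X.obj v) (p : ∀ v, X.obj v →ₗ[k] N.obj v), IsHom L X f ∧
      (∀ v, Function.Injective (f v)) ∧ IsHom X N p ∧ (∀ v, Function.Surjective (p v)) ∧
      ∀ v y, p v y = 0 ↔ ∃ x, f v x = y := by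
  obtain ⟨φ, hφ, hb⟩ := h.symm.exists_isHom
  obtain ⟨G, hG⟩ := h
  refine ⟨fun v => (G v).symm.toLinearMap ∘ₗ extnInl N L z v,
    fun v => extnSnd N L z v ∘ₗ (G v).toLinearMap, ?_,
    fun v => (G v).symm.injective.comp (extnInl_injective v),
    isHom_extnSnd.comp (f := fun v => (G v).toLinearMap) hG,
    fun v => (extnSnd_surjective v).comp (G v).surjective, fun v y => ⟨fun hy => ?_, ?_⟩⟩
  · refine IsHom.comp (Y := extn N L z) (g := fun v => (G v).symm.toLinearMap) ?_ isHom_extnInl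
    intro i j a x
    refine (G i).injective ?_
    exact ((G i).apply_symm_apply _).trans
      (((hG i j a _).trans (congrArg _ ((G j).apply_symm_apply x))).symm)
  · refine ⟨(G v y : L.obj v × N.obj v).1, (G v).injective ?_⟩
    refine ((G v).apply_symm_apply _).trans ?_
    exact Prod.ext rfl hy.symm
  · rintro ⟨x, rfl⟩
    exact congrArg Prod.snd ((G v).apply_symm_apply ((x, 0) : L.obj v × N.obj v))

end Multiplication

/-! ### Submodules of regular simple modules. -/

section Tube

variable {k V : Type u} [Field k] [Finite k] [Quiver.{u} V] [Fintype V]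
  [∀ i j : V, Finite (i ⟶ j)] {r : ℕ} {E : ZMod r → QRep k V} {i : ZMod r}

/-- Proper submodules of a regular simple module have no extensions by the modules of its tube. -/
theorem Tower.ext_restrict_eq_zero (hE : IsNonhomogeneousTube r E) (hQ : IsAcyclic V) {l : ℕ}
    {L : QRep k V} (hL : Tower E i l L) {j : ZMod r} {C : ∀ v, Submodule k ((E j).obj v)}
    (hC : (E j).IsSub C) (h : C ≠ ⊤) : ext ((E j).restrict C hC) L = 0 := by
  have hCfd := isFD_restrict (hE.isFD j) hC
  refine hL.ext_right_eq_zero hE hCfd fun m _ => ?_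
  rw [hE.ext_right hQ _ hCfd]
  by_contra h0
  obtain ⟨g, hg, hg0⟩ := (hom_ne_zero_iff (hE.isFD _) hCfd).1 h0
  refine h (funext fun v => eq_top_iff.2 fun x _ => ?_)
  -- A nonzero morphism from a regular simple of the tube to `C`, followed by the inclusion into `E
  -- j`, is bijective, which makes `C` everything.
  have hb := hE.bijective hQ _ (hE.regularSimple j) ((isHom_subtype hC).comp hg) (fun h1 => hg0
    (funext fun v => LinearMap.ext fun y =>
      Subtype.val_injective (LinearMap.congr_fun (congr_fun h1 v) y))) v
  obtain ⟨y, rfl⟩ := hb.2 x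
  exact (g v y : C v).2

end Tube

end QRep

end QuiverCC

end

/-! ### The multiplication formula in a tube. -/

open QuiverCC QuiverCC.QRep in
theorem mainTheorem11 {k V : Type u} [Field k] [Finite k] [Fintype V] [DecidableEq V]
    [Quiver.{u} V] [∀ i j : V, Finite (i ⟶ j)]
    (hQ : IsTameQuiver V) (hgr : IsGraded V)
    (Λ : Matrix (V ⊕ V) (V ⊕ V) ℤ) (hskew : Λ.transpose = -Λ)
    (hcompat : Λ * (-matBt V) = matIt V)
    (r : ℕ) (E : ZMod r → QRep k V) (hE : IsNonhomogeneousTube r E) (i : ZMod r)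
    (M M' M'' : QRep k V)
    (hM : IsTubeModule (E i) r M)
    (hM' : IsTubeModule (E i) (r - 1) M')
    (hM'' : IsTubeModule (E i) (r - 2) M'') :
    cc Λ M' * cc Λ (E (i - 1)) =
      (sqrtCard k ^ form Λ (gvec M'.dimVec) (gvec (E (i - 1)).dimVec)) • cc Λ M +
      (sqrtCard k ^ (form Λ (gvec M'.dimVec) (gvec (E (i - 1)).dimVec) - 1)) •
        ccShift Λ M'' (frozenInj k (E (i - 1)).dimVec) := by
  have hQ := hQ.1
  -- This removes the truncated subtractions: `r - 1` and `r - 2` become `s + 1` and `s`.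
  obtain ⟨s, rfl⟩ : ∃ s, r = s + 2 := ⟨r - 2, (Nat.sub_add_cancel hE.two_le).symm⟩
  have hM' : IsTubeModule (E i) (s + 1) M' := hM'
  have hM'' : IsTubeModule (E i) s M'' := hM''
  -- Modulo `r`, the module `E (i - 1)` is the top layer of the tower of length `r`.
  have hi1 : i - 1 = i + ((s + 1 : ℕ) : ZMod (s + 2)) := by
    have h : ((s + 2 : ℕ) : ZMod (s + 2)) = 0 := ZMod.natCast_self _
    push_cast at h ⊢
    linear_combination -h
  have hj : i + ((s + 1 : ℕ) : ZMod (s + 2)) = i + (s : ZMod (s + 2)) + 1 := by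
    push_cast
    ring
  rw [hi1]
  -- Removing the top layer of `M` leaves `L`, isomorphic to `M'`; removing one more leaves `L'`,
  -- isomorphic to `M''`, with quotient `E (i + s)`, the translate of `E (i - 1)`.
  obtain ⟨L, z, hL, hz, e⟩ := hM.tower hE hQ
  have hLM := hL.iso hE hQ (hM'.tower hE hQ)
  have hLfd := hL.isFD hE
  obtain ⟨L', z', hL', -, e'⟩ := id hL
  have hLM' := hL'.iso hE hQ (hM''.tower hE hQ)
  have hL'fd := hL'.isFD hE
  obtain ⟨f, p, hf, hfi, hp, hps, hex⟩ := e'.exists_exact_extn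
  have hNfd := hE.isFD (i + ((s + 1 : ℕ) : ZMod (s + 2)))
  have hTfd := hE.isFD (i + (s : ZMod (s + 2)))
  rw [← hLM.dimVec_eq, cc, cc, cc, ccShift, ← hLM.ccSum_eq hLfd, ← hLM'.ccSum_eq hL'fd,
    e.ccSum_eq (e.symm.isFD (isFD_extn hNfd hLfd))]
  refine cc_mul_cc hskew hcompat hNfd hTfd hLfd hL'fd hf hfi hp hex
    (e'.dimZ_eq.trans (dimZ_extn hTfd hL'fd)) ?_ ?_ ?_
    (fun C hC hCt => hL.ext_restrict_eq_zero hE hQ hC hCt) ?_ ?_ (hz (Nat.succ_ne_zero s))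
  · rintro rfl
    refine (hE.regularSimple (i + (s : ZMod (s + 2)))).1.1 fun v =>
      subsingleton_of_forall_eq 0 fun y => ?_
    obtain ⟨x, rfl⟩ := hps v y
    rfl
  · rw [hL.hom_eq hE hQ, if_pos rfl]
  · intro Z hZ
    rw [hj, hE.hom_right hQ _ hZ]
  · intro x
    rw [hj, hE.euler_right hQ]
  -- The `r - 1` layers of `L` have the indices other than `i - 1` modulo `r`.
  · refine hL.hom_right_eq_zero hE hNfd fun m hm => hE.hom_of_ne hQ fun h => ?_
    have h1 := congrArg ZMod.val (add_left_cancel h)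
    rw [ZMod.val_natCast, ZMod.val_natCast, Nat.mod_eq_of_lt (by omega),
      Nat.mod_eq_of_lt (by omega)] at h1
    omega
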